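/- Consider a Runge--Kutta scheme with $s$ stages and real coefficients $a_{ij}$, $b_i$, $c_i$ which is the implicit Euler scheme ($s=1$, $a_{11}=b_1=c_1=1$), or of order at least two ($\sum_j a_{ij}=c_i$, $\sum_i b_i=1$, $\sum_i b_ic_i=\tfrac12$), or the explicit Euler scheme ($s=1$, $a_{11}=c_1=0$, $b_1=1$). Put $C=2\sum_i b_i(1-c_i)$; thus $C=0$, $1$, $2$, respectively. For $d\ge 1$ let $R_0(d)$ be the interior of the set of all $(\alpha,\beta)\in(0,\infty)^2$ for which there are $c_1\le 0$ and $c_2\in\mathbb R$ such that, for all real $\eta_G,\eta_L,\eta_R,\eta_S$, $$ \begin{aligned} 0\le{}& \big(C+1+(1-\tfrac1d)c_1\big)\eta_L^2+\big((C+2)(\beta-\alpha)+(1-\tfrac1d)(2\beta-\alpha-1)c_1-(\tfrac2d+1)c_2\big)\eta_L\eta_G^2\\ &+\big((\beta-\alpha)^2-(2\beta-2\alpha-1)c_2\big)\eta_G^4-(d-1)\big((2\beta-\alpha-1)c_1+2c_2\big)\eta_S\eta_G^2-c_1\eta_R^2-d(d-1)c_1\eta_S^2 . \end{aligned} $$ Then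 $R_0(d)$ is a nonempty open subset of $(0,\infty)^2$, and the following holds. Let $\Omega\subset\mathbb R^d$ be a bounded convex open set with smooth boundary and outer normal $\nu$, let $\beta>0$, and consider the equation $\partial_t u=\Delta(u^\beta)$ in $\Omega$ with $\nabla u^\beta\cdot\nu=0$ on $\partial\Omega$. Fix $k\ge1$. Let $\tau_0>0$ and, for $0\le\tau<\tau_0$, let $u^{k-1}=u^{k-1}_\tau$, $u^k=u^k_\tau$, $K_i=K_{i,\tau}$ be functions in $C^\infty(\overline\Omega)$, depending continuously on $\tau\in[0,\tau_0)$ as elements of $C^\infty(\overline\Omega)$, such that in $\Omega$ $$ u^k=u^{k-1}+\tau\sum_{i=1}^s b_iK_i,\qquad K_i=\Delta(w_i^\beta),\qquad w_i=u^{k-1}+\tau\sum_{j=1}^s a_{ij}K_j ,\quad i=1,\dots,s, $$ where $u^{k-1},u^k,w_1,\dots,w_s$ are positive on $\overline\Omega$ and satisfy the boundary condition. (For instance, $u^k$ may be a fixed function, independent of $\tau$.) Assume that $u^k_\tau|_{\tau=0}$ is not constant. Then there is $\tau^k\in(0,\tau_0)$ such that for all $\alpha$ with $(\alpha,\beta)\in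 R_0(d)$ and all $0<\tau\le\tau^k$, $$ H[u^k]+\tau\beta\int_\Omega (u^k)^{\alpha+\beta-2}|\nabla u^k|^2\,dx\le H[u^{k-1}],\qquad H[u]=\frac1{\alpha(\alpha+1)}\int_\Omega u^{\alpha+1}\,dx . $$ In one space dimension, $R_0(1)=(0,\infty)^2$ for the implicit Euler scheme, $R_0(1)=\{(\alpha,\beta)\in(0,\infty)^2:-2<\alpha-\beta<1\}$ for schemes of order at least two, and $R_0(1)=\{(\alpha,\beta)\in(0,\infty)^2:-1<\alpha-\beta<1\}$ for the explicit Euler scheme. -/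

import Mathlib

open Set MeasureTheory Topology
open scoped ContDiff

noncomputable section

namespace PorousMediumRK

/-- The Euclidean space of dimension `d`. -/
abbrev Space (d : ℕ) := EuclideanSpace ℝ (Fin d)

/-! ### Runge-Kutta schemes -/

/-- The coefficients of a Runge-Kutta scheme with `s` stages. -/
structure RungeKutta (s : ℕ) where
  /-- the matrix of the scheme -/
  a : Fin s → Fin s → ℝ
  /-- the weights -/
  b : Fin s → ℝ
  /-- the knots -/
  c : Fin s → ℝ

namespace RungeKutta

variable {s : ℕ}

/-- Consistency: the rows of `a` sum up to the knots and the weights sum up to one. -/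
def IsConsistent (T : RungeKutta s) : Prop :=
  (∀ i, ∑ j, T.a i j = T.c i) ∧ ∑ i, T.b i = 1

/-- Order at least two, expressed by the order conditions. -/
def HasOrderAtLeastTwo (T : RungeKutta s) : Prop :=
  T.IsConsistent ∧ ∑ i, T.b i * T.c i = 1 / 2

/-- The implicit Euler scheme `u₁ = u₀ - τ A[u₁]`. -/
def IsImplicitEuler (T : RungeKutta s) : Prop :=
  s = 1 ∧ (∀ i j, T.a i j = 1) ∧ (∀ i, T.b i = 1) ∧ (∀ i, T.c i = 1)

/-- The explicit Euler scheme `u₁ = u₀ - τ A[u₀]`. -/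
def IsExplicitEuler (T : RungeKutta s) : Prop :=
  s = 1 ∧ (∀ i j, T.a i j = 0) ∧ (∀ i, T.b i = 1) ∧ (∀ i, T.c i = 0)

/-- The number `C_RK = 2 ∑ bᵢ (1 - cᵢ)`. -/
def CRK (T : RungeKutta s) : ℝ := 2 * ∑ i, T.b i * (1 - T.c i)

end RungeKutta

/-! ### The parameter region -/

/-- The polynomial `Q(η_G, η_L, η_R, η_S)` attached to the dimension `d`, the number `C = C_RK`,
the exponents `α`, `β` and the multipliers `c₁`, `c₂` of two integration-by-parts formulas. -/
def polyQ (d : ℕ) (C α β c₁ c₂ ηG ηL ηR ηS : ℝ) : ℝ :=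
  ((C + 1) + (1 - 1 / (d : ℝ)) * c₁) * ηL ^ 2
    + ((C + 2) * (β - α) + (1 - 1 / (d : ℝ)) * (2 * β - α - 1) * c₁
        - (2 / (d : ℝ) + 1) * c₂) * ηL * ηG ^ 2
    + ((β - α) ^ 2 - (2 * β - 2 * α - 1) * c₂) * ηG ^ 4
    + (-((d : ℝ) - 1) * ((2 * β - α - 1) * c₁ + 2 * c₂)) * ηS * ηG ^ 2
    + (-c₁) * ηR ^ 2
    + (-((d : ℝ) * ((d : ℝ) - 1) * c₁)) * ηS ^ 2

/-- The region `R₀(d)`, for the value `C` of `C_RK`: the interior of the set of all positive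
`(α, β)` such that `Q` is nonnegative on `ℝ⁴` for some `c₁ ≤ 0` and some real `c₂`. -/
def regionZero (d : ℕ) (C : ℝ) : Set (ℝ × ℝ) :=
  interior {p : ℝ × ℝ | 0 < p.1 ∧ 0 < p.2 ∧ ∃ c₁ c₂ : ℝ, c₁ ≤ 0 ∧
    ∀ ηG ηL ηR ηS : ℝ, 0 ≤ polyQ d C p.1 p.2 c₁ c₂ ηG ηL ηR ηS}

/-! ### Domains with smooth boundary and the Neumann condition -/

variable {d : ℕ}

/-- `ρ` is a smooth function with nonzero gradient at `x` which is negative exactly on `Ω` near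
`x`. If `x` is a boundary point of `Ω`, then `∇ρ(x) / |∇ρ(x)|` is the outer unit normal at `x`. -/
def IsDefiningFunctionAt (Ω : Set (Space d)) (x : Space d) (ρ : Space d → ℝ) : Prop :=
  ContDiff ℝ ∞ ρ ∧ gradient ρ x ≠ 0 ∧ ∀ᶠ y in 𝓝 x, (y ∈ Ω ↔ ρ y < 0)

/-- The boundary of `Ω` is smooth, and `Ω` lies on one side of it. -/
def HasSmoothBoundary (Ω : Set (Space d)) : Prop :=
  ∀ x ∈ frontier Ω, ∃ ρ : Space d → ℝ, IsDefiningFunctionAt Ω x ρ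

/-- The homogeneous Neumann condition `∇f · ν = 0` on the boundary of `Ω`. -/
def Neumann (Ω : Set (Space d)) (f : Space d → ℝ) : Prop :=
  ∀ x ∈ frontier Ω, ∀ ρ : Space d → ℝ, IsDefiningFunctionAt Ω x ρ →
    fderivWithin ℝ f (closure Ω) x (gradient ρ x) = 0

/-! ### The scheme for the porous-medium equation -/

/-- The porous-medium operator `A[w] = -Δ(w ^ β)`. -/
def pmOperator (β : ℝ) (w : Space d → ℝ) (x : Space d) : ℝ :=
  -_root_.Laplacian.laplacian (fun y => w y ^ β) x

/-- `w` is an admissible state: smooth up to the boundary, positive, and `∇(w ^ β) · ν = 0`. -/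
def Admissible (Ω : Set (Space d)) (β : ℝ) (w : Space d → ℝ) : Prop :=
  ContDiffOn ℝ ∞ w (closure Ω) ∧ (∀ x ∈ closure Ω, 0 < w x) ∧ Neumann Ω (fun y => w y ^ β)

/-- The `i`-th argument `v + τ ∑ aᵢⱼ Kⱼ` of the operator in a Runge-Kutta step. -/
def stage {s : ℕ} (T : RungeKutta s) (τ : ℝ) (v : Space d → ℝ) (K : Fin s → Space d → ℝ)
    (i : Fin s) (x : Space d) : ℝ :=
  v x + τ * ∑ j, T.a i j * K j x

/-- `u` arises from `v` by one Runge-Kutta step of size `τ` for the porous-medium equation on `Ω`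
with Neumann conditions; the `K i` are the increments. -/
structure IsStep {s : ℕ} (T : RungeKutta s) (Ω : Set (Space d)) (β τ : ℝ)
    (v u : Space d → ℝ) (K : Fin s → Space d → ℝ) : Prop where
  old_admissible : Admissible Ω β v
  new_admissible : Admissible Ω β u
  stage_admissible : ∀ i, Admissible Ω β (stage T τ v K i)
  increment_smooth : ∀ i, ContDiffOn ℝ ∞ (K i) (closure Ω)
  increment_eq : ∀ i, ∀ x ∈ Ω, K i x = -pmOperator β (stage T τ v K i) x
  update_eq : ∀ x ∈ Ω, u x = v x + τ * ∑ i, T.b i * K i x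

/-- `τ ↦ f τ` is continuous on `[0, τ₀)` with values in `C^∞` of the closure of `Ω`: every spatial
derivative of `f` is jointly continuous in `(τ, x)`. -/
def ContinuousFamily (Ω : Set (Space d)) (τ₀ : ℝ) (f : ℝ → Space d → ℝ) : Prop :=
  ∀ n : ℕ, ContinuousOn
    (fun p : ℝ × Space d => iteratedFDerivWithin ℝ n (f p.1) (closure Ω) p.2)
    (Ico 0 τ₀ ×ˢ closure Ω)

/-- A family of solutions of one step of the scheme, parametrized by the step size
`τ ∈ [0, τ₀)` and depending continuously on it, down to `τ = 0`. -/
structure IsStepFamily {s : ℕ} (T : RungeKutta s) (Ω : Set (Space d)) (β τ₀ : ℝ)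
    (v u : ℝ → Space d → ℝ) (K : ℝ → Fin s → Space d → ℝ) : Prop where
  isStep : ∀ τ ∈ Ico 0 τ₀, IsStep T Ω β τ (v τ) (u τ) (K τ)
  old_continuous : ContinuousFamily Ω τ₀ v
  new_continuous : ContinuousFamily Ω τ₀ u
  increment_continuous : ∀ i, ContinuousFamily Ω τ₀ (fun τ => K τ i)

/-! ### Entropy and entropy production -/

/-- The zeroth-order entropy `H[u] = (α (α + 1))⁻¹ ∫_Ω u ^ (α + 1)`. -/
def entropy (Ω : Set (Space d)) (α : ℝ) (u : Space d → ℝ) : ℝ :=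
  1 / (α * (α + 1)) * ∫ x in Ω, u x ^ (α + 1)

/-- The entropy production `β ∫_Ω u ^ (α + β - 2) |∇u| ^ 2`. -/
def production (Ω : Set (Space d)) (α β : ℝ) (u : Space d → ℝ) : ℝ :=
  β * ∫ x in Ω, u x ^ (α + β - 2) * ‖gradient u x‖ ^ 2

end PorousMediumRK

end

/-!
# Discrete entropy inequalities for Runge-Kutta schemes for the porous-medium equation

Write `u` for the new and `v = u - τ ∑ bᵢ Kᵢ` for the old state, and `C` for `T.CRK`. The entropy
density is convex, with second derivative at least `min (u ^ (α - 1)) (v ^ (α - 1))` between the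
two states. Testing the equation of each stage with the derivative of the density at `u` and
integrating by parts, one finds that `H[v] - H[u] - τ P[u]`, with the entropy production `P`, is
at least an integral of the form `τ² ∫ defect` (`IsStep.le_entropy_sub`,
`IsStep.integral_defect_le`). For the implicit Euler scheme the only stage is `u` itself, the
lower bound is the integral of a square with a positive weight, and nothing more is needed
(`IsStep.entropy_le_of_isImplicitEuler`).

For the other schemes, let `τ → 0`. All increments tend to `Δ(u ^ β)`, the stages are `u + τ (cᵢ -
1) Δ(u ^ β)` to first order, and `∫ defect` tends to half the second variation
(`IsStepFamily.tendsto_integral_defect`), which with `w = log u` and `m = 2 β + α - 1` is `β² ∫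
exp (m w) ((Δw + β |∇w|²)² + C (Δw + β |∇w|²) (Δw + α |∇w|²))` (`integral_secondVariation_eq`).
Two integrals can be added to it:

* `∫ exp (m w) (|∇w|² Δw + 2 ⟪D²w ∇w, ∇w⟫ + m |∇w|⁴) = 0` (`integral_hessGrad`), with any real
  factor `-c₂`;
* `∫ exp (m w) ((Δw)² - |D²w|² + m (|∇w|² Δw - ⟪D²w ∇w, ∇w⟫)) ≥ 0` (`integral_hessSq_nonneg`),
  with a factor `c₁ ≤ 0`. The sign comes from `⟪D²w ∇w, ν⟫ ≤ 0` on the boundary of a convex domain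
  (`sum_hessian_mul_normal_nonpos`).

Splitting `D²w + α ∇w ⊗ ∇w` into its trace, its traceless part in direction `∇w` and the rest, the
sum of the integrands becomes `exp (m w)` times a value of the polynomial `Q`
(`exists_secondVar_eq_polyQ`), so the second variation is nonnegative. It is even positive,
although `Q` may be degenerate (`integral_secondVar_pos`): were it zero, then `Q` would vanish at
every point, so its arguments would be critical points of `Q`, which forces either `Δw + a |∇w|² =
0` or `D²w = f I + b ∇w ⊗ ∇w` with constants `a` or `b`; with Neumann conditions both make `w`
constant (`exists_const_of_lap_add`, `exists_const_of_hessian`). Since this covers the closed set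
of all feasible `α`, which is bounded, compactness gives a step size that works for all of them at
once (`isCompact_feasible`, `IsStepFamily.exists_entropy_le`).

The integrations by parts rest on the divergence theorem on convex domains
(`integral_div_nonpos`), which is obtained by testing with the cutoff function `min (1, dist (x,
Ωᶜ) / ε)`: its gradient points away from the nearest boundary point, where the smoothness of the
boundary identifies that direction with the normal.

In dimension one, `Q` reduces to a quadratic polynomial in `η_L / η_G²` and feasibility to a
condition on its discriminant, which is again quadratic in `c₂` (`regionZero_one_zero`,
`regionZero_one_one`, `regionZero_one_two`). The same discriminant condition is necessary in every
dimension and, for `C = 1` and `C = 2`, bounds `α` in terms of `β`.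
-/

noncomputable section

namespace PorousMediumRK

open Filter
open scoped RealInnerProductSpace

section

/-! ### Integration over convex domains -/

variable {d : ℕ} {Ω : Set (Space d)}

/-- Bounded convex domains with smooth boundary in a space of positive dimension. -/
structure IsSmoothConvexDomain (Ω : Set (Space d)) : Prop where
  one_le_dim : 1 ≤ d
  isOpen : IsOpen Ω
  isBounded : Bornology.IsBounded Ω
  convex : Convex ℝ Ω
  nonempty : Ω.Nonempty
  smooth : HasSmoothBoundary Ω

/-- The partial derivative `∂ᵢ f` relative to the set `s`. For `s = closure Ω` it makes sense up to
the boundary. -/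
def pd (s : Set (Space d)) (i : Fin d) (f : Space d → ℝ) (x : Space d) : ℝ :=
  fderivWithin ℝ f s x (EuclideanSpace.single i 1)

/-! ### Normal vectors -/

/-- If `v ↦ ⟪g, v⟫` is nonpositive on an open half-space, then `g` is a nonnegative multiple of
the normal of that half-space. -/
lemma exists_nonneg_smul_of_forall_inner {E : Type*} [NormedAddCommGroup E]
    [InnerProductSpace ℝ E] {n g : E} (hn : n ≠ 0)
    (h : ∀ v, ⟪n, v⟫ < 0 → ⟪g, v⟫ ≤ 0) : ∃ l : ℝ, 0 ≤ l ∧ g = l • n := by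
  have hnn : 0 < ⟪n, n⟫ := real_inner_self_pos.2 hn
  have horth : ∀ v, ⟪n, v⟫ = 0 → ⟪g, v⟫ ≤ 0 := by
    intro v hv
    refine le_of_forall_pos_le_add fun e he => ?_
    obtain ⟨t, ht, hte⟩ : ∃ t : ℝ, 0 < t ∧ t * |⟪g, n⟫| ≤ e :=
      ⟨e / (|⟪g, n⟫| + 1), by positivity, by
        rw [div_mul_eq_mul_div, div_le_iff₀ (by positivity)]; nlinarith [abs_nonneg ⟪g, n⟫]⟩
    have := h (v - t • n) (by rw [inner_sub_right, inner_smul_right, hv]; nlinarith)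
    rw [inner_sub_right, inner_smul_right] at this
    nlinarith [le_abs_self ⟪g, n⟫]
  refine ⟨⟪g, n⟫ / ⟪n, n⟫, div_nonneg ?_ hnn.le, ?_⟩
  · have := h (-n) (by rw [inner_neg_right]; linarith)
    rw [inner_neg_right] at this; linarith
  · have h1 : ⟪n, g - (⟪g, n⟫ / ⟪n, n⟫) • n⟫ = 0 := by
      rw [inner_sub_right, inner_smul_right, div_mul_cancel₀ _ hnn.ne', real_inner_comm, sub_self]
    have h2 := horth _ h1
    have h3 : ⟪g - (⟪g, n⟫ / ⟪n, n⟫) • n, g - (⟪g, n⟫ / ⟪n, n⟫) • n⟫ ≤ 0 := by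
      nth_rewrite 1 [inner_sub_left]
      rw [inner_smul_left, h1]; simpa using h2
    exact sub_eq_zero.1 (inner_self_eq_zero.1 (le_antisymm h3 real_inner_self_nonneg))

lemma inner_gradient_nonpos_of_eventually {E : Type*} [NormedAddCommGroup E]
    [InnerProductSpace ℝ E] [CompleteSpace E] {ρ : E → ℝ} {y v : E}
    (hρ : DifferentiableAt ℝ ρ y) (h0 : 0 ≤ ρ y)
    (h : ∀ᶠ t : ℝ in 𝓝[>] 0, ρ (y + t • v) ≤ 0) : ⟪gradient ρ y, v⟫ ≤ 0 := by
  have hg : HasFDerivAt ρ (fderiv ℝ ρ y) (y + (0 : ℝ) • v) := by simpa using hρ.hasFDerivAt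
  have hl : HasDerivAt (fun t : ℝ => y + t • v) v 0 := by
    simpa using ((hasDerivAt_id (0 : ℝ)).smul_const v).const_add y
  have hd : HasDerivAt (fun t : ℝ => ρ (y + t • v)) (fderiv ℝ ρ y v) 0 :=
    hg.comp_hasDerivAt (0 : ℝ) hl
  have hgr : ⟪gradient ρ y, v⟫ = fderiv ℝ ρ y v := by
    rw [gradient, InnerProductSpace.toDual_symm_apply]
  rw [hgr]
  have ht := (hasDerivAt_iff_tendsto_slope.1 hd).mono_left
    (nhdsWithin_mono _ (fun x (hx : 0 < x) => hx.ne') : 𝓝[>] (0 : ℝ) ≤ 𝓝[≠] 0)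
  refine le_of_tendsto ht ?_
  filter_upwards [h, self_mem_nhdsWithin] with t h1 h2
  rw [slope_def_field]
  simp only [zero_smul, add_zero, sub_zero]
  exact div_nonpos_of_nonpos_of_nonneg (by linarith) (le_of_lt h2)

lemma IsDefiningFunctionAt.nonneg {y : Space d} {ρ : Space d → ℝ}
    (h : IsDefiningFunctionAt Ω y ρ) (hy : y ∉ Ω) : 0 ≤ ρ y :=
  not_lt.1 fun hc => hy ((h.2.2.self_of_nhds).2 hc)

lemma IsDefiningFunctionAt.differentiableAt {y : Space d} {ρ : Space d → ℝ}
    (h : IsDefiningFunctionAt Ω y ρ) (x : Space d) : DifferentiableAt ℝ ρ x :=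
  (h.1.differentiable (by simp)) x

lemma eventually_of_eventually_segment {E : Type*} [NormedAddCommGroup E] [NormedSpace ℝ E]
    {y v : E} {p : E → Prop} (h : ∀ᶠ z in 𝓝 y, p z) : ∀ᶠ t : ℝ in 𝓝[>] 0, p (y + t • v) := by
  have : Tendsto (fun t : ℝ => y + t • v) (𝓝[>] 0) (𝓝 y) := by
    have hc : Continuous fun t : ℝ => y + t • v := by fun_prop
    have := hc.tendsto 0
    simp only [zero_smul, add_zero] at this
    exact this.mono_left nhdsWithin_le_nhds
  exact this.eventually h

/-- At a boundary point touched from inside by a ball, the direction from the center of the ball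
is that of the outer normal. -/
lemma IsDefiningFunctionAt.exists_smul_gradient_of_ball {x y : Space d} {ρ : Space d → ℝ}
    (h : IsDefiningFunctionAt Ω y ρ) (hy : y ∉ Ω) (hxy : x ≠ y)
    (hball : Metric.ball x (dist x y) ⊆ Ω) : ∃ l : ℝ, 0 ≤ l ∧ y - x = l • gradient ρ y := by
  have hn : y - x ≠ 0 := sub_ne_zero.2 hxy.symm
  obtain ⟨l, hl, hg⟩ : ∃ l : ℝ, 0 ≤ l ∧ gradient ρ y = l • (y - x) := by
    refine exists_nonneg_smul_of_forall_inner hn fun v hv => ?_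
    refine inner_gradient_nonpos_of_eventually (h.differentiableAt y) (h.nonneg hy) ?_
    have hsmall : ∀ᶠ t : ℝ in 𝓝[>] 0, 2 * ⟪y - x, v⟫ + t * ‖v‖ ^ 2 < 0 := by
      have hc : Continuous fun t : ℝ => 2 * ⟪y - x, v⟫ + t * ‖v‖ ^ 2 := by fun_prop
      refine nhdsWithin_le_nhds ((hc.tendsto 0).eventually_lt_const ?_)
      linarith
    filter_upwards [hsmall, self_mem_nhdsWithin,
      eventually_of_eventually_segment (v := v) h.2.2] with t ht ht0 hiff
    refine (hiff.1 (hball ?_)).le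
    rw [Metric.mem_ball, dist_eq_norm, dist_eq_norm, ← sq_lt_sq₀ (norm_nonneg _) (norm_nonneg _),
      show y + t • v - x = (y - x) + t • v by abel, norm_add_sq_real, norm_smul, inner_smul_right,
      norm_sub_rev x y, Real.norm_of_nonneg (le_of_lt ht0)]
    have : 0 < t := ht0
    nlinarith
  have hl0 : l ≠ 0 := fun h0 => h.2.1 (by rw [hg, h0, zero_smul])
  exact ⟨l⁻¹, inv_nonneg.2 hl, by rw [hg, smul_smul, inv_mul_cancel₀ hl0, one_smul]⟩

/-- The outer normal at a boundary point of a convex set supports the set. -/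
lemma IsDefiningFunctionAt.inner_le_zero {x y : Space d} {ρ : Space d → ℝ}
    (h : IsDefiningFunctionAt Ω y ρ) (ho : IsOpen Ω) (hc : Convex ℝ Ω) (hy : y ∈ frontier Ω)
    (hx : x ∈ closure Ω) : ⟪gradient ρ y, x - y⟫ ≤ 0 := by
  rw [frontier, ho.interior_eq] at hy
  have key : ∀ z ∈ Ω, ⟪gradient ρ y, z - y⟫ ≤ 0 := by
    intro z hz
    refine inner_gradient_nonpos_of_eventually (h.differentiableAt y) (h.nonneg hy.2) ?_
    filter_upwards [Ioo_mem_nhdsGT (zero_lt_one' ℝ),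
      eventually_of_eventually_segment (v := z - y) h.2.2] with t ht hiff
    refine (hiff.1 ?_).le
    have := hc.combo_interior_closure_mem_interior (by rwa [ho.interior_eq]) hy.1 ht.1
      (by linarith [ht.2] : 0 ≤ 1 - t) (by ring)
    rw [ho.interior_eq] at this
    convert this using 1
    module
  have hcl : IsClosed {z : Space d | ⟪gradient ρ y, z - y⟫ ≤ 0} :=
    isClosed_le (by fun_prop) continuous_const
  exact closure_minimal key hcl hx

/-! ### The divergence theorem -/

section domain

lemma IsSmoothConvexDomain.isCompact_closure (hΩ : IsSmoothConvexDomain Ω) :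
    IsCompact (closure Ω) := hΩ.isBounded.isCompact_closure

lemma IsSmoothConvexDomain.uniqueDiffOn (hΩ : IsSmoothConvexDomain Ω) :
    UniqueDiffOn ℝ (closure Ω) :=
  uniqueDiffOn_convex hΩ.convex.closure
    (hΩ.nonempty.mono (interior_maximal subset_closure hΩ.isOpen))

lemma IsSmoothConvexDomain.closure_mem_nhds (hΩ : IsSmoothConvexDomain Ω) {x : Space d}
    (hx : x ∈ Ω) : closure Ω ∈ 𝓝 x :=
  mem_of_superset (hΩ.isOpen.mem_nhds hx) subset_closure

lemma IsSmoothConvexDomain.compl_nonempty (hΩ : IsSmoothConvexDomain Ω) : (Ωᶜ).Nonempty := by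
  by_contra hne
  rw [not_nonempty_iff_eq_empty, compl_empty_iff] at hne
  have : Nonempty (Fin d) := ⟨⟨0, hΩ.one_le_dim⟩⟩
  have hb := hΩ.isBounded
  rw [hne] at hb
  exact (NormedSpace.unbounded_univ ℝ (Space d)) hb

lemma IsSmoothConvexDomain.volume_ne_top (hΩ : IsSmoothConvexDomain Ω) : volume Ω ≠ ⊤ :=
  hΩ.isBounded.measure_lt_top.ne

lemma IsSmoothConvexDomain.integrableOn (hΩ : IsSmoothConvexDomain Ω) {f : Space d → ℝ}
    (hf : ContinuousOn f (closure Ω)) : IntegrableOn f Ω :=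
  (hf.integrableOn_compact hΩ.isCompact_closure).mono_set subset_closure

end domain

/-- The cutoff function `min (1, dist (x, Ωᶜ) / ε)`. -/
def cutoff (Ω : Set (Space d)) (ε : ℝ) (x : Space d) : ℝ := min 1 (Metric.infDist x Ωᶜ / ε)

lemma cutoff_nonneg {ε : ℝ} (hε : 0 < ε) (x : Space d) : 0 ≤ cutoff Ω ε x :=
  le_min zero_le_one (div_nonneg Metric.infDist_nonneg hε.le)

lemma cutoff_le_one {ε : ℝ} (x : Space d) : cutoff Ω ε x ≤ 1 := min_le_left _ _

lemma cutoff_eq_zero {ε : ℝ} {x : Space d} (hx : x ∉ Ω) : cutoff Ω ε x = 0 := by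
  rw [cutoff, Metric.infDist_zero_of_mem (by simpa using hx)]; simp

lemma exists_lipschitzWith_cutoff {ε : ℝ} (hε : 0 < ε) :
    ∃ K, LipschitzWith K (cutoff Ω ε) := by
  refine ⟨⟨ε⁻¹, (inv_pos.2 hε).le⟩, LipschitzWith.const_min ?_ 1⟩
  refine LipschitzWith.of_dist_le_mul fun x y => ?_
  have h := (Metric.lipschitz_infDist_pt (Ωᶜ)).dist_le_mul x y
  rw [Real.dist_eq] at h ⊢
  rw [← sub_div, abs_div, abs_of_pos hε, div_eq_inv_mul]
  refine mul_le_mul_of_nonneg_left ?_ (inv_pos.2 hε).le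
  simpa using h

lemma hasCompactSupport_cutoff (hΩ : IsSmoothConvexDomain Ω) {ε : ℝ} :
    HasCompactSupport (cutoff Ω ε) :=
  HasCompactSupport.intro hΩ.isCompact_closure fun _ hx =>
    cutoff_eq_zero fun h => hx (subset_closure h)

/-- Where it does not vanish, the gradient of the cutoff function points in the direction opposite
to a nearest boundary point. -/
lemma fderiv_cutoff (hΩ : IsSmoothConvexDomain Ω) {ε : ℝ} (hε : 0 < ε) {x : Space d}
    (hd : DifferentiableAt ℝ (cutoff Ω ε) x) :
    fderiv ℝ (cutoff Ω ε) x = 0 ∨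
      ∃ y ∈ frontier Ω, x ∈ Ω ∧ x ≠ y ∧ dist x y < ε ∧ Metric.infDist x Ωᶜ = dist x y ∧
        Metric.ball x (dist x y) ⊆ Ω ∧
        ∀ v, fderiv ℝ (cutoff Ω ε) x v = - (ε⁻¹ * ((dist x y)⁻¹ * ⟪y - x, v⟫)) := by
  by_cases hx : x ∈ Ω
  swap
  · left
    refine IsLocalMin.fderiv_eq_zero (Eventually.of_forall fun z => ?_)
    rw [cutoff_eq_zero hx]; exact cutoff_nonneg hε z
  by_cases h1 : ε ≤ Metric.infDist x Ωᶜ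
  · left
    refine IsLocalMax.fderiv_eq_zero (Eventually.of_forall fun z => ?_)
    have : cutoff Ω ε x = 1 := min_eq_left ((one_le_div hε).2 h1)
    rw [this]; exact cutoff_le_one z
  right
  push Not at h1
  have hcl : IsClosed Ωᶜ := hΩ.isOpen.isClosed_compl
  obtain ⟨y, hy, hxy⟩ := hcl.exists_infDist_eq_dist hΩ.compl_nonempty x
  have hne : x ≠ y := fun h => hy (h ▸ hx)
  have hball : Metric.ball x (dist x y) ⊆ Ω := by
    intro z hz
    by_contra hzΩ
    have := Metric.infDist_le_dist_of_mem (x := x) (show z ∈ Ωᶜ from hzΩ)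
    rw [Metric.mem_ball, dist_comm] at hz
    linarith
  have hpos : 0 < dist x y := dist_pos.2 hne
  refine ⟨y, ⟨?_, by rw [hΩ.isOpen.interior_eq]; exact hy⟩, hx, hne, hxy ▸ h1, hxy, hball, ?_⟩
  · refine closure_mono hball ?_
    rw [closure_ball _ hpos.ne', Metric.mem_closedBall, dist_comm]
  -- the cutoff is touched from above at `x` by the smooth function `z ↦ |z - y| / ε`
  have hnz : x - y ≠ 0 := sub_ne_zero.2 hne
  have hsq : HasFDerivAt (fun z : Space d => ‖z - y‖ ^ 2) (2 • (innerSL ℝ (x - y))) x := by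
    simpa using ((hasFDerivAt_id x).sub_const y).norm_sq
  have hψ : HasFDerivAt (fun z : Space d => ε⁻¹ * ‖z - y‖)
      (ε⁻¹ • ((1 / (2 * Real.sqrt (‖x - y‖ ^ 2))) • (2 • (innerSL ℝ (x - y))))) x := by
    have := (hsq.sqrt (by positivity)).const_mul ε⁻¹
    simpa [Real.sqrt_sq] using this
  have hmax : IsLocalMax (fun z => cutoff Ω ε z - ε⁻¹ * ‖z - y‖) x := by
    refine Eventually.of_forall fun z => ?_
    have e1 : cutoff Ω ε x = ε⁻¹ * ‖x - y‖ := by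
      rw [cutoff, hxy, dist_eq_norm, min_eq_right, div_eq_inv_mul]
      rw [div_le_one hε, ← dist_eq_norm, ← hxy]; exact h1.le
    have e2 : cutoff Ω ε z ≤ ε⁻¹ * ‖z - y‖ := by
      refine (min_le_right _ _).trans ?_
      rw [div_eq_inv_mul]
      refine mul_le_mul_of_nonneg_left ?_ (inv_pos.2 hε).le
      rw [← dist_eq_norm]
      exact Metric.infDist_le_dist_of_mem hy
    show cutoff Ω ε z - ε⁻¹ * ‖z - y‖ ≤ cutoff Ω ε x - ε⁻¹ * ‖x - y‖
    linarith
  have h0 := hmax.hasFDerivAt_eq_zero (hd.hasFDerivAt.sub hψ)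
  intro v
  have h2 := DFunLike.congr_fun h0 v
  simp only [sub_apply, smul_apply,
    innerSL_apply_apply, zero_apply, smul_eq_mul, Real.sqrt_sq (norm_nonneg _),
    nsmul_eq_mul] at h2
  have hnorm : ‖x - y‖ ≠ 0 := norm_ne_zero_iff.2 hnz
  rw [dist_eq_norm, ← neg_sub x y, inner_neg_left]
  rw [sub_eq_zero] at h2
  rw [h2]
  field_simp
  norm_num

/-- The divergence theorem for vector fields pointing inwards along the boundary, in the form of
an inequality. Testing the divergence with the cutoff function leaves the integral over a thin
strip of the component of the field normal to the boundary, up to an error of the order of the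
measure of the strip. -/
theorem integral_div_nonpos (hΩ : IsSmoothConvexDomain Ω) {F : Fin d → Space d → ℝ}
    (hF : ∀ i, ContDiffOn ℝ 1 (F i) (closure Ω))
    (hn : ∀ y ∈ frontier Ω, ∀ ρ : Space d → ℝ, IsDefiningFunctionAt Ω y ρ →
      ∑ i, F i y * gradient ρ y i ≤ 0) :
    ∫ x in Ω, ∑ i, pd (closure Ω) i (F i) x ≤ 0 := by
  -- extend the field to a Lipschitz field on the whole space, so that the integration by parts of
  -- Lipschitz functions applies
  choose K hK using fun i =>
    (hF i).exists_lipschitzOnWith one_ne_zero hΩ.convex.closure hΩ.isCompact_closure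
  choose g hg hgF using fun i => (hK i).extend_real
  set M : ℝ := ∑ i, (K i : ℝ) with hM
  have hM0 : 0 ≤ M := Finset.sum_nonneg fun i _ => (K i).2
  have hpdc : ∀ i, ContinuousOn (pd (closure Ω) i (F i)) (closure Ω) := fun i =>
    ((hF i).continuousOn_fderivWithin hΩ.uniqueDiffOn le_rfl).clm_apply continuousOn_const
  have hline : ∀ i, ∀ x ∈ Ω, lineDeriv ℝ (g i) x (EuclideanSpace.single i 1)
      = pd (closure Ω) i (F i) x := by
    intro i x hx
    have hnh := hΩ.closure_mem_nhds hx
    have hev : g i =ᶠ[𝓝 x] F i := by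
      filter_upwards [hnh] with z hz using (hgF i hz).symm
    have hFd : DifferentiableAt ℝ (F i) x :=
      (((hF i).differentiableOn one_ne_zero) x (subset_closure hx)).differentiableAt hnh
    rw [pd, fderivWithin_of_mem_nhds hnh, ← hev.fderiv_eq]
    exact (hFd.congr_of_eventuallyEq hev).lineDeriv_eq_fderiv
  have hstep : ∀ ε : ℝ, 0 < ε →
      ∫ x in Ω, (∑ i, pd (closure Ω) i (F i) x) * cutoff Ω ε x ≤
        ∫ x in Ω, {x | Metric.infDist x Ωᶜ < ε}.indicator (fun _ => M) x := by
    intro ε hε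
    obtain ⟨Kc, hKc⟩ := exists_lipschitzWith_cutoff (Ω := Ω) hε
    have hcs := hasCompactSupport_cutoff hΩ (ε := ε)
    have hlhs : ∫ x in Ω, (∑ i, pd (closure Ω) i (F i) x) * cutoff Ω ε x
        = ∑ i, ∫ x, lineDeriv ℝ (g i) x (EuclideanSpace.single i 1) * cutoff Ω ε x := by
      simp_rw [Finset.sum_mul]
      rw [integral_finsetSum]
      · refine Finset.sum_congr rfl fun i _ => ?_
        rw [← setIntegral_eq_integral_of_forall_compl_eq_zero (s := Ω)
          (f := fun x => lineDeriv ℝ (g i) x (EuclideanSpace.single i 1) * cutoff Ω ε x)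
          (fun x hx => by rw [cutoff_eq_zero hx, mul_zero])]
        refine setIntegral_congr_fun hΩ.isOpen.measurableSet fun x hx => ?_
        simp only [hline i x hx]
      · intro i _
        exact hΩ.integrableOn ((hpdc i).mul hKc.continuous.continuousOn)
    have hint : ∀ i, Integrable fun x =>
        lineDeriv ℝ (cutoff Ω ε) x (-EuclideanSpace.single i 1) * g i x := by
      intro i
      refine IntegrableOn.integrable_of_forall_notMem_eq_zero (s := closure Ω) ?_ ?_
      · exact ((hKc.locallyIntegrable_lineDeriv _).integrableOn_isCompact
          hΩ.isCompact_closure).mul_continuousOn (hg i).continuous.continuousOn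
            hΩ.isCompact_closure
      · intro x hx
        have hev : cutoff Ω ε =ᶠ[𝓝 x] fun _ => 0 := by
          filter_upwards [isClosed_closure.isOpen_compl.mem_nhds hx] with z hz
          exact cutoff_eq_zero fun h => hz (subset_closure h)
        have : DifferentiableAt ℝ (cutoff Ω ε) x :=
          (differentiableAt_const (0 : ℝ)).congr_of_eventuallyEq hev
        rw [this.lineDeriv_eq_fderiv, hev.fderiv_eq]; simp
    have hparts : ∀ i, ∫ x, lineDeriv ℝ (g i) x (EuclideanSpace.single i 1) * cutoff Ω ε x
        = ∫ x, lineDeriv ℝ (cutoff Ω ε) x (-EuclideanSpace.single i 1) * g i x := fun i =>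
      (hg i).integral_lineDeriv_mul_eq hKc hcs _
    have hmeas : MeasurableSet {x : Space d | Metric.infDist x Ωᶜ < ε} :=
      measurableSet_lt (Metric.continuous_infDist_pt _).measurable measurable_const
    -- Rademacher's theorem: the cutoff function is differentiable almost everywhere, and at such a
    -- point `x` of the strip its gradient sees only the normal component of the field; that
    -- component is nonpositive at the nearest boundary point `y`, hence at most `M * dist x y`
    -- at `x`
    have hbound : ∀ᵐ x : Space d,
        ∑ i, lineDeriv ℝ (cutoff Ω ε) x (-EuclideanSpace.single i 1) * g i x ≤
          Ω.indicator ({x | Metric.infDist x Ωᶜ < ε}.indicator (fun _ => M)) x := by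
      filter_upwards [hKc.ae_differentiableAt] with x hx
      simp_rw [hx.lineDeriv_eq_fderiv]
      rcases fderiv_cutoff hΩ hε hx with h0 | ⟨y, hy, hxΩ, hxy, hlt, hinf, hball, hfd⟩
      · rw [h0]
        simpa using indicator_nonneg (fun _ _ => indicator_nonneg (fun _ _ => hM0) _) x
      have hδ : 0 < dist x y := dist_pos.2 hxy
      have hyΩ : y ∉ Ω := by
        have := hy.2; rwa [hΩ.isOpen.interior_eq] at this
      obtain ⟨ρ, hρ⟩ := hΩ.smooth y hy
      obtain ⟨l, hl, hnl⟩ := hρ.exists_smul_gradient_of_ball hyΩ hxy hball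
      have hFy : ∑ i, F i y * (y - x) i ≤ 0 := by
        have := mul_nonpos_of_nonneg_of_nonpos hl (hn y hy ρ hρ)
        rw [Finset.mul_sum] at this
        rw [hnl]
        refine le_of_eq_of_le (Finset.sum_congr rfl fun i _ => ?_) this
        rw [PiLp.smul_apply, smul_eq_mul]; ring
      have hdiff : ∀ i, (g i x - F i y) * (y - x) i ≤ K i * dist x y ^ 2 := by
        intro i
        have h1 : |g i x - F i y| ≤ K i * dist x y := by
          rw [hgF i hy.1, ← Real.dist_eq]
          exact (hg i).dist_le_mul x y
        have h2 : |(y - x) i| ≤ dist x y := by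
          rw [dist_comm, dist_eq_norm, ← Real.norm_eq_abs]
          exact PiLp.norm_apply_le (y - x) i
        calc (g i x - F i y) * (y - x) i ≤ |(g i x - F i y) * (y - x) i| := le_abs_self _
          _ = |g i x - F i y| * |(y - x) i| := abs_mul _ _
          _ ≤ (K i * dist x y) * dist x y :=
            mul_le_mul h1 h2 (abs_nonneg _) (by positivity)
          _ = K i * dist x y ^ 2 := by ring
      have hsum : ∑ i, g i x * (y - x) i ≤ M * dist x y ^ 2 := by
        have h3 := Finset.sum_le_sum fun i (_ : i ∈ Finset.univ) => hdiff i
        rw [← Finset.sum_mul] at h3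
        have h4 : ∑ i, (g i x - F i y) * (y - x) i
            = ∑ i, g i x * (y - x) i - ∑ i, F i y * (y - x) i := by
          rw [← Finset.sum_sub_distrib]
          exact Finset.sum_congr rfl fun i _ => by ring
        linarith
      have hval : ∀ i, fderiv ℝ (cutoff Ω ε) x (-EuclideanSpace.single i 1) * g i x
          = ε⁻¹ * (dist x y)⁻¹ * (g i x * (y - x) i) := by
        intro i
        rw [hfd, inner_neg_right, EuclideanSpace.inner_single_right]
        simp; ring
      rw [indicator_of_mem hxΩ, indicator_of_mem (s := {x : Space d | Metric.infDist x Ωᶜ < ε})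
        (show Metric.infDist x Ωᶜ < ε from hinf ▸ hlt)]
      simp_rw [hval]
      rw [← Finset.mul_sum]
      calc ε⁻¹ * (dist x y)⁻¹ * ∑ i, g i x * (y - x) i
          ≤ ε⁻¹ * (dist x y)⁻¹ * (M * dist x y ^ 2) :=
            mul_le_mul_of_nonneg_left hsum (by positivity)
        _ = M * (dist x y / ε) := by field_simp
        _ ≤ M := mul_le_of_le_one_right hM0 ((div_le_one hε).2 hlt.le)
    have hfin : IntegrableOn ({x : Space d | Metric.infDist x Ωᶜ < ε}.indicator (fun _ => M)) Ω :=
      (integrableOn_const hΩ.volume_ne_top).indicator hmeas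
    rw [hlhs, Finset.sum_congr rfl fun i _ => hparts i, ← integral_finsetSum _ fun i _ => hint i,
      ← integral_indicator hΩ.isOpen.measurableSet]
    exact integral_mono_ae (integrable_finsetSum _ fun i _ => hint i)
      (hfin.integrable_indicator hΩ.isOpen.measurableSet) hbound
  have hpos : ∀ x ∈ Ω, 0 < Metric.infDist x Ωᶜ := fun x hx =>
    (hΩ.isOpen.isClosed_compl.notMem_iff_infDist_pos hΩ.compl_nonempty).1 (by simpa using hx)
  have hdivc : ContinuousOn (fun x => ∑ i, pd (closure Ω) i (F i) x) (closure Ω) :=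
    continuousOn_finsetSum _ fun i _ => hpdc i
  have hlim1 : Tendsto (fun ε : ℝ => ∫ x in Ω, (∑ i, pd (closure Ω) i (F i) x) * cutoff Ω ε x)
      (𝓝[>] 0) (𝓝 (∫ x in Ω, ∑ i, pd (closure Ω) i (F i) x)) := by
    refine tendsto_integral_filter_of_dominated_convergence
      (fun x => ‖∑ i, pd (closure Ω) i (F i) x‖) ?_ ?_ (hΩ.integrableOn hdivc).norm ?_
    · filter_upwards [self_mem_nhdsWithin] with ε hε
      obtain ⟨Kc, hKc⟩ := exists_lipschitzWith_cutoff (Ω := Ω) hε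
      exact (hΩ.integrableOn (hdivc.mul hKc.continuous.continuousOn)).aestronglyMeasurable
    · filter_upwards [self_mem_nhdsWithin] with ε hε
      refine Eventually.of_forall fun x => ?_
      rw [norm_mul, Real.norm_of_nonneg (cutoff_nonneg hε x)]
      exact mul_le_of_le_one_right (norm_nonneg _) (cutoff_le_one x)
    · filter_upwards [ae_restrict_mem hΩ.isOpen.measurableSet] with x hx
      refine tendsto_const_nhds.congr' ?_
      filter_upwards [Ioo_mem_nhdsGT (hpos x hx)] with ε hε
      rw [cutoff, min_eq_left ((one_le_div hε.1).2 hε.2.le), mul_one]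
  have hlim2 : Tendsto (fun ε : ℝ =>
      ∫ x in Ω, {x | Metric.infDist x Ωᶜ < ε}.indicator (fun _ => M) x)
      (𝓝[>] 0) (𝓝 (∫ _ in Ω, (0 : ℝ))) := by
    refine tendsto_integral_filter_of_dominated_convergence
      (fun _ => M) ?_ ?_ (integrableOn_const hΩ.volume_ne_top) ?_
    · refine Eventually.of_forall fun ε => ?_
      exact (measurable_const.indicator (measurableSet_lt
        (Metric.continuous_infDist_pt _).measurable measurable_const)).aestronglyMeasurable
    · refine Eventually.of_forall fun ε => Eventually.of_forall fun x => ?_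
      exact (norm_indicator_le_norm_self _ _).trans (by simp [abs_of_nonneg hM0])
    · filter_upwards [ae_restrict_mem hΩ.isOpen.measurableSet] with x hx
      refine tendsto_const_nhds.congr' ?_
      filter_upwards [Ioo_mem_nhdsGT (hpos x hx)] with ε hε
      rw [indicator_of_notMem]
      simpa using hε.2.le
  rw [integral_zero] at hlim2
  refine le_of_tendsto_of_tendsto hlim1 hlim2 ?_
  filter_upwards [self_mem_nhdsWithin] with ε hε using hstep ε hε

/-- The divergence theorem for vector fields tangential to the boundary. -/
theorem integral_div_eq_zero (hΩ : IsSmoothConvexDomain Ω) {F : Fin d → Space d → ℝ}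
    (hF : ∀ i, ContDiffOn ℝ 1 (F i) (closure Ω))
    (hn : ∀ y ∈ frontier Ω, ∀ ρ : Space d → ℝ, IsDefiningFunctionAt Ω y ρ →
      ∑ i, F i y * gradient ρ y i = 0) :
    ∫ x in Ω, ∑ i, pd (closure Ω) i (F i) x = 0 := by
  refine le_antisymm (integral_div_nonpos hΩ hF fun y hy ρ hρ => (hn y hy ρ hρ).le) ?_
  have h := integral_div_nonpos hΩ (fun i => (hF i).neg) fun y hy ρ hρ => by
    simpa [neg_mul, Finset.sum_neg_distrib] using (hn y hy ρ hρ).ge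
  have hneg : ∀ x ∈ Ω, ∑ i, pd (closure Ω) i (fun z => -F i z) x
      = -∑ i, pd (closure Ω) i (F i) x := fun x hx => by
    rw [← Finset.sum_neg_distrib]
    refine Finset.sum_congr rfl fun i _ => ?_
    rw [pd, fderivWithin_fun_neg (hΩ.uniqueDiffOn x (subset_closure hx))]; rfl
  rw [setIntegral_congr_fun hΩ.isOpen.measurableSet hneg, integral_neg] at h
  linarith

end

section

/-! ### The curvature of the boundary -/

variable {d : ℕ} {Ω : Set (Space d)}

lemma IsDefiningFunctionAt.eq_zero {y : Space d} {ρ : Space d → ℝ}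
    (h : IsDefiningFunctionAt Ω y ρ) (ho : IsOpen Ω) (hy : y ∈ frontier Ω) : ρ y = 0 := by
  rw [frontier, ho.interior_eq] at hy
  refine le_antisymm (not_lt.1 fun hc => ?_) (h.nonneg hy.2)
  have h1 : ∀ᶠ z in 𝓝 y, 0 < ρ z := (h.1.continuous.tendsto y).eventually_const_lt hc
  obtain ⟨z, ⟨hz1, hz2⟩, hz⟩ := mem_closure_iff_nhds.1 hy.1 _ (h1.and h.2.2)
  exact absurd (hz2.1 hz) (not_lt.2 hz1.le)

lemma eventually_neg_of_inner_gradient_neg {E : Type*} [NormedAddCommGroup E]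
    [InnerProductSpace ℝ E] [CompleteSpace E] {ρ : E → ℝ} {y v : E}
    (hρ : DifferentiableAt ℝ ρ y) (h0 : ρ y = 0) (hv : ⟪gradient ρ y, v⟫ < 0) :
    ∀ᶠ t : ℝ in 𝓝[>] 0, ρ (y + t • v) < 0 := by
  have hg : HasFDerivAt ρ (fderiv ℝ ρ y) (y + (0 : ℝ) • v) := by simpa using hρ.hasFDerivAt
  have hl : HasDerivAt (fun t : ℝ => y + t • v) v 0 := by
    simpa using ((hasDerivAt_id (0 : ℝ)).smul_const v).const_add y
  have hd : HasDerivAt (fun t : ℝ => ρ (y + t • v)) (fderiv ℝ ρ y v) 0 :=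
    hg.comp_hasDerivAt (0 : ℝ) hl
  have hgr : ⟪gradient ρ y, v⟫ = fderiv ℝ ρ y v := by
    rw [gradient, InnerProductSpace.toDual_symm_apply]
  rw [hgr] at hv
  have ht := (hasDerivAt_iff_tendsto_slope.1 hd).mono_left
    (nhdsWithin_mono _ (fun x (hx : 0 < x) => hx.ne') : 𝓝[>] (0 : ℝ) ≤ 𝓝[≠] 0)
  filter_upwards [ht.eventually_lt_const hv, self_mem_nhdsWithin] with t h1 h2
  rw [slope_def_field] at h1
  simp only [zero_smul, add_zero, sub_zero, h0] at h1
  exact (div_neg_iff.1 h1).elim (fun h => absurd h.2 (not_lt.2 (le_of_lt h2))) fun h => h.1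

/-- Tangential directions are limits of secant directions of the boundary. -/
lemma exists_tendsto_frontier (hΩ : IsSmoothConvexDomain Ω) {y t : Space d} {ρ : Space d → ℝ}
    (hy : y ∈ frontier Ω) (hρ : IsDefiningFunctionAt Ω y ρ) (ht : ⟪gradient ρ y, t⟫ = 0) :
    ∃ (c : ℕ → ℝ) (v : ℕ → Space d), (∀ n, 0 < c n) ∧ (∀ n, y + v n ∈ frontier Ω) ∧
      Tendsto v atTop (𝓝 0) ∧ Tendsto (fun n => c n • v n) atTop (𝓝 t) := by
  set m := gradient ρ y with hm
  have hmm : 0 < ⟪m, m⟫ := real_inner_self_pos.2 hρ.2.1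
  -- for small `s`, the segment from `y + s • t` to `y + s • (t - ε • m)` starts outside `Ω`, by
  -- convexity, and ends inside
  have key : ∀ ε : ℝ, 0 < ε → ∃ s ∈ Ioo 0 ε, ∃ e ∈ Icc 0 ε,
      y + s • (t - e • m) ∈ frontier Ω := by
    intro ε hε
    have hv : ⟪gradient ρ y, t - ε • m⟫ < 0 := by
      rw [inner_sub_right, ht, inner_smul_right]; nlinarith
    have hsmall : ∀ᶠ r in 𝓝[>] (0 : ℝ), r ∈ Ioo 0 ε := Ioo_mem_nhdsGT hε
    obtain ⟨s, hs, hs1, hs2⟩ := (hsmall.and (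
      (eventually_neg_of_inner_gradient_neg (hρ.differentiableAt y)
        (hρ.eq_zero hΩ.isOpen hy) hv).and (eventually_of_eventually_segment hρ.2.2))).exists
    have hin : y + s • (t - ε • m) ∈ Ω := hs2.2 hs1
    have hout : y + s • (t - (0 : ℝ) • m) ∉ Ω := by
      intro hc
      rw [zero_smul, sub_zero] at hc
      obtain ⟨r, hr, hr0⟩ := ((eventually_of_eventually_segment (v := m)
        (hΩ.isOpen.mem_nhds hc)).and self_mem_nhdsWithin).exists
      have := hρ.inner_le_zero hΩ.isOpen hΩ.convex hy (subset_closure hr)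
      rw [show y + s • t + r • m - y = s • t + r • m by abel, inner_add_right, inner_smul_right,
        inner_smul_right, ← hm, ht] at this
      have hr0' : 0 < r := hr0
      nlinarith
    have hpre : IsPreconnected ((fun e : ℝ => y + s • (t - e • m)) '' Icc 0 ε) :=
      isPreconnected_Icc.image _ (by fun_prop)
    by_contra hno
    push Not at hno
    have hnf : ∀ e ∈ Icc 0 ε, y + s • (t - e • m) ∉ Ω → y + s • (t - e • m) ∈ (closure Ω)ᶜ :=
      fun e he h1 h2 => hno s hs e he ⟨h2, by rwa [hΩ.isOpen.interior_eq]⟩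
    obtain ⟨z, -, hz1, hz2⟩ := hpre Ω (closure Ω)ᶜ hΩ.isOpen isClosed_closure.isOpen_compl
      (by
        rintro _ ⟨e, he, rfl⟩
        by_cases h : y + s • (t - e • m) ∈ Ω
        · exact Or.inl h
        · exact Or.inr (hnf e he h))
      ⟨_, ⟨ε, ⟨hε.le, le_rfl⟩, rfl⟩, hin⟩
      ⟨_, ⟨0, ⟨le_rfl, hε.le⟩, rfl⟩, hnf 0 ⟨le_rfl, hε.le⟩ hout⟩
    exact hz2 (subset_closure hz1)
  choose s hs e he hf using fun n : ℕ => key (1 / (n + 1)) (by positivity)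
  have hlim := tendsto_one_div_add_atTop_nhds_zero_nat (𝕜 := ℝ)
  have hs0 : Tendsto s atTop (𝓝 0) :=
    squeeze_zero (fun n => (hs n).1.le) (fun n => (hs n).2.le) hlim
  have he0 : Tendsto e atTop (𝓝 0) :=
    squeeze_zero (fun n => (he n).1) (fun n => (he n).2) hlim
  have h1 : Tendsto (fun n => t - e n • m) atTop (𝓝 t) := by
    simpa using tendsto_const_nhds.sub (he0.smul_const m)
  refine ⟨fun n => (s n)⁻¹, fun n => s n • (t - e n • m), fun n => inv_pos.2 (hs n).1, hf, ?_, ?_⟩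
  · simpa using hs0.smul h1
  · refine h1.congr fun n => ?_
    rw [smul_smul, inv_mul_cancel₀ (hs n).1.ne', one_smul]

lemma sum_pd_mul {s : Set (Space d)} {f : Space d → ℝ} {x v : Space d} :
    ∑ i, pd s i f x * v i = fderivWithin ℝ f s x v := by
  conv_rhs => rw [← (EuclideanSpace.basisFun (Fin d) ℝ).sum_repr v]
  simp [map_sum, mul_comm, pd]

/-- If `∇w` is tangential to the boundary of a convex domain, then `⟪D²w ∇w, ν⟫ ≤ 0` there:
differentiating `⟪∇w, ∇ρ⟫ = 0` along the boundary in direction `∇w` turns this expression into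
minus the second fundamental form at `∇w`, which convexity makes nonnegative. -/
theorem sum_hessian_mul_normal_nonpos (hΩ : IsSmoothConvexDomain Ω) {w : Space d → ℝ}
    (hw : ContDiffOn ℝ ∞ w (closure Ω)) (hN : Neumann Ω w) {y : Space d} (hy : y ∈ frontier Ω)
    {ρ : Space d → ℝ} (hρ : IsDefiningFunctionAt Ω y ρ) :
    ∑ i, (∑ j, pd (closure Ω) j (pd (closure Ω) i w) y * pd (closure Ω) j w y)
      * gradient ρ y i ≤ 0 := by
  set s := closure Ω with hs
  have hud : UniqueDiffOn ℝ s := hΩ.uniqueDiffOn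
  have hys : y ∈ s := hy.1
  set t : Space d := WithLp.toLp 2 fun i => pd s i w y with ht
  have hti : ∀ i, t i = pd s i w y := fun i => rfl
  have htm : ⟪gradient ρ y, t⟫ = 0 := by
    have h0 := hN y hy ρ hρ
    rw [← sum_pd_mul] at h0
    rw [PiLp.inner_apply]
    simpa [hti, mul_comm] using h0
  obtain ⟨c, v, hc, hv, hv0, hcv⟩ := exists_tendsto_frontier hΩ hy hρ htm
  have hvs : ∀ᶠ n in atTop, y + v n ∈ s := Eventually.of_forall fun n => (hv n).1
  have hG : ContDiff ℝ ∞ (gradient ρ) := by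
    have : ContDiff ℝ ∞ (fderiv ℝ ρ) := hρ.1.fderiv_right (by simp)
    exact (InnerProductSpace.toDual ℝ (Space d)).symm.contDiff.comp this
  have hGd : HasFDerivAt (gradient ρ) (fderiv ℝ (gradient ρ) y) y :=
    (hG.differentiable (by simp) y).hasFDerivAt
  have hρv : ∀ᶠ n in atTop, IsDefiningFunctionAt Ω (y + v n) ρ := by
    have hz : ∀ᶠ z in 𝓝 y, IsDefiningFunctionAt Ω z ρ := by
      filter_upwards [hρ.2.2.eventually_nhds,
        hG.continuous.continuousAt.eventually_ne hρ.2.1] with z h1 h2 using ⟨hρ.1, h2, h1⟩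
    have : Tendsto (fun n => y + v n) atTop (𝓝 y) := by simpa using hv0.const_add y
    exact this.eventually hz
  -- monotonicity of the normal field gives the sign of the second fundamental form
  have hmono : 0 ≤ ⟪fderiv ℝ (gradient ρ) y t, t⟫ := by
    have hlim := (hGd.hasFDerivWithinAt (s := s)).lim hv0 hvs hcv
    refine ge_of_tendsto (hlim.inner hcv) ?_
    filter_upwards [hρv] with n hn
    have h1 := hρ.inner_le_zero hΩ.isOpen hΩ.convex hy (hv n).1
    have h2 := hn.inner_le_zero hΩ.isOpen hΩ.convex (hv n) hys
    rw [add_sub_cancel_left] at h1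
    rw [sub_add_cancel_left, inner_neg_right] at h2
    rw [inner_smul_left, inner_smul_right, inner_sub_left]
    simp only [conj_trivial]
    have := hc n
    have h3 : 0 ≤ ⟪gradient ρ (y + v n), v n⟫ - ⟪gradient ρ y, v n⟫ := by linarith
    positivity
  -- the function `⟪∇w, ∇ρ⟫` vanishes along the boundary
  have hdw : ∀ i, DifferentiableWithinAt ℝ (pd s i w) s y := by
    intro i
    have : ContDiffOn ℝ ∞ (fderivWithin ℝ w s) s := hw.fderivWithin hud (by simp)
    exact ((this.clm_apply contDiffOn_const).differentiableOn (by simp)) y hys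
  have hGi : ∀ i, HasFDerivAt (fun z => gradient ρ z i)
      ((EuclideanSpace.proj i).comp (fderiv ℝ (gradient ρ) y)) y := fun i =>
    (EuclideanSpace.proj (𝕜 := ℝ) i).hasFDerivAt.comp y hGd
  have hder := HasFDerivWithinAt.fun_sum (u := Finset.univ) fun i _ =>
    (hdw i).hasFDerivWithinAt.mul (hGi i).hasFDerivWithinAt
  have hlim := hder.lim hv0 hvs hcv
  have hzero : ∀ z, ∀ r : Space d → ℝ, z ∈ frontier Ω → IsDefiningFunctionAt Ω z r →
      ∑ i, (pd s i w * fun z => gradient r z i) z = 0 := by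
    intro z r hz hr
    have := hN z hz r hr
    rw [← sum_pd_mul] at this
    simpa using this
  have h0 := tendsto_nhds_unique hlim (tendsto_const_nhds.congr' (f₁ := fun _ => (0 : ℝ)) (by
    filter_upwards [hρv] with n hn
    rw [hzero _ _ hy hρ, hzero _ _ (hv n) hn]; simp))
  simp only [sum_apply, add_apply, smul_apply, ContinuousLinearMap.comp_apply,
    smul_eq_mul] at h0
  have e1 : ∑ i, pd s i w y * (fderiv ℝ (gradient ρ) y t) i
      = ⟪fderiv ℝ (gradient ρ) y t, t⟫ := by
    rw [PiLp.inner_apply]; simp [hti]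
  have e2 : ∀ i, fderivWithin ℝ (pd s i w) s y t = ∑ j, pd s j (pd s i w) y * pd s j w y :=
    fun i => by rw [← sum_pd_mul]
  rw [Finset.sum_add_distrib] at h0
  simp only [e2] at h0
  have e3 : ∑ i, gradient ρ y i * ∑ j, pd s j (pd s i w) y * pd s j w y
     = ∑ i, (∑ j, pd s j (pd s i w) y * pd s j w y) * gradient ρ y i :=
    Finset.sum_congr rfl fun i _ => mul_comm _ _
  have e4 : ∑ i, pd s i w y * (EuclideanSpace.proj i) (fderiv ℝ (gradient ρ) y t)
      = ⟪fderiv ℝ (gradient ρ) y t, t⟫ := e1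
  linarith

end

section

/-! ### Partial derivatives up to the boundary -/

variable {d : ℕ} {Ω s : Set (Space d)}

section pd

variable {f g : Space d → ℝ} {x : Space d} {i j : Fin d}

lemma pd_smooth (hs : UniqueDiffOn ℝ s) (hf : ContDiffOn ℝ ∞ f s) (i : Fin d) :
    ContDiffOn ℝ ∞ (pd s i f) s :=
  (hf.fderivWithin hs (by simp)).clm_apply contDiffOn_const

lemma differentiableWithinAt_of_smooth (hf : ContDiffOn ℝ ∞ f s) (hx : x ∈ s) :
    DifferentiableWithinAt ℝ f s x := (hf.differentiableOn (by simp)) x hx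

lemma pd_add (hs : UniqueDiffOn ℝ s) (hf : ContDiffOn ℝ ∞ f s) (hg : ContDiffOn ℝ ∞ g s)
    (hx : x ∈ s) : pd s i (fun z => f z + g z) x = pd s i f x + pd s i g x := by
  rw [pd, fderivWithin_fun_add (hs x hx) (differentiableWithinAt_of_smooth hf hx)
    (differentiableWithinAt_of_smooth hg hx)]
  rfl

lemma pd_sub (hs : UniqueDiffOn ℝ s) (hf : ContDiffOn ℝ ∞ f s) (hg : ContDiffOn ℝ ∞ g s)
    (hx : x ∈ s) : pd s i (fun z => f z - g z) x = pd s i f x - pd s i g x := by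
  rw [pd, fderivWithin_fun_sub (hs x hx) (differentiableWithinAt_of_smooth hf hx)
    (differentiableWithinAt_of_smooth hg hx)]
  rfl

lemma pd_mul (hs : UniqueDiffOn ℝ s) (hf : ContDiffOn ℝ ∞ f s) (hg : ContDiffOn ℝ ∞ g s)
    (hx : x ∈ s) :
    pd s i (fun z => f z * g z) x = pd s i f x * g x + f x * pd s i g x := by
  rw [pd, fderivWithin_fun_mul (hs x hx) (differentiableWithinAt_of_smooth hf hx)
    (differentiableWithinAt_of_smooth hg hx)]
  simp [pd]; ring

lemma pd_sq (hs : UniqueDiffOn ℝ s) (hf : ContDiffOn ℝ ∞ f s) (hx : x ∈ s) :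
    pd s i (fun z => f z ^ 2) x = 2 * f x * pd s i f x := by
  simp_rw [pow_two]; rw [pd_mul hs hf hf hx]; ring

lemma pd_sum (hs : UniqueDiffOn ℝ s) {ι : Type*} {t : Finset ι} {F : ι → Space d → ℝ}
    (hF : ∀ k ∈ t, ContDiffOn ℝ ∞ (F k) s) (hx : x ∈ s) :
    pd s i (fun z => ∑ k ∈ t, F k z) x = ∑ k ∈ t, pd s i (F k) x := by
  rw [pd, fderivWithin_fun_sum (hs x hx) fun k hk =>
    differentiableWithinAt_of_smooth (hF k hk) hx]
  simp [pd]

lemma pd_comp (hs : UniqueDiffOn ℝ s) (hf : ContDiffOn ℝ ∞ f s) (hx : x ∈ s) {h : ℝ → ℝ} {h' : ℝ}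
    (hh : HasDerivAt h h' (f x)) : pd s i (fun z => h (f z)) x = h' * pd s i f x := by
  have := hh.comp_hasFDerivWithinAt x (differentiableWithinAt_of_smooth hf hx).hasFDerivWithinAt
  rw [pd, show (fun z => h (f z)) = h ∘ f from rfl, this.fderivWithin (hs x hx)]
  simp [pd]

lemma pd_const_mul (hs : UniqueDiffOn ℝ s) (hf : ContDiffOn ℝ ∞ f s) (hx : x ∈ s) (a : ℝ) :
    pd s i (fun z => a * f z) x = a * pd s i f x := by
  refine pd_comp (h := fun y => a * y) hs hf hx ?_
  simpa using (hasDerivAt_id (f x)).const_mul a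

lemma pd_exp (hs : UniqueDiffOn ℝ s) (hf : ContDiffOn ℝ ∞ f s) (hx : x ∈ s) (a : ℝ) :
    pd s i (fun z => Real.exp (a * f z)) x = Real.exp (a * f x) * (a * pd s i f x) := by
  rw [pd_comp (h := fun y => Real.exp (a * y)) (h' := Real.exp (a * f x) * a) hs hf hx]
  · ring
  · simpa using ((hasDerivAt_id (f x)).const_mul a).exp

lemma exp_smooth (hf : ContDiffOn ℝ ∞ f s) (a : ℝ) :
    ContDiffOn ℝ ∞ (fun z => Real.exp (a * f z)) s := (contDiffOn_const.mul hf).exp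

lemma pd_comm (hΩ : IsSmoothConvexDomain Ω) (hf : ContDiffOn ℝ ∞ f (closure Ω))
    (hx : x ∈ closure Ω) :
    pd (closure Ω) j (pd (closure Ω) i f) x = pd (closure Ω) i (pd (closure Ω) j f) x := by
  have hs := hΩ.uniqueDiffOn
  have hsymm : IsSymmSndFDerivWithinAt ℝ f (closure Ω) x :=
    (hf x hx).isSymmSndFDerivWithinAt (by
      rw [minSmoothness_of_isRCLikeNormedField]
      exact WithTop.coe_le_coe.2 (le_top : (2 : ℕ∞) ≤ ⊤)) hs
      (closure_mono (interior_maximal subset_closure hΩ.isOpen) hx) hx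
  have hd : DifferentiableWithinAt ℝ (fderivWithin ℝ f (closure Ω)) (closure Ω) x :=
    ((hf.fderivWithin (m := ∞) hs (by simp)).differentiableOn (by simp)) x hx
  have e : ∀ k l : Fin d, pd (closure Ω) k (pd (closure Ω) l f) x
      = fderivWithin ℝ (fderivWithin ℝ f (closure Ω)) (closure Ω) x
        (EuclideanSpace.single k 1) (EuclideanSpace.single l 1) := by
    intro k l
    unfold pd
    rw [fderivWithin_clm_apply (hs x hx) hd (differentiableWithinAt_const _)]
    simp
  rw [e, e]
  exact hsymm _ _

lemma pd_congr (hΩ : IsSmoothConvexDomain Ω) (h : EqOn f g Ω) (hx : x ∈ Ω) :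
    pd (closure Ω) i f x = pd (closure Ω) i g x := by
  have hn := hΩ.closure_mem_nhds hx
  have : f =ᶠ[𝓝 x] g := by filter_upwards [hΩ.isOpen.mem_nhds hx] with z hz using h hz
  rw [pd, pd, fderivWithin_of_mem_nhds hn, fderivWithin_of_mem_nhds hn, this.fderiv_eq]

end pd

/-- `|∇w|²`, up to the boundary of `Ω`. -/
def gradSq (Ω : Set (Space d)) (w : Space d → ℝ) (x : Space d) : ℝ :=
  ∑ i, pd (closure Ω) i w x ^ 2

/-- `Δw`, up to the boundary of `Ω`. -/
def lap (Ω : Set (Space d)) (w : Space d → ℝ) (x : Space d) : ℝ :=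
  ∑ i, pd (closure Ω) i (pd (closure Ω) i w) x

/-- `⟪D²w ∇w, ∇w⟫`, up to the boundary of `Ω`. -/
def hessGrad (Ω : Set (Space d)) (w : Space d → ℝ) (x : Space d) : ℝ :=
  ∑ i, ∑ j, pd (closure Ω) j (pd (closure Ω) i w) x * pd (closure Ω) i w x * pd (closure Ω) j w x

/-- `|D²w|²`, up to the boundary of `Ω`. -/
def hessSq (Ω : Set (Space d)) (w : Space d → ℝ) (x : Space d) : ℝ :=
  ∑ i, ∑ j, pd (closure Ω) j (pd (closure Ω) i w) x ^ 2

section smooth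

variable {w : Space d → ℝ}

lemma gradSq_nonneg (x : Space d) : 0 ≤ gradSq Ω w x := Finset.sum_nonneg fun _ _ => sq_nonneg _

lemma gradSq_smooth (hΩ : IsSmoothConvexDomain Ω) (hw : ContDiffOn ℝ ∞ w (closure Ω)) :
    ContDiffOn ℝ ∞ (gradSq Ω w) (closure Ω) :=
  ContDiffOn.sum fun i _ => (pd_smooth hΩ.uniqueDiffOn hw i).pow 2

lemma lap_smooth (hΩ : IsSmoothConvexDomain Ω) (hw : ContDiffOn ℝ ∞ w (closure Ω)) :
    ContDiffOn ℝ ∞ (lap Ω w) (closure Ω) :=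
  ContDiffOn.sum fun i _ => pd_smooth hΩ.uniqueDiffOn (pd_smooth hΩ.uniqueDiffOn hw i) i

lemma hessGrad_smooth (hΩ : IsSmoothConvexDomain Ω) (hw : ContDiffOn ℝ ∞ w (closure Ω)) :
    ContDiffOn ℝ ∞ (hessGrad Ω w) (closure Ω) :=
  ContDiffOn.sum fun i _ => ContDiffOn.sum fun j _ =>
    ((pd_smooth hΩ.uniqueDiffOn (pd_smooth hΩ.uniqueDiffOn hw i) j).mul
      (pd_smooth hΩ.uniqueDiffOn hw i)).mul (pd_smooth hΩ.uniqueDiffOn hw j)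

lemma hessSq_smooth (hΩ : IsSmoothConvexDomain Ω) (hw : ContDiffOn ℝ ∞ w (closure Ω)) :
    ContDiffOn ℝ ∞ (hessSq Ω w) (closure Ω) :=
  ContDiffOn.sum fun i _ => ContDiffOn.sum fun j _ =>
    (pd_smooth hΩ.uniqueDiffOn (pd_smooth hΩ.uniqueDiffOn hw i) j).pow 2

end smooth

/-! ### Integration by parts -/

section parts

variable {w φ ψ : Space d → ℝ}

/-- Green's formula with homogeneous Neumann conditions. -/
lemma integral_green (hΩ : IsSmoothConvexDomain Ω) (hφ : ContDiffOn ℝ ∞ φ (closure Ω))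
    (hψ : ContDiffOn ℝ ∞ ψ (closure Ω)) (hN : Neumann Ω ψ) :
    ∫ x in Ω, ((∑ i, pd (closure Ω) i φ x * pd (closure Ω) i ψ x) + φ x * lap Ω ψ x) = 0 := by
  have hs := hΩ.uniqueDiffOn
  have h := integral_div_eq_zero hΩ (F := fun i x => φ x * pd (closure Ω) i ψ x)
    (fun i => (hφ.mul (pd_smooth hs hψ i)).of_le (by simp)) fun y hy ρ hρ => by
      have := hN y hy ρ hρ
      rw [← sum_pd_mul] at this
      simp_rw [mul_assoc]
      rw [← Finset.mul_sum, this, mul_zero]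
  rw [← h]
  refine setIntegral_congr_fun hΩ.isOpen.measurableSet fun x hx => ?_
  simp only [lap]
  rw [Finset.mul_sum, ← Finset.sum_add_distrib]
  exact Finset.sum_congr rfl fun i _ =>
    (pd_mul hs hφ (pd_smooth hs hψ i) (subset_closure hx)).symm

lemma integral_green_exp (hΩ : IsSmoothConvexDomain Ω) (hφ : ContDiffOn ℝ ∞ φ (closure Ω))
    (hw : ContDiffOn ℝ ∞ w (closure Ω)) (hN : Neumann Ω w) (a : ℝ) :
    ∫ x in Ω, Real.exp (a * w x) * (φ x * (lap Ω w x + a * gradSq Ω w x)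
      + ∑ i, pd (closure Ω) i φ x * pd (closure Ω) i w x) = 0 := by
  have hs := hΩ.uniqueDiffOn
  rw [← integral_green hΩ ((exp_smooth hw a).mul hφ) hw hN]
  refine setIntegral_congr_fun hΩ.isOpen.measurableSet fun x hx => ?_
  have hx' := subset_closure hx
  simp only [pd_mul hs (exp_smooth hw a) hφ hx', pd_exp hs hw hx', gradSq, add_mul, mul_add,
    Finset.sum_add_distrib, Finset.mul_sum]
  have e1 : ∑ i, Real.exp (a * w x) * (a * pd (closure Ω) i w x) * φ x * pd (closure Ω) i w x
      = ∑ i, Real.exp (a * w x) * (φ x * (a * pd (closure Ω) i w x ^ 2)) :=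
    Finset.sum_congr rfl fun i _ => by ring
  have e2 : ∑ i, Real.exp (a * w x) * pd (closure Ω) i φ x * pd (closure Ω) i w x
      = ∑ i, Real.exp (a * w x) * (pd (closure Ω) i φ x * pd (closure Ω) i w x) :=
    Finset.sum_congr rfl fun i _ => by ring
  rw [e1, e2]; ring

/-- The first integration-by-parts formula. -/
lemma integral_hessGrad (hΩ : IsSmoothConvexDomain Ω) (hw : ContDiffOn ℝ ∞ w (closure Ω))
    (hN : Neumann Ω w) (m : ℝ) :
    ∫ x in Ω, Real.exp (m * w x) * (gradSq Ω w x * lap Ω w x + 2 * hessGrad Ω w x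
      + m * gradSq Ω w x ^ 2) = 0 := by
  have hs := hΩ.uniqueDiffOn
  rw [← integral_green_exp hΩ (gradSq_smooth hΩ hw) hw hN m]
  refine setIntegral_congr_fun hΩ.isOpen.measurableSet fun x hx => ?_
  have hx' := subset_closure hx
  have hpd : ∀ i, pd (closure Ω) i (gradSq Ω w) x
      = ∑ j, 2 * pd (closure Ω) j w x * pd (closure Ω) i (pd (closure Ω) j w) x := by
    intro i
    unfold gradSq
    rw [pd_sum hs (fun j _ => (pd_smooth hs hw j).pow 2) hx']
    exact Finset.sum_congr rfl fun j _ => pd_sq hs (pd_smooth hs hw j) hx'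
  have hsum : ∑ i, pd (closure Ω) i (gradSq Ω w) x * pd (closure Ω) i w x
      = 2 * hessGrad Ω w x := by
    simp_rw [hpd, hessGrad, Finset.sum_mul, Finset.mul_sum]
    rw [Finset.sum_comm]
    exact Finset.sum_congr rfl fun i _ => Finset.sum_congr rfl fun j _ => by ring
  rw [hsum]; ring

/-- The second integration-by-parts formula, of Bochner type. Its boundary term
`-⟪D²w ∇w, ν⟫` is nonnegative since the domain is convex. -/
lemma integral_hessSq_nonneg (hΩ : IsSmoothConvexDomain Ω) (hw : ContDiffOn ℝ ∞ w (closure Ω))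
    (hN : Neumann Ω w) (m : ℝ) :
    0 ≤ ∫ x in Ω, Real.exp (m * w x) * (lap Ω w x ^ 2 - hessSq Ω w x
      + m * (gradSq Ω w x * lap Ω w x - hessGrad Ω w x)) := by
  have hs := hΩ.uniqueDiffOn
  have hP := fun i => pd_smooth hs hw i
  have hH := fun i j => pd_smooth hs (hP i) j
  have hV : ∀ i, ContDiffOn ℝ ∞ (fun x => ∑ j, pd (closure Ω) j (pd (closure Ω) i w) x
      * pd (closure Ω) j w x) (closure Ω) :=
    fun i => ContDiffOn.sum fun j _ => (hH i j).mul (hP j)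
  have hF : ∀ i, ContDiffOn ℝ ∞ (fun x => (∑ j, pd (closure Ω) j (pd (closure Ω) i w) x
      * pd (closure Ω) j w x) - lap Ω w x * pd (closure Ω) i w x) (closure Ω) :=
    fun i => (hV i).sub ((lap_smooth hΩ hw).mul (hP i))
  have h := integral_div_nonpos hΩ (F := fun i x => Real.exp (m * w x) *
      ((∑ j, pd (closure Ω) j (pd (closure Ω) i w) x * pd (closure Ω) j w x)
        - lap Ω w x * pd (closure Ω) i w x))
    (fun i => ((exp_smooth hw m).mul (hF i)).of_le (by simp)) fun y hy ρ hρ => by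
      have h1 := hN y hy ρ hρ
      rw [← sum_pd_mul] at h1
      have h2 := sum_hessian_mul_normal_nonpos hΩ hw hN hy hρ
      simp_rw [mul_assoc (Real.exp _), sub_mul, mul_assoc (lap Ω w y)]
      rw [← Finset.mul_sum, Finset.sum_sub_distrib, ← Finset.mul_sum, h1, mul_zero, sub_zero]
      exact mul_nonpos_of_nonneg_of_nonpos (Real.exp_pos _).le h2
  rw [← neg_nonpos, ← integral_neg]
  refine le_of_eq_of_le (setIntegral_congr_fun hΩ.isOpen.measurableSet fun x hx => ?_) h
  have hx' := subset_closure hx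
  have hlap : ∀ i, pd (closure Ω) i (lap Ω w) x
      = ∑ j, pd (closure Ω) i (pd (closure Ω) j (pd (closure Ω) j w)) x := fun i => by
    unfold lap; exact pd_sum hs (fun j _ => hH j j) hx'
  have hdiv : ∀ i, pd (closure Ω) i (fun x => Real.exp (m * w x) *
      ((∑ j, pd (closure Ω) j (pd (closure Ω) i w) x * pd (closure Ω) j w x)
        - lap Ω w x * pd (closure Ω) i w x)) x
      = Real.exp (m * w x) * (
        (m * ∑ j, pd (closure Ω) j (pd (closure Ω) i w) x * pd (closure Ω) i w x
          * pd (closure Ω) j w x)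
        - m * lap Ω w x * pd (closure Ω) i w x ^ 2
        + (∑ j, pd (closure Ω) i (pd (closure Ω) j (pd (closure Ω) i w)) x * pd (closure Ω) j w x)
        + (∑ j, pd (closure Ω) j (pd (closure Ω) i w) x ^ 2)
        - (∑ j, pd (closure Ω) i (pd (closure Ω) j (pd (closure Ω) j w)) x * pd (closure Ω) i w x)
        - lap Ω w x * pd (closure Ω) i (pd (closure Ω) i w) x) := by
    intro i
    rw [pd_mul hs (exp_smooth hw m) (hF i) hx', pd_exp hs hw hx',
      pd_sub hs (hV i) ((lap_smooth hΩ hw).mul (hP i)) hx',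
      pd_mul hs (lap_smooth hΩ hw) (hP i) hx', hlap,
      pd_sum hs (fun j _ => (hH i j).mul (hP j)) hx',
      Finset.sum_congr rfl fun j _ => pd_mul hs (hH i j) (hP j) hx', Finset.sum_add_distrib,
      Finset.sum_mul]
    have e1 : ∑ j, pd (closure Ω) j (pd (closure Ω) i w) x
        * pd (closure Ω) i (pd (closure Ω) j w) x
        = ∑ j, pd (closure Ω) j (pd (closure Ω) i w) x ^ 2 :=
      Finset.sum_congr rfl fun j _ => by rw [pd_comm hΩ hw hx', pow_two]
    have e2 : ∑ j, pd (closure Ω) j (pd (closure Ω) i w) x * pd (closure Ω) i w x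
          * pd (closure Ω) j w x = pd (closure Ω) i w x
          * ∑ j, pd (closure Ω) j (pd (closure Ω) i w) x * pd (closure Ω) j w x := by
      rw [Finset.mul_sum]; exact Finset.sum_congr rfl fun j _ => by ring
    rw [e1, e2]; ring
  have e3 : ∑ i, ∑ j, pd (closure Ω) i (pd (closure Ω) j (pd (closure Ω) i w)) x
      * pd (closure Ω) j w x
      = ∑ i, ∑ j, pd (closure Ω) i (pd (closure Ω) j (pd (closure Ω) j w)) x
        * pd (closure Ω) i w x := by
    rw [Finset.sum_comm]
    exact Finset.sum_congr rfl fun i _ => Finset.sum_congr rfl fun j _ => by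
      rw [pd_comm hΩ (hP j) hx']
  simp only [hdiv]
  rw [← Finset.mul_sum, Finset.sum_sub_distrib, Finset.sum_sub_distrib, Finset.sum_add_distrib,
    Finset.sum_add_distrib, Finset.sum_sub_distrib, e3, ← Finset.mul_sum, ← Finset.mul_sum,
    ← Finset.mul_sum]
  simp only [gradSq, hessSq, hessGrad]
  have e4 : ∑ i, pd (closure Ω) i (pd (closure Ω) i w) x = lap Ω w x := rfl
  rw [e4]; ring

end parts

end

section

/-! ### Pointwise algebra -/

variable {d : ℕ} {Ω s : Set (Space d)}

section algebra

lemma sum_sq_sub_add (A : Fin d → Fin d → ℝ) (p : Fin d → ℝ) (a b : ℝ) :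
    ∑ i, ∑ j, (A i j - ((if i = j then a else 0) + b * p i * p j)) ^ 2
      = (∑ i, ∑ j, A i j ^ 2) - 2 * a * (∑ i, A i i) - 2 * b * (∑ i, ∑ j, A i j * p i * p j)
        + a ^ 2 * d + 2 * a * b * (∑ i, p i ^ 2) + b ^ 2 * (∑ i, p i ^ 2) ^ 2 := by
  have h : ∀ i j, (A i j - ((if i = j then a else 0) + b * p i * p j)) ^ 2
      = A i j ^ 2 - 2 * b * (A i j * p i * p j) + b ^ 2 * (p i ^ 2 * p j ^ 2)
        + (if i = j then a ^ 2 - 2 * a * A i j + 2 * a * b * (p i * p j) else 0) := by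
    intro i j
    split_ifs <;> ring
  simp_rw [h, Finset.sum_add_distrib, Finset.sum_sub_distrib, ← Finset.mul_sum]
  simp only [Finset.sum_ite_eq, Finset.mem_univ, if_true, Finset.sum_add_distrib,
    Finset.sum_sub_distrib, ← Finset.mul_sum, ← Finset.sum_mul, Finset.sum_const,
    Finset.card_univ, Fintype.card_fin, nsmul_eq_mul]
  simp_rw [← pow_two]
  ring

/-- The traceless part of `A`, evaluated at `p`, is of the form `(d - 1) σ |p|⁴`, also for `p = 0`
and in dimension one, where it vanishes. -/
lemma exists_sigma (hd : 1 ≤ d) (A : Fin d → Fin d → ℝ) (p : Fin d → ℝ) :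
    ∃ σ : ℝ, (∑ i, ∑ j, A i j * p i * p j) - (∑ i, A i i) / d * ∑ i, p i ^ 2
      = (d - 1) * σ * (∑ i, p i ^ 2) ^ 2 := by
  by_cases hp : ∑ i, p i ^ 2 = 0
  · have hp0 : ∀ i, p i = 0 := fun i => by
      have := (Finset.sum_eq_zero_iff_of_nonneg fun i _ => sq_nonneg (p i)).1 hp i
        (Finset.mem_univ i)
      simpa using this
    exact ⟨0, by simp [hp0]⟩
  rcases hd.eq_or_lt with rfl | hd
  · exact ⟨0, by simp; ring⟩
  · have h1 : (d : ℝ) - 1 ≠ 0 := by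
      have : (1 : ℝ) < d := by exact_mod_cast hd
      linarith
    refine ⟨((∑ i, ∑ j, A i j * p i * p j) - (∑ i, A i i) / d * ∑ i, p i ^ 2)
      / ((d - 1) * (∑ i, p i ^ 2) ^ 2), ?_⟩
    field_simp

/-- The squared norm of what remains of `A` after removing its trace part and the traceless part of
`σ d p ⊗ p`. -/
lemma sum_sq_sub_trace (hd : 1 ≤ d) (A : Fin d → Fin d → ℝ) (p : Fin d → ℝ) {σ : ℝ}
    (hσ : (∑ i, ∑ j, A i j * p i * p j) - (∑ i, A i i) / d * ∑ i, p i ^ 2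
      = (d - 1) * σ * (∑ i, p i ^ 2) ^ 2) :
    ∑ i, ∑ j, (A i j - ((if i = j then ((∑ i, A i i) / d - σ * ∑ i, p i ^ 2) else 0)
        + σ * d * p i * p j)) ^ 2
      = (∑ i, ∑ j, A i j ^ 2) - (∑ i, A i i) ^ 2 / d
        - d * (d - 1) * (σ * ∑ i, p i ^ 2) ^ 2 := by
  have hd0 : (d : ℝ) ≠ 0 := by positivity
  rw [sum_sq_sub_add]
  have e : ∑ i, ∑ j, A i j * p i * p j = (∑ i, A i i) / d * (∑ i, p i ^ 2)
      + (d - 1) * σ * (∑ i, p i ^ 2) ^ 2 := by linarith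
  rw [e]
  field_simp
  ring

lemma eq_zero_of_quadratic {a b c t : ℝ} (h : ∀ x : ℝ, 0 ≤ a * x ^ 2 + b * x + c)
    (h0 : a * t ^ 2 + b * t + c = 0) : 2 * a * t + b = 0 := by
  by_contra hk
  have h1 := h (t - (2 * a * t + b) / (2 * (|a| + 1)))
  set k := 2 * a * t + b with hk'
  set r := k / (2 * (|a| + 1)) with hr
  have hpos : 0 < |a| + 1 := by positivity
  have h2 : k = 2 * (|a| + 1) * r := by rw [hr]; field_simp
  have hr0 : r ≠ 0 := fun h => hk (by rw [h2, h, mul_zero])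
  have h3 : a * (t - r) ^ 2 + b * (t - r) + c = a * r ^ 2 - k * r := by
    rw [hk']; linear_combination h0
  rw [h3, h2] at h1
  have h4 : 0 < r ^ 2 := by positivity
  nlinarith [le_abs_self a, abs_nonneg a]

variable {C α β c₁ c₂ : ℝ}

/-- Nonnegativity of the polynomial `Q` at a vanishing point makes its partial derivatives with
respect to `η_L`, `η_R` and `η_S` vanish. -/
lemma polyQ_critical (h : ∀ ηG ηL ηR ηS : ℝ, 0 ≤ polyQ d C α β c₁ c₂ ηG ηL ηR ηS)
    {g l r t : ℝ} (h0 : polyQ d C α β c₁ c₂ g l r t = 0) :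
    2 * ((C + 1) + (1 - 1 / (d : ℝ)) * c₁) * l + ((C + 2) * (β - α)
      + (1 - 1 / (d : ℝ)) * (2 * β - α - 1) * c₁ - (2 / (d : ℝ) + 1) * c₂) * g ^ 2 = 0 ∧
    c₁ * r = 0 ∧
    2 * (-((d : ℝ) * ((d : ℝ) - 1) * c₁)) * t
      + (-((d : ℝ) - 1) * ((2 * β - α - 1) * c₁ + 2 * c₂)) * g ^ 2 = 0 := by
  unfold polyQ at h h0
  refine ⟨?_, ?_, ?_⟩
  · refine eq_zero_of_quadratic (t := l)
      (c := ((β - α) ^ 2 - (2 * β - 2 * α - 1) * c₂) * g ^ 4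
        + (-((d : ℝ) - 1) * ((2 * β - α - 1) * c₁ + 2 * c₂)) * t * g ^ 2
        + (-c₁) * r ^ 2 + (-((d : ℝ) * ((d : ℝ) - 1) * c₁)) * t ^ 2) (fun x => ?_) ?_
    · exact (h g x r t).trans_eq (by ring)
    · linear_combination h0
  · have := eq_zero_of_quadratic (a := -c₁) (b := 0) (t := r)
      (c := ((C + 1) + (1 - 1 / (d : ℝ)) * c₁) * l ^ 2
    + ((C + 2) * (β - α) + (1 - 1 / (d : ℝ)) * (2 * β - α - 1) * c₁
        - (2 / (d : ℝ) + 1) * c₂) * l * g ^ 2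
    + ((β - α) ^ 2 - (2 * β - 2 * α - 1) * c₂) * g ^ 4
    + (-((d : ℝ) - 1) * ((2 * β - α - 1) * c₁ + 2 * c₂)) * t * g ^ 2
    + (-((d : ℝ) * ((d : ℝ) - 1) * c₁)) * t ^ 2) (fun x => ?_) ?_
    · linarith
    · exact (h g l x t).trans_eq (by ring)
    · linear_combination h0
  · refine eq_zero_of_quadratic (t := t)
      (c := ((C + 1) + (1 - 1 / (d : ℝ)) * c₁) * l ^ 2
    + ((C + 2) * (β - α) + (1 - 1 / (d : ℝ)) * (2 * β - α - 1) * c₁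
        - (2 / (d : ℝ) + 1) * c₂) * l * g ^ 2
    + ((β - α) ^ 2 - (2 * β - 2 * α - 1) * c₂) * g ^ 4
    + (-c₁) * r ^ 2) (fun x => ?_) ?_
    · exact (h g l r x).trans_eq (by ring)
    · linear_combination h0

end algebra

/-! ### Positivity of the second variation -/

section strict

variable {w : Space d → ℝ}

lemma eqOn_zero_of_integral_eq_zero (hΩ : IsSmoothConvexDomain Ω) {f : Space d → ℝ}
    (hf : ContinuousOn f (closure Ω)) (h0 : ∀ x ∈ Ω, 0 ≤ f x) (hi : ∫ x in Ω, f x = 0) :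
    ∀ x ∈ Ω, f x = 0 := by
  have hae : f =ᵐ[volume.restrict Ω] fun _ => 0 :=
    (setIntegral_eq_zero_iff_of_nonneg_ae
      ((ae_restrict_iff' hΩ.isOpen.measurableSet).2 (Eventually.of_forall h0))
      (hΩ.integrableOn hf)).1 hi
  exact fun x hx => Measure.eqOn_open_of_ae_eq hae hΩ.isOpen (hf.mono subset_closure)
    continuousOn_const hx

lemma exists_const_of_pd_eq_zero (hΩ : IsSmoothConvexDomain Ω) {f : Space d → ℝ}
    (hf : ContDiffOn ℝ ∞ f (closure Ω)) (h : ∀ x ∈ Ω, ∀ i, pd (closure Ω) i f x = 0) :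
    ∃ c, ∀ x ∈ Ω, f x = c := by
  refine hΩ.isOpen.exists_is_const_of_fderiv_eq_zero hΩ.convex.isPreconnected
    ((hf.differentiableOn (by simp)).mono subset_closure) fun x hx => ?_
  ext v
  have := sum_pd_mul (s := closure Ω) (f := f) (x := x) (v := v)
  rw [fderivWithin_of_mem_nhds (hΩ.closure_mem_nhds hx)] at this
  rw [← this]
  simp [h x hx]

/-- Rigidity: the equation `Δw + a |∇w|² = 0` says that a strictly increasing function of `w` is
harmonic, so with Neumann conditions `w` is constant. -/
lemma exists_const_of_lap_add (hΩ : IsSmoothConvexDomain Ω) (hw : ContDiffOn ℝ ∞ w (closure Ω))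
    (hN : Neumann Ω w) {a : ℝ} (h : ∀ x ∈ Ω, lap Ω w x + a * gradSq Ω w x = 0) :
    ∃ c, ∀ x ∈ Ω, w x = c := by
  have hi := integral_green_exp hΩ hw hw hN a
  have hi' : ∫ x in Ω, Real.exp (a * w x) * gradSq Ω w x = 0 := by
    rw [← hi]
    refine setIntegral_congr_fun hΩ.isOpen.measurableSet fun x hx => ?_
    simp only [h x hx]
    simp only [gradSq, mul_zero, zero_add, pow_two]
  have h0 := eqOn_zero_of_integral_eq_zero hΩ
    ((exp_smooth hw a).mul (gradSq_smooth hΩ hw)).continuousOn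
    (fun x _ => mul_nonneg (Real.exp_pos _).le (gradSq_nonneg x)) hi'
  refine exists_const_of_pd_eq_zero hΩ hw fun x hx i => ?_
  have h1 : gradSq Ω w x = 0 := (mul_eq_zero.1 (h0 x hx)).resolve_left (Real.exp_pos _).ne'
  have := (Finset.sum_eq_zero_iff_of_nonneg fun i _ => sq_nonneg _).1 h1 i (Finset.mem_univ i)
  simpa using this

/-- Rigidity: if `D²w = f I + b ∇w ⊗ ∇w` and `φ' = exp (-b ·)`, then the Hessian of `φ ∘ w` is
`exp (-b w) f` times the identity; in dimension at least two the factor `exp (-b w) f` is then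
constant, and the Neumann condition makes it zero. -/
lemma exists_const_of_hessian (hΩ : IsSmoothConvexDomain Ω) (hd : 2 ≤ d)
    (hw : ContDiffOn ℝ ∞ w (closure Ω)) (hN : Neumann Ω w) {b : ℝ} {f : Space d → ℝ}
    (h : ∀ x ∈ Ω, ∀ i j, pd (closure Ω) j (pd (closure Ω) i w) x
      = (if i = j then f x else 0) + b * pd (closure Ω) i w x * pd (closure Ω) j w x) :
    ∃ c, ∀ x ∈ Ω, w x = c := by
  have hs := hΩ.uniqueDiffOn
  have hd0 : (d : ℝ) ≠ 0 := by positivity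
  have hlap : ∀ x ∈ Ω, lap Ω w x = d * f x + b * gradSq Ω w x := by
    intro x hx
    simp only [lap, gradSq, h x hx, if_true, Finset.sum_add_distrib, Finset.mul_sum,
      Finset.sum_const, Finset.card_univ, Fintype.card_fin, nsmul_eq_mul]
    congr 1
    exact Finset.sum_congr rfl fun i _ => by ring
  set F : Space d → ℝ := fun x => (d : ℝ)⁻¹ * (lap Ω w x - b * gradSq Ω w x) with hF
  have hFs : ContDiffOn ℝ ∞ F (closure Ω) :=
    contDiffOn_const.mul ((lap_smooth hΩ hw).sub (contDiffOn_const.mul (gradSq_smooth hΩ hw)))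
  have hFf : ∀ x ∈ Ω, F x = f x := fun x hx => by
    simp only [hF, hlap x hx]; field_simp; ring
  have hP := fun i => pd_smooth hs hw i
  have hbPP := fun i j => (contDiffOn_const (c := b) (n := ∞) (s := closure Ω)).mul
    ((hP i).mul (hP j))
  have hderiv : ∀ x ∈ Ω, ∀ k, pd (closure Ω) k F x = b * F x * pd (closure Ω) k w x := by
    intro x hx k
    have hx' := subset_closure hx
    -- compare `∂ₖ ∂ᵢ ∂ᵢ w` with `∂ᵢ ∂ₖ ∂ᵢ w` for some `i ≠ k`
    have : Nontrivial (Fin d) := Fin.nontrivial_iff_two_le.2 hd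
    obtain ⟨i, hik⟩ := exists_ne k
    have h1 : pd (closure Ω) k (pd (closure Ω) i (pd (closure Ω) i w)) x
        = pd (closure Ω) k F x + b * (pd (closure Ω) k (pd (closure Ω) i w) x
          * pd (closure Ω) i w x + pd (closure Ω) i w x
          * pd (closure Ω) k (pd (closure Ω) i w) x) := by
      rw [pd_congr hΩ (g := fun z => F z + b * (pd (closure Ω) i w z * pd (closure Ω) i w z))
        (fun z hz => by simp [h z hz, hFf z hz, mul_assoc]) hx, pd_add hs hFs (hbPP i i) hx',
        pd_const_mul hs ((hP i).mul (hP i)) hx', pd_mul hs (hP i) (hP i) hx']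
    have h2 : pd (closure Ω) i (pd (closure Ω) k (pd (closure Ω) i w)) x
        = b * (pd (closure Ω) i (pd (closure Ω) i w) x
          * pd (closure Ω) k w x + pd (closure Ω) i w x
          * pd (closure Ω) i (pd (closure Ω) k w) x) := by
      rw [pd_congr hΩ (g := fun z => b * (pd (closure Ω) i w z * pd (closure Ω) k w z))
        (fun z hz => by simp [h z hz, hik, mul_assoc]) hx,
        pd_const_mul hs ((hP i).mul (hP k)) hx', pd_mul hs (hP i) (hP k) hx']
    rw [pd_comm hΩ (hP i) hx', h2] at h1
    rw [h x hx i k, h x hx k i, h x hx i i, if_neg hik, if_neg hik.symm, if_pos rfl,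
      ← hFf x hx] at h1
    linear_combination -h1
  obtain ⟨c, hc⟩ := exists_const_of_pd_eq_zero hΩ ((exp_smooth hw (-b)).mul hFs) fun x hx k => by
    rw [pd_mul hs (exp_smooth hw (-b)) hFs (subset_closure hx),
      pd_exp hs hw (subset_closure hx), hderiv x hx k]
    ring
  have hi := integral_green_exp hΩ (contDiffOn_const (c := 1)) hw hN (-b)
  have hint : ∀ x ∈ Ω, Real.exp (-b * w x) * (1 * (lap Ω w x + -b * gradSq Ω w x)
      + ∑ i, pd (closure Ω) i (fun _ => (1 : ℝ)) x * pd (closure Ω) i w x) = d * c := by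
    intro x hx
    have : ∀ i, pd (closure Ω) i (fun _ => (1 : ℝ)) x = 0 := fun i => by simp [pd]
    simp only [this, zero_mul, Finset.sum_const_zero, hlap x hx, ← hc x hx, hFf x hx]
    ring
  rw [setIntegral_congr_fun hΩ.isOpen.measurableSet hint, setIntegral_const, smul_eq_mul,
    mul_eq_zero, mul_eq_zero] at hi
  have hvol : volume.real Ω ≠ 0 :=
    (ENNReal.toReal_pos (hΩ.isOpen.measure_pos _ hΩ.nonempty).ne' hΩ.volume_ne_top).ne'
  have hc0 : c = 0 := (hi.resolve_left hvol).resolve_left hd0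
  refine exists_const_of_lap_add hΩ hw hN (a := -b) fun x hx => ?_
  have h3 := hc x hx
  rw [hc0, mul_eq_zero] at h3
  rw [hlap x hx, ← hFf x hx, h3.resolve_left (Real.exp_pos _).ne']
  ring

/-- The density of the second variation of the entropy, in terms of `w = log u` and without the
weight `β ^ 2 * exp ((2 β + α - 1) w)`. -/
def secondVar (Ω : Set (Space d)) (C α β : ℝ) (w : Space d → ℝ) (x : Space d) : ℝ :=
  (lap Ω w x + β * gradSq Ω w x) ^ 2
    + C * (lap Ω w x + β * gradSq Ω w x) * (lap Ω w x + α * gradSq Ω w x)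

lemma secondVar_smooth (hΩ : IsSmoothConvexDomain Ω) (hw : ContDiffOn ℝ ∞ w (closure Ω))
    (C α β : ℝ) : ContDiffOn ℝ ∞ (secondVar Ω C α β w) (closure Ω) := by
  have hL := lap_smooth hΩ hw
  have hG := gradSq_smooth hΩ hw
  have h := fun a : ℝ => hL.add ((contDiffOn_const (c := a)).mul hG)
  exact ((h β).pow 2).add ((contDiffOn_const.mul (h β)).mul (h α))

/-- Adding multiples of the two integration-by-parts identities to the density of the second
variation gives a value of the polynomial `Q`, at the arguments `η_G = |∇w|`,
`η_L = Δw + α |∇w|²`, and `η_S`, `η_R` measuring the traceless part of `D²w + α ∇w ⊗ ∇w` in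
direction `∇w` and its remainder. -/
lemma exists_secondVar_eq_polyQ (hd : 1 ≤ d) (C α β c₁ c₂ : ℝ) (x : Space d) :
    ∃ r σ : ℝ, secondVar Ω C α β w x
      + c₁ * (lap Ω w x ^ 2 - hessSq Ω w x
        + (2 * β + α - 1) * (gradSq Ω w x * lap Ω w x - hessGrad Ω w x))
      - c₂ * (gradSq Ω w x * lap Ω w x + 2 * hessGrad Ω w x
        + (2 * β + α - 1) * gradSq Ω w x ^ 2)
      = polyQ d C α β c₁ c₂ (Real.sqrt (gradSq Ω w x)) (lap Ω w x + α * gradSq Ω w x) r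
        (σ * gradSq Ω w x) ∧
      (r = 0 → ∀ i j, pd (closure Ω) j (pd (closure Ω) i w) x
        = (if i = j then ((lap Ω w x + α * gradSq Ω w x) / d - σ * gradSq Ω w x) else 0)
          + (σ * d - α) * pd (closure Ω) i w x * pd (closure Ω) j w x) := by
  set p : Fin d → ℝ := fun i => pd (closure Ω) i w x with hp
  set A : Fin d → Fin d → ℝ := fun i j =>
    pd (closure Ω) j (pd (closure Ω) i w) x + α * (p i * p j) with hA
  have hG : ∑ i, p i ^ 2 = gradSq Ω w x := rfl
  have hL : ∑ i, A i i = lap Ω w x + α * gradSq Ω w x := by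
    simp only [hA, Finset.sum_add_distrib, ← Finset.mul_sum, ← pow_two]; rfl
  have hPP : ∑ i, ∑ j, A i j * p i * p j = hessGrad Ω w x + α * gradSq Ω w x ^ 2 := by
    have : ∀ i j, A i j * p i * p j = pd (closure Ω) j (pd (closure Ω) i w) x * p i * p j
        + α * (p i ^ 2 * p j ^ 2) := fun i j => by simp only [hA]; ring
    simp_rw [this, Finset.sum_add_distrib, ← Finset.mul_sum, ← Finset.sum_mul]
    rw [hG, ← pow_two]; rfl
  have hSq : ∑ i, ∑ j, A i j ^ 2 = hessSq Ω w x + 2 * α * hessGrad Ω w x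
      + α ^ 2 * gradSq Ω w x ^ 2 := by
    have : ∀ i j, A i j ^ 2 = pd (closure Ω) j (pd (closure Ω) i w) x ^ 2
        + 2 * α * (pd (closure Ω) j (pd (closure Ω) i w) x * p i * p j)
        + α ^ 2 * (p i ^ 2 * p j ^ 2) := fun i j => by simp only [hA]; ring
    simp_rw [this, Finset.sum_add_distrib, ← Finset.mul_sum, ← Finset.sum_mul]
    rw [hG, ← pow_two]; rfl
  obtain ⟨σ, hσ⟩ := exists_sigma hd A p
  have hrem := sum_sq_sub_trace hd A p hσ
  have hnn : 0 ≤ ∑ i, ∑ j, (A i j - ((if i = j then ((∑ i, A i i) / d - σ * ∑ i, p i ^ 2) else 0)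
        + σ * d * p i * p j)) ^ 2 :=
    Finset.sum_nonneg fun i _ => Finset.sum_nonneg fun j _ => sq_nonneg _
  set R2 := ∑ i, ∑ j, (A i j - ((if i = j then ((∑ i, A i i) / d - σ * ∑ i, p i ^ 2) else 0)
        + σ * d * p i * p j)) ^ 2 with hR2
  refine ⟨Real.sqrt R2, σ, ?_, ?_⟩
  · have hd0 : (d : ℝ) ≠ 0 := by positivity
    unfold polyQ secondVar
    have h4 : Real.sqrt (gradSq Ω w x) ^ 4 = gradSq Ω w x ^ 2 := by
      rw [show 4 = 2 * 2 from rfl, pow_mul, Real.sq_sqrt (gradSq_nonneg x)]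
    rw [h4, Real.sq_sqrt (gradSq_nonneg x), Real.sq_sqrt hnn, hrem, hL, hSq, hG]
    rw [hG, hL, hPP] at hσ
    linear_combination (-((2 * β - α - 1) * c₁ + 2 * c₂)) * hσ
  · intro hr i j
    have h0 : R2 = 0 := by
      have := Real.sq_sqrt hnn
      rw [hr] at this; linarith
    have h1 := (Finset.sum_eq_zero_iff_of_nonneg fun i _ =>
      Finset.sum_nonneg fun j _ => sq_nonneg _).1 h0 i (Finset.mem_univ i)
    have h2 := (Finset.sum_eq_zero_iff_of_nonneg fun j _ => sq_nonneg _).1 h1 j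
      (Finset.mem_univ j)
    rw [hL, hG] at h2
    have h3 : A i j = _ := sub_eq_zero.1 (pow_eq_zero_iff two_ne_zero |>.1 h2)
    simp only [hA] at h3
    linear_combination h3

/-- The second variation is positive as soon as `w` is not constant, also for those exponents for
which the polynomial `Q` is nonnegative but not positive definite. -/
theorem integral_secondVar_pos (hΩ : IsSmoothConvexDomain Ω) (hw : ContDiffOn ℝ ∞ w (closure Ω))
    (hN : Neumann Ω w) (hne : ¬ ∃ c, ∀ x ∈ Ω, w x = c) {C α β c₁ c₂ : ℝ} (hC : 0 ≤ C)
    (hc₁ : c₁ ≤ 0) (hQ : ∀ ηG ηL ηR ηS : ℝ, 0 ≤ polyQ d C α β c₁ c₂ ηG ηL ηR ηS) :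
    0 < ∫ x in Ω, Real.exp ((2 * β + α - 1) * w x) * secondVar Ω C α β w x := by
  set m := 2 * β + α - 1 with hm
  have hd := hΩ.one_le_dim
  have hG := gradSq_smooth hΩ hw
  have hL := lap_smooth hΩ hw
  have hE := exp_smooth hw m
  have hJ1 := integral_hessSq_nonneg hΩ hw hN m
  have hJ2 := integral_hessGrad hΩ hw hN m
  set e : Space d → ℝ := fun x => Real.exp (m * w x) with he
  set j1 : Space d → ℝ := fun x => lap Ω w x ^ 2 - hessSq Ω w x
        + m * (gradSq Ω w x * lap Ω w x - hessGrad Ω w x) with hj1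
  set j2 : Space d → ℝ := fun x => gradSq Ω w x * lap Ω w x + 2 * hessGrad Ω w x
        + m * gradSq Ω w x ^ 2 with hj2
  have cB : ContinuousOn (fun x => e x * secondVar Ω C α β w x) (closure Ω) :=
    (hE.mul (secondVar_smooth hΩ hw C α β)).continuousOn
  have c1 : ContinuousOn (fun x => e x * j1 x) (closure Ω) :=
    (hE.mul (((hL.pow 2).sub (hessSq_smooth hΩ hw)).add (contDiffOn_const.mul
      ((hG.mul hL).sub (hessGrad_smooth hΩ hw))))).continuousOn
  have c2 : ContinuousOn (fun x => e x * j2 x) (closure Ω) :=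
    (hE.mul (((hG.mul hL).add (contDiffOn_const.mul (hessGrad_smooth hΩ hw))).add
      (contDiffOn_const.mul (hG.pow 2)))).continuousOn
  have cN : ContinuousOn (fun x => e x * secondVar Ω C α β w x + c₁ * (e x * j1 x)
      - c₂ * (e x * j2 x)) (closure Ω) :=
    (cB.add (continuousOn_const.mul c1)).sub (continuousOn_const.mul c2)
  have hNnn : ∀ x ∈ Ω, 0 ≤ e x * secondVar Ω C α β w x + c₁ * (e x * j1 x)
      - c₂ * (e x * j2 x) := by
    intro x _
    obtain ⟨r, σ, h1, -⟩ := exists_secondVar_eq_polyQ (Ω := Ω) (w := w) hd C α β c₁ c₂ x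
    have : e x * secondVar Ω C α β w x + c₁ * (e x * j1 x) - c₂ * (e x * j2 x)
        = e x * (secondVar Ω C α β w x + c₁ * j1 x - c₂ * j2 x) := by ring
    rw [this]
    exact mul_nonneg (Real.exp_pos _).le ((hQ _ _ _ _).trans_eq h1.symm)
  have hint : ∫ x in Ω, (e x * secondVar Ω C α β w x + c₁ * (e x * j1 x) - c₂ * (e x * j2 x))
      = (∫ x in Ω, e x * secondVar Ω C α β w x) + c₁ * (∫ x in Ω, e x * j1 x) := by
    have hi12 : IntegrableOn (fun x => e x * secondVar Ω C α β w x + c₁ * (e x * j1 x)) Ω :=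
      (hΩ.integrableOn cB).add ((hΩ.integrableOn c1).const_mul _)
    rw [integral_sub hi12 ((hΩ.integrableOn c2).const_mul _), integral_add (hΩ.integrableOn cB)
      ((hΩ.integrableOn c1).const_mul _), integral_const_mul, integral_const_mul, hJ2]
    ring
  have hge := setIntegral_nonneg (μ := volume) hΩ.isOpen.measurableSet hNnn
  rw [hint] at hge
  have hc1J := mul_nonpos_of_nonpos_of_nonneg hc₁ hJ1
  -- otherwise the nonnegative integrand vanishes identically, so that its arguments minimize `Q`
  by_contra hle
  rw [not_lt] at hle
  have hzero := eqOn_zero_of_integral_eq_zero hΩ cN hNnn (by rw [hint]; linarith)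
  have hcrit : ∀ x ∈ Ω, ∃ r σ : ℝ, polyQ d C α β c₁ c₂ (Real.sqrt (gradSq Ω w x))
      (lap Ω w x + α * gradSq Ω w x) r (σ * gradSq Ω w x) = 0 ∧
      (r = 0 → ∀ i j, pd (closure Ω) j (pd (closure Ω) i w) x
        = (if i = j then ((lap Ω w x + α * gradSq Ω w x) / d - σ * gradSq Ω w x) else 0)
          + (σ * d - α) * pd (closure Ω) i w x * pd (closure Ω) j w x) := by
    intro x hx
    obtain ⟨r, σ, h1, h2⟩ := exists_secondVar_eq_polyQ (Ω := Ω) (w := w) hd C α β c₁ c₂ x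
    refine ⟨r, σ, ?_, h2⟩
    rw [← h1]
    have h3 := hzero x hx
    have : e x * secondVar Ω C α β w x + c₁ * (e x * j1 x) - c₂ * (e x * j2 x)
        = e x * (secondVar Ω C α β w x + c₁ * j1 x - c₂ * j2 x) := by ring
    rw [this] at h3
    exact (mul_eq_zero.1 h3).resolve_left (Real.exp_pos _).ne'
  by_cases hq : (C + 1) + (1 - 1 / (d : ℝ)) * c₁ = 0
  -- the polynomial does not control `η_L`, but then it controls the traceless Hessian
  · have hc1n : c₁ < 0 := lt_of_le_of_ne hc₁ fun h => by rw [h] at hq; linarith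
    have hd2 : 2 ≤ d := by
      by_contra hlt
      have : d = 1 := by omega
      rw [this] at hq; norm_num at hq; linarith
    have hd2' : (2 : ℝ) ≤ d := by exact_mod_cast hd2
    set σ₀ : ℝ := -((2 * β - α - 1) * c₁ + 2 * c₂) / (2 * d * c₁) with hσ₀
    refine hne (exists_const_of_hessian hΩ hd2 hw hN (b := σ₀ * d - α)
      (f := fun x => (lap Ω w x + α * gradSq Ω w x) / d - σ₀ * gradSq Ω w x) fun x hx i j => ?_)
    obtain ⟨r, σ, h1, h2⟩ := hcrit x hx
    obtain ⟨-, h4, h5⟩ := polyQ_critical hQ h1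
    have hr := (mul_eq_zero.1 h4).resolve_left hc1n.ne
    rw [Real.sq_sqrt (gradSq_nonneg x)] at h5
    have hσ : σ * gradSq Ω w x = σ₀ * gradSq Ω w x := by
      have h6 : ((d : ℝ) - 1) * (2 * d * c₁ * (σ * gradSq Ω w x)
          + ((2 * β - α - 1) * c₁ + 2 * c₂) * gradSq Ω w x) = 0 := by linear_combination -h5
      have h7 := (mul_eq_zero.1 h6).resolve_left (by linarith)
      have h8 : 2 * (d : ℝ) * c₁ ≠ 0 := by
        have := hc1n.ne; positivity
      rw [hσ₀, div_mul_eq_mul_div, eq_div_iff h8]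
      linear_combination h7
    have h9 := h2 hr i j
    have hprod : σ * (pd (closure Ω) i w x * pd (closure Ω) j w x)
        = σ₀ * (pd (closure Ω) i w x * pd (closure Ω) j w x) := by
      by_cases hg : gradSq Ω w x = 0
      · have := (Finset.sum_eq_zero_iff_of_nonneg fun i _ => sq_nonneg _).1 hg i
          (Finset.mem_univ i)
        have hpi : pd (closure Ω) i w x = 0 := by simpa using this
        rw [hpi]; ring
      · rw [mul_right_cancel₀ hg hσ]
    rw [h9, hσ]
    linear_combination (d : ℝ) * hprod
  -- the minimizing `η_L` is a multiple of `η_G²`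
  · refine hne (exists_const_of_lap_add hΩ hw hN (a := α + ((C + 2) * (β - α)
      + (1 - 1 / (d : ℝ)) * (2 * β - α - 1) * c₁ - (2 / (d : ℝ) + 1) * c₂)
      / (2 * ((C + 1) + (1 - 1 / (d : ℝ)) * c₁))) fun x hx => ?_)
    obtain ⟨r, σ, h1, -⟩ := hcrit x hx
    obtain ⟨h3, -, -⟩ := polyQ_critical hQ h1
    rw [Real.sq_sqrt (gradSq_nonneg x)] at h3
    set q := (C + 1) + (1 - 1 / (d : ℝ)) * c₁ with hqdef
    clear_value q
    generalize (C + 2) * (β - α) + (1 - 1 / (d : ℝ)) * (2 * β - α - 1) * c₁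
      - (2 / (d : ℝ) + 1) * c₂ = q' at h3 ⊢
    field_simp
    linear_combination h3

end strict

end

section

/-! ### The parameter region -/

variable {d : ℕ} {C α β : ℝ}

/-- Nonnegativity of the polynomial `Q` for suitable multipliers. -/
def Feasible (d : ℕ) (C α β : ℝ) : Prop :=
  ∃ c₁ c₂ : ℝ, c₁ ≤ 0 ∧ ∀ ηG ηL ηR ηS : ℝ, 0 ≤ polyQ d C α β c₁ c₂ ηG ηL ηR ηS

lemma regionZero_eq (d : ℕ) (C : ℝ) :
    regionZero d C = interior {p : ℝ × ℝ | 0 < p.1 ∧ 0 < p.2 ∧ Feasible d C p.1 p.2} := rfl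

/-- For a Hessian of rank one in the direction of the gradient, that is for `η_S = η_L / d` and
`η_R = 0`, the polynomial `Q` does not depend on `c₁` and `d`. Here `η_G = 1` and `η_L = x`. -/
lemma quadratic_of_polyQ (hd : 1 ≤ d) {c₁ c₂ : ℝ}
    (h : ∀ ηG ηL ηR ηS : ℝ, 0 ≤ polyQ d C α β c₁ c₂ ηG ηL ηR ηS) (x : ℝ) :
    0 ≤ (C + 1) * (x * x) + ((C + 2) * (β - α) - 3 * c₂) * x
      + ((β - α) ^ 2 - (2 * β - 2 * α - 1) * c₂) := by
  have hd0 : (d : ℝ) ≠ 0 := by positivity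
  refine (h 1 x 0 (x / d)).trans_eq ?_
  unfold polyQ
  field_simp
  ring

/-- The discriminant condition necessary for feasibility in all dimensions. -/
lemma Feasible.exists_le (hd : 1 ≤ d) (h : Feasible d C α β) :
    ∃ c : ℝ, 9 * c ^ 2 + c * ((2 * C - 4) * (β - α) - 4 * (C + 1)) + C ^ 2 * (β - α) ^ 2 ≤ 0 := by
  obtain ⟨c₁, c₂, -, hQ⟩ := h
  have := discrim_le_zero (quadratic_of_polyQ hd hQ)
  refine ⟨c₂, le_of_eq_of_le ?_ this⟩
  rw [discrim]; ring

/-- In dimension one the discriminant condition is sufficient: there `c₁` may be taken zero. -/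
lemma feasible_one_of_le (hC : 0 ≤ C) {c : ℝ}
    (h : 9 * c ^ 2 + c * ((2 * C - 4) * (β - α) - 4 * (C + 1)) + C ^ 2 * (β - α) ^ 2 ≤ 0) :
    Feasible 1 C α β := by
  refine ⟨0, c, le_rfl, fun g l r t => ?_⟩
  have h1 : 0 ≤ 4 * (C + 1) * polyQ 1 C α β 0 c g l r t := by
    have : 4 * (C + 1) * polyQ 1 C α β 0 c g l r t
        = (2 * (C + 1) * l + ((C + 2) * (β - α) - 3 * c) * g ^ 2) ^ 2
          + -(9 * c ^ 2 + c * ((2 * C - 4) * (β - α) - 4 * (C + 1)) + C ^ 2 * (β - α) ^ 2)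
            * (g ^ 2) ^ 2 := by
      unfold polyQ; push_cast; ring
    rw [this]
    have := mul_nonneg (neg_nonneg.2 h) (sq_nonneg (g ^ 2))
    positivity
  exact nonneg_of_mul_nonneg_right h1 (by positivity)

lemma Feasible.sub_mem_of_one (hd : 1 ≤ d) (h : Feasible d 1 α β) :
    -2 ≤ α - β ∧ α - β ≤ 1 := by
  obtain ⟨c, hc⟩ := h.exists_le hd
  have h1 : (β - α - 2) * (β - α + 1) ≤ 0 := by
    nlinarith [sq_nonneg (3 * c - (β - α + 4) / 3)]
  constructor <;> nlinarith

lemma Feasible.sub_mem_of_two (hd : 1 ≤ d) (h : Feasible d 2 α β) :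
    -1 ≤ α - β ∧ α - β ≤ 1 := by
  obtain ⟨c, hc⟩ := h.exists_le hd
  have h1 : (β - α) ^ 2 ≤ 1 := by nlinarith [sq_nonneg (3 * c - 2)]
  constructor <;> nlinarith

lemma interior_strip (a b : ℝ) :
    interior {p : ℝ × ℝ | 0 < p.1 ∧ 0 < p.2 ∧ a ≤ p.1 - p.2 ∧ p.1 - p.2 ≤ b}
      = {p : ℝ × ℝ | 0 < p.1 ∧ 0 < p.2 ∧ a < p.1 - p.2 ∧ p.1 - p.2 < b} := by
  refine Subset.antisymm (fun p hp => ?_) (interior_maximal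
    (fun p hp => ⟨hp.1, hp.2.1, hp.2.2.1.le, hp.2.2.2.le⟩) ?_)
  · have hc : Continuous fun t : ℝ => (p.1 + t, p.2) := by fun_prop
    have hn : ∀ᶠ t : ℝ in 𝓝 0, (p.1 + t, p.2) ∈ {p : ℝ × ℝ | 0 < p.1 ∧ 0 < p.2 ∧
        a ≤ p.1 - p.2 ∧ p.1 - p.2 ≤ b} := by
      refine (hc.tendsto 0).eventually ?_
      rw [add_zero]
      exact mem_interior_iff_mem_nhds.1 hp
    obtain ⟨e, he, hball⟩ := Metric.eventually_nhds_iff.1 hn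
    have h1 := hball (y := e / 2) (by rw [Real.dist_eq, sub_zero, abs_of_pos] <;> linarith)
    have h2 := hball (y := -(e / 2))
      (by rw [Real.dist_eq, sub_zero, abs_neg, abs_of_pos] <;> linarith)
    have h3 := interior_subset hp
    simp only [mem_ofPred_eq] at h1 h2
    exact ⟨h3.1, h3.2.1, by linarith [h2.2.2.1], by linarith [h1.2.2.2]⟩
  · exact (isOpen_lt continuous_const continuous_fst).inter
      ((isOpen_lt continuous_const continuous_snd).inter
        ((isOpen_lt continuous_const (continuous_fst.sub continuous_snd)).inter
          (isOpen_lt (continuous_fst.sub continuous_snd) continuous_const)))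

lemma regionZero_one_zero : regionZero 1 0 = Ioi 0 ×ˢ Ioi 0 := by
  have : {p : ℝ × ℝ | 0 < p.1 ∧ 0 < p.2 ∧ Feasible 1 0 p.1 p.2} = Ioi 0 ×ˢ Ioi 0 := by
    ext p
    refine ⟨fun h => ⟨h.1, h.2.1⟩, fun h => ⟨h.1, h.2, feasible_one_of_le le_rfl (c := 0) ?_⟩⟩
    simp
  rw [regionZero_eq, this]
  exact (isOpen_Ioi.prod isOpen_Ioi).interior_eq

lemma regionZero_one_one :
    regionZero 1 1 = {p : ℝ × ℝ | 0 < p.1 ∧ 0 < p.2 ∧ -2 < p.1 - p.2 ∧ p.1 - p.2 < 1} := by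
  rw [← interior_strip, regionZero_eq]
  congr 1
  ext p
  refine and_congr_right fun _ => and_congr_right fun _ =>
    ⟨fun h => h.sub_mem_of_one le_rfl, fun h =>
      -- the discriminant is smallest for this `c`
      feasible_one_of_le zero_le_one (c := (p.2 - p.1 + 4) / 9) ?_⟩
  nlinarith [mul_nonneg (sub_nonneg.2 h.1) (sub_nonneg.2 h.2)]

lemma regionZero_one_two :
    regionZero 1 2 = {p : ℝ × ℝ | 0 < p.1 ∧ 0 < p.2 ∧ -1 < p.1 - p.2 ∧ p.1 - p.2 < 1} := by
  rw [← interior_strip, regionZero_eq]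
  congr 1
  ext p
  refine and_congr_right fun _ => and_congr_right fun _ =>
    ⟨fun h => h.sub_mem_of_two le_rfl, fun h =>
      -- the discriminant is smallest for this `c`
      feasible_one_of_le zero_le_two (c := 2 / 3) ?_⟩
  nlinarith [mul_nonneg (sub_nonneg.2 h.1) (sub_nonneg.2 h.2)]

/-- Near `α = β = 1` the multipliers `c₁ = -1/2` and `c₂ = 1/10` make `Q` positive definite. -/
lemma regionZero_nonempty (hd : 1 ≤ d) (hC : 0 ≤ C) : (regionZero d C).Nonempty := by
  have hd1 : (1 : ℝ) ≤ d := by exact_mod_cast hd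
  have hd0 : (0 : ℝ) < d := by linarith
  set q : ℝ × ℝ → ℝ := fun p => (C + 2) * (p.2 - p.1)
    + (1 - 1 / (d : ℝ)) * (2 * p.2 - p.1 - 1) * (-1 / 2) - (2 / (d : ℝ) + 1) * (1 / 10) with hq
  set k : ℝ × ℝ → ℝ := fun p => (2 * p.2 - p.1 - 1) * (-1 / 2) + 2 * (1 / 10) with hk
  set g : ℝ × ℝ → ℝ := fun p => (p.2 - p.1) ^ 2 - (2 * p.2 - 2 * p.1 - 1) * (1 / 10) with hg
  have ho : IsOpen {p : ℝ × ℝ | 0 < p.1 ∧ 0 < p.2 ∧ 0 < g p - q p ^ 2 / 2 - k p ^ 2 / 2} :=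
    (isOpen_lt continuous_const continuous_fst).inter
      ((isOpen_lt continuous_const continuous_snd).inter
        (isOpen_lt continuous_const
          (by fun_prop : Continuous fun p => g p - q p ^ 2 / 2 - k p ^ 2 / 2)))
  refine ⟨(1, 1), interior_maximal ?_ ho ⟨one_pos, one_pos, ?_⟩⟩
  · rintro p ⟨h1, h2, h3⟩
    refine ⟨h1, h2, -1 / 2, 1 / 10, by norm_num, fun G L R S => ?_⟩
    have e : polyQ d C p.1 p.2 (-1 / 2) (1 / 10) G L R S
        = (C + 1 / (2 * (d : ℝ))) * L ^ 2 + 1 / 2 * (L + q p * G ^ 2) ^ 2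
          + (g p - q p ^ 2 / 2 - k p ^ 2 / 2) * (G ^ 2) ^ 2
          + (d - 1) * (d / 2 * (S - k p * G ^ 2 / d) ^ 2) + 1 / (2 * (d : ℝ)) * (k p * G ^ 2) ^ 2
          + 1 / 2 * R ^ 2 := by
      simp only [polyQ, hq, hk, hg]
      field_simp
      ring
    rw [e]
    have hd2 : 0 ≤ (d : ℝ) - 1 := by linarith
    positivity
  · have h1 : 0 < 1 / (d : ℝ) := by positivity
    have h2 : 1 / (d : ℝ) ≤ 1 := (div_le_one hd0).2 hd1
    simp only [hq, hk, hg]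
    rw [show 2 / (d : ℝ) = 2 * (1 / d) by ring]
    generalize 1 / (d : ℝ) = y at h1 h2 ⊢
    have h3 : (2 * y + 1) ^ 2 ≤ 9 := by nlinarith
    nlinarith

lemma continuous_polyQ (d : ℕ) (C β ηG ηL ηR ηS : ℝ) :
    Continuous fun z : ℝ × ℝ × ℝ => polyQ d C z.1 β z.2.1 z.2.2 ηG ηL ηR ηS := by
  unfold polyQ; fun_prop

/-- The multipliers stay bounded on bounded sets of exponents, so that feasibility survives
passing to limits. -/
lemma isCompact_feasible (hd : 1 ≤ d) (hC : 0 ≤ C) (β b : ℝ) :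
    IsCompact {α : ℝ | α ∈ Icc 0 b ∧ Feasible d C α β} := by
  -- at the points `x₁ α` and `x₂ α` the multiplier `c₂` enters the quadratic polynomial of
  -- `quadratic_of_polyQ` with coefficients `1` and `-1`
  set x₁ : ℝ → ℝ := fun α => (-1 - (2 * β - 2 * α - 1)) / 3 with hx₁
  set x₂ : ℝ → ℝ := fun α => (1 - (2 * β - 2 * α - 1)) / 3 with hx₂
  set E : ℝ → ℝ → ℝ := fun α x =>
    (C + 1) * (x * x) + (C + 2) * (β - α) * x + (β - α) ^ 2 with hE
  obtain ⟨B₁, hB₁⟩ := (isCompact_Icc (a := (0 : ℝ)) (b := b)).exists_bound_of_continuousOn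
    (f := fun α => E α (x₁ α)) (by simp only [hE, hx₁]; fun_prop)
  obtain ⟨B₂, hB₂⟩ := (isCompact_Icc (a := (0 : ℝ)) (b := b)).exists_bound_of_continuousOn
    (f := fun α => E α (x₂ α)) (by simp only [hE, hx₂]; fun_prop)
  set K : Set (ℝ × ℝ × ℝ) := Icc 0 b ×ˢ Icc (-(2 * (C + 1))) 0 ×ˢ Icc (-B₁) B₂ with hK
  have hKc : IsCompact K := isCompact_Icc.prod (isCompact_Icc.prod isCompact_Icc)
  have hcl : IsClosed {z : ℝ × ℝ × ℝ | ∀ ηG ηL ηR ηS : ℝ,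
      0 ≤ polyQ d C z.1 β z.2.1 z.2.2 ηG ηL ηR ηS} := by
    simp only [ofPred_forall]
    exact isClosed_iInter fun G => isClosed_iInter fun L => isClosed_iInter fun R =>
      isClosed_iInter fun S => isClosed_le continuous_const (continuous_polyQ d C β G L R S)
  have himg := (hKc.inter_right hcl).image continuous_fst
  convert himg using 1
  ext α
  constructor
  · rintro ⟨hα, c₁, c₂, hc₁, hQ⟩
    have hq := quadratic_of_polyQ hd hQ
    have h1 : -B₁ ≤ c₂ := by
      have h := hq (x₁ α)
      have h' := (abs_le.1 (hB₁ α hα)).2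
      have : (C + 1) * (x₁ α * x₁ α) + ((C + 2) * (β - α) - 3 * c₂) * x₁ α
        + ((β - α) ^ 2 - (2 * β - 2 * α - 1) * c₂) = E α (x₁ α) + c₂ := by
        simp only [hE, hx₁]; ring
      linarith
    have h2 : c₂ ≤ B₂ := by
      have h := hq (x₂ α)
      have h' := (abs_le.1 (hB₂ α hα)).2
      have : (C + 1) * (x₂ α * x₂ α) + ((C + 2) * (β - α) - 3 * c₂) * x₂ α
        + ((β - α) ^ 2 - (2 * β - 2 * α - 1) * c₂) = E α (x₂ α) - c₂ := by
        simp only [hE, hx₂]; ring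
      linarith
    rcases hd.eq_or_lt with rfl | hd2
    -- in dimension one the multiplier `c₁` only enters through `η_R` and may be replaced by zero
    · refine ⟨(α, 0, c₂), ⟨⟨hα, ⟨by simp; linarith, le_rfl⟩, h1, h2⟩, fun G L R S => ?_⟩, rfl⟩
      refine (hQ G L 0 S).trans_eq ?_
      simp [polyQ]
    · refine ⟨(α, c₁, c₂), ⟨⟨hα, ⟨?_, hc₁⟩, h1, h2⟩, hQ⟩, rfl⟩
      have h3 := hQ 0 1 0 0
      simp only [polyQ] at h3
      have h4 : 1 / (d : ℝ) ≤ 1 / 2 :=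
        one_div_le_one_div_of_le two_pos (by exact_mod_cast hd2)
      norm_num at h3 h4
      show -(2 * (C + 1)) ≤ c₁
      nlinarith
  · rintro ⟨⟨a, c₁, c₂⟩, ⟨⟨h1, h2, -⟩, hQ⟩, rfl⟩
    exact ⟨h1, c₁, c₂, h2.2, hQ⟩

lemma RungeKutta.crk_eq {s : ℕ} (T : RungeKutta s) (h : T.IsConsistent) :
    T.CRK = 2 * (1 - ∑ i, T.b i * T.c i) := by
  simp only [CRK, mul_sub, mul_one, Finset.sum_sub_distrib, h.2]

lemma RungeKutta.IsImplicitEuler.crk {s : ℕ} {T : RungeKutta s} (h : T.IsImplicitEuler) :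
    T.CRK = 0 := by
  obtain ⟨-, -, hb, hc⟩ := h
  simp [CRK, hb, hc]

lemma RungeKutta.HasOrderAtLeastTwo.crk {s : ℕ} {T : RungeKutta s} (h : T.HasOrderAtLeastTwo) :
    T.CRK = 1 := by
  rw [T.crk_eq h.1, h.2]; norm_num

lemma RungeKutta.IsExplicitEuler.isConsistent {s : ℕ} {T : RungeKutta s}
    (h : T.IsExplicitEuler) : T.IsConsistent := by
  obtain ⟨rfl, ha, hb, hc⟩ := h
  exact ⟨fun i => by simp [ha, hc], by simp [hb]⟩

lemma RungeKutta.IsExplicitEuler.crk {s : ℕ} {T : RungeKutta s} (h : T.IsExplicitEuler) :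
    T.CRK = 2 := by
  rw [T.crk_eq h.isConsistent]
  obtain ⟨rfl, ha, hb, hc⟩ := h
  simp [hc]

end

section

/-! ### One step of the scheme -/

variable {d : ℕ} {Ω : Set (Space d)}

section calculus

variable {f : Space d → ℝ} {x : Space d}

lemma laplacian_eq_lap (hΩ : IsSmoothConvexDomain Ω) (hf : ContDiffOn ℝ ∞ f (closure Ω))
    (hx : x ∈ Ω) : Laplacian.laplacian f x = lap Ω f x := by
  rw [InnerProductSpace.laplacian_eq_iteratedFDeriv_orthonormalBasis f
    (EuclideanSpace.basisFun (Fin d) ℝ)]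
  have hC : ContDiffOn ℝ ∞ f Ω := hf.mono subset_closure
  have hd : DifferentiableAt ℝ (fderiv ℝ f) x :=
    (((hC.fderiv_of_isOpen (m := ∞) hΩ.isOpen (by simp)).differentiableOn (by simp)) x
      hx).differentiableAt (hΩ.isOpen.mem_nhds hx)
  refine Finset.sum_congr rfl fun i _ => ?_
  rw [iteratedFDeriv_two_apply, pd_congr hΩ
    (g := fun z => fderiv ℝ f z (EuclideanSpace.single i 1)) (fun z hz => by
      rw [pd, fderivWithin_of_mem_nhds (hΩ.closure_mem_nhds hz)]) hx, pd,
    fderivWithin_of_mem_nhds (hΩ.closure_mem_nhds hx), fderiv_clm_apply hd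
      (differentiableAt_const _)]
  simp

lemma norm_gradient_sq (hΩ : IsSmoothConvexDomain Ω) (hx : x ∈ Ω) :
    ‖gradient f x‖ ^ 2 = gradSq Ω f x := by
  rw [EuclideanSpace.norm_sq_eq]
  refine Finset.sum_congr rfl fun i _ => ?_
  rw [Real.norm_eq_abs, sq_abs, pd, fderivWithin_of_mem_nhds (hΩ.closure_mem_nhds hx)]
  congr 1
  have h : ⟪gradient f x, EuclideanSpace.single i (1 : ℝ)⟫
      = fderiv ℝ f x (EuclideanSpace.single i 1) := by
    rw [gradient, InnerProductSpace.toDual_symm_apply]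
  rw [← h, EuclideanSpace.inner_single_right]
  simp

lemma rpow_smooth {s : Set (Space d)} (hf : ContDiffOn ℝ ∞ f s) (h0 : ∀ x ∈ s, 0 < f x) (a : ℝ) :
    ContDiffOn ℝ ∞ (fun z => f z ^ a) s :=
  hf.rpow_const_of_ne fun x hx => (h0 x hx).ne'

lemma pd_rpow {s : Set (Space d)} (hs : UniqueDiffOn ℝ s) (hf : ContDiffOn ℝ ∞ f s) (hx : x ∈ s)
    (h0 : 0 < f x) (a : ℝ) (i : Fin d) :
    pd s i (fun z => f z ^ a) x = a * f x ^ (a - 1) * pd s i f x :=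
  pd_comp (h := fun y => y ^ a) hs hf hx (Real.hasDerivAt_rpow_const (Or.inl h0.ne'))

end calculus

/-- Strong convexity of the entropy density on the segment between two states. -/
lemma rpow_convexity {α u v : ℝ} (hα : 0 < α) (hu : 0 < u) (hv : 0 < v) :
    1 / (α * (α + 1)) * u ^ (α + 1) + u ^ α / α * (v - u)
      + (v - u) ^ 2 / 2 * min (u ^ (α - 1)) (v ^ (α - 1)) ≤ 1 / (α * (α + 1)) * v ^ (α + 1) := by
  set c := min (u ^ (α - 1)) (v ^ (α - 1)) with hc
  set g : ℝ → ℝ := fun s => 1 / (α * (α + 1)) * s ^ (α + 1) - c / 2 * s ^ 2 with hg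
  have hpos : ∀ s ∈ uIcc u v, 0 < s := fun s hs => lt_of_lt_of_le (lt_min hu hv) hs.1
  have hd1 : ∀ s, 0 < s → HasDerivAt g (s ^ α / α - c * s) s := by
    intro s hs
    have h := ((Real.hasDerivAt_rpow_const (p := α + 1) (Or.inl hs.ne')).const_mul
      (1 / (α * (α + 1)))).sub ((hasDerivAt_pow 2 s).const_mul (c / 2))
    refine h.congr_deriv ?_
    rw [add_sub_cancel_right]
    field_simp
    ring
  have hd2 : ∀ s, 0 < s → HasDerivAt (fun s => s ^ α / α - c * s) (s ^ (α - 1) - c) s := by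
    intro s hs
    have h := ((Real.hasDerivAt_rpow_const (p := α) (Or.inl hs.ne')).div_const α).sub
      ((hasDerivAt_id s).const_mul c)
    refine h.congr_deriv ?_
    field_simp
  have hge : ∀ s ∈ uIcc u v, 0 ≤ s ^ (α - 1) - c := by
    intro s hs
    have hs0 := hpos s hs
    rw [sub_nonneg]
    rcases le_total 1 α with h1 | h1
    · have : min u v ^ (α - 1) ≤ s ^ (α - 1) :=
        Real.rpow_le_rpow (lt_min hu hv).le hs.1 (by linarith)
      refine le_trans ?_ this
      rcases le_total u v with h | h
      · rw [min_eq_left h]; exact min_le_left _ _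
      · rw [min_eq_right h]; exact min_le_right _ _
    · have : max u v ^ (α - 1) ≤ s ^ (α - 1) :=
        Real.rpow_le_rpow_of_nonpos hs0 hs.2 (by linarith)
      refine le_trans ?_ this
      rcases le_total u v with h | h
      · rw [max_eq_right h]; exact min_le_right _ _
      · rw [max_eq_left h]; exact min_le_left _ _
  have hconv : ConvexOn ℝ (uIcc u v) g := by
    refine convexOn_of_hasDerivWithinAt2_nonneg (convex_uIcc u v)
      (fun s hs => (hd1 s (hpos s hs)).continuousAt.continuousWithinAt)
      (fun s hs => (hd1 s (hpos s (interior_subset hs))).hasDerivWithinAt)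
      (fun s hs => (hd2 s (hpos s (interior_subset hs))).hasDerivWithinAt)
      fun s hs => hge s (interior_subset hs)
  have key : g u + (u ^ α / α - c * u) * (v - u) ≤ g v := by
    rcases lt_trichotomy u v with h | h | h
    · have := hconv.le_slope_of_hasDerivAt left_mem_uIcc right_mem_uIcc h (hd1 u hu)
      rw [slope_def_field, le_div_iff₀ (by linarith)] at this
      linarith
    · subst h; simp
    · have := hconv.slope_le_of_hasDerivAt right_mem_uIcc left_mem_uIcc h (hd1 u hu)
      rw [slope_def_field, div_le_iff₀ (by linarith)] at this
      linarith
  simp only [hg] at key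
  linarith

section step

variable {s : ℕ} {T : RungeKutta s} {α β τ : ℝ} {v u : Space d → ℝ} {K : Fin s → Space d → ℝ}

/-- The sum `∑ bᵢ Kᵢ` of the increments. -/
def increment (T : RungeKutta s) (K : Fin s → Space d → ℝ) (x : Space d) : ℝ :=
  ∑ i, T.b i * K i x

/-- The difference between the `i`-th stage and the new state, divided by the step size. -/
def stageShift (T : RungeKutta s) (K : Fin s → Space d → ℝ) (i : Fin s) (x : Space d) : ℝ :=
  ∑ j, T.a i j * K j x - increment T K x

lemma IsStep.stage_eq (h : IsStep T Ω β τ v u K) (i : Fin s) {x : Space d} (hx : x ∈ Ω) :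
    stage T τ v K i x = u x + τ * stageShift T K i x := by
  simp only [stage, stageShift, increment, h.update_eq x hx]; ring

lemma IsStep.increment_smooth' (h : IsStep T Ω β τ v u K) :
    ContDiffOn ℝ ∞ (increment T K) (closure Ω) :=
  ContDiffOn.sum fun i _ => contDiffOn_const.mul (h.increment_smooth i)

lemma IsStep.stageShift_smooth (h : IsStep T Ω β τ v u K) (i : Fin s) :
    ContDiffOn ℝ ∞ (stageShift T K i) (closure Ω) :=
  (ContDiffOn.sum fun j _ => contDiffOn_const.mul (h.increment_smooth j)).sub h.increment_smooth'

lemma IsStep.increment_eq_lap (h : IsStep T Ω β τ v u K) (hΩ : IsSmoothConvexDomain Ω)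
    (i : Fin s) {x : Space d} (hx : x ∈ Ω) :
    K i x = lap Ω (fun y => stage T τ v K i y ^ β) x := by
  rw [h.increment_eq i x hx, pmOperator, neg_neg]
  exact laplacian_eq_lap hΩ (rpow_smooth (h.stage_admissible i).1 (h.stage_admissible i).2.1 β) hx

/-- Testing the equation of a stage with the derivative `u ^ α / α` of the entropy density. -/
lemma IsStep.integral_rpow_mul_increment (h : IsStep T Ω β τ v u K)
    (hΩ : IsSmoothConvexDomain Ω) (hα : 0 < α) (i : Fin s) :
    ∫ x in Ω, u x ^ α / α * K i x = -∫ x in Ω, u x ^ (α - 1) *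
      ∑ j, pd (closure Ω) j u x * pd (closure Ω) j (fun y => stage T τ v K i y ^ β) x := by
  have hs := hΩ.uniqueDiffOn
  have hu := h.new_admissible
  have hw := h.stage_admissible i
  have hφ : ContDiffOn ℝ ∞ (fun x => α⁻¹ * u x ^ α) (closure Ω) :=
    contDiffOn_const.mul (rpow_smooth hu.1 hu.2.1 α)
  have hψ := rpow_smooth hw.1 hw.2.1 β
  have hg := integral_green hΩ hφ hψ hw.2.2
  have hi1 : ContinuousOn (fun x => ∑ j, pd (closure Ω) j (fun x => α⁻¹ * u x ^ α) x
        * pd (closure Ω) j (fun y => stage T τ v K i y ^ β) x) (closure Ω) :=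
    continuousOn_finsetSum _ fun j _ =>
      (pd_smooth hs hφ j).continuousOn.mul (pd_smooth hs hψ j).continuousOn
  have hi2 : ContinuousOn (fun x => α⁻¹ * u x ^ α
      * lap Ω (fun y => stage T τ v K i y ^ β) x) (closure Ω) :=
    hφ.continuousOn.mul (lap_smooth hΩ hψ).continuousOn
  rw [integral_add (hΩ.integrableOn hi1) (hΩ.integrableOn hi2)] at hg
  have e1 : ∫ x in Ω, u x ^ α / α * K i x = ∫ x in Ω, α⁻¹ * u x ^ α
      * lap Ω (fun y => stage T τ v K i y ^ β) x := by
    refine setIntegral_congr_fun hΩ.isOpen.measurableSet fun x hx => ?_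
    simp only [h.increment_eq_lap hΩ i hx]; ring
  have e2 : ∫ x in Ω, u x ^ (α - 1) *
      ∑ j, pd (closure Ω) j u x * pd (closure Ω) j (fun y => stage T τ v K i y ^ β) x
      = ∫ x in Ω, ∑ j, pd (closure Ω) j (fun x => α⁻¹ * u x ^ α) x
        * pd (closure Ω) j (fun y => stage T τ v K i y ^ β) x := by
    refine setIntegral_congr_fun hΩ.isOpen.measurableSet fun x hx => ?_
    have hx' := subset_closure hx
    simp only [Finset.mul_sum]
    refine Finset.sum_congr rfl fun j _ => ?_
    rw [pd_const_mul hs (rpow_smooth hu.1 hu.2.1 α) hx', pd_rpow hs hu.1 hx' (hu.2.1 x hx')]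
    field_simp
  rw [e1, e2]
  linarith

/-- A lower bound for the difference of the two sides of the discrete entropy inequality: convexity
of the entropy density around the new state, and each stage equation tested with the derivative of
the density. The first term is the error made by replacing the stages by the new state. -/
theorem IsStep.le_entropy_sub (h : IsStep T Ω β τ v u K) (hΩ : IsSmoothConvexDomain Ω)
    (hT : ∑ i, T.b i = 1) (hα : 0 < α) :
    (∫ x in Ω, (τ * (u x ^ (α - 1) * ∑ i, T.b i * ∑ j, pd (closure Ω) j u x *
        (pd (closure Ω) j (fun y => stage T τ v K i y ^ β) x
          - pd (closure Ω) j (fun y => u y ^ β) x))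
      + τ ^ 2 * (increment T K x ^ 2 / 2 * min (u x ^ (α - 1)) (v x ^ (α - 1)))))
      ≤ entropy Ω α v - entropy Ω α u - τ * production Ω α β u := by
  have hs := hΩ.uniqueDiffOn
  have hu := h.new_admissible
  have hv := h.old_admissible
  have cu := fun a => (rpow_smooth hu.1 hu.2.1 a).continuousOn
  have cv := fun a => (rpow_smooth hv.1 hv.2.1 a).continuousOn
  have cpu := fun j => (pd_smooth hs hu.1 j).continuousOn
  have cpw := fun i j => (pd_smooth hs (rpow_smooth (h.stage_admissible i).1
    (h.stage_admissible i).2.1 β) j).continuousOn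
  have cK := fun i => (h.increment_smooth i).continuousOn
  have cκ := h.increment_smooth'.continuousOn
  have cG : ∀ i, ContinuousOn (fun x => u x ^ (α - 1) * ∑ j, pd (closure Ω) j u x *
      pd (closure Ω) j (fun y => stage T τ v K i y ^ β) x) (closure Ω) := fun i =>
    (cu _).mul (continuousOn_finsetSum _ fun j _ => (cpu j).mul (cpw i j))
  have cP : ContinuousOn (fun x => β * (u x ^ (α + β - 2) * gradSq Ω u x)) (closure Ω) :=
    continuousOn_const.mul ((cu _).mul (gradSq_smooth hΩ hu.1).continuousOn)
  have cR : ContinuousOn (fun x => increment T K x ^ 2 / 2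
      * min (u x ^ (α - 1)) (v x ^ (α - 1))) (closure Ω) :=
    ((cκ.pow 2).div_const 2).mul (ContinuousOn.inf (cu _) (cv _))
  have cR' : ContinuousOn (fun x => τ ^ 2 * (increment T K x ^ 2 / 2
      * min (u x ^ (α - 1)) (v x ^ (α - 1)))) (closure Ω) := continuousOn_const.mul cR
  have cA : ∀ i, ContinuousOn (fun x => T.b i * (u x ^ α / α * K i x)) (closure Ω) := fun i =>
    continuousOn_const.mul (((cu _).div_const _).mul (cK i))
  have cA' : ContinuousOn (fun x => -τ * ∑ i, T.b i * (u x ^ α / α * K i x)) (closure Ω) :=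
    continuousOn_const.mul (continuousOn_finsetSum _ fun i _ => cA i)
  have hprod : production Ω α β u = ∫ x in Ω, β * (u x ^ (α + β - 2) * gradSq Ω u x) := by
    rw [production, ← integral_const_mul]
    refine setIntegral_congr_fun hΩ.isOpen.measurableSet fun x hx => ?_
    simp only [norm_gradient_sq hΩ hx]
  have hconv : entropy Ω α u + ∫ x in Ω, (-τ * ∑ i, T.b i * (u x ^ α / α * K i x)
      + τ ^ 2 * (increment T K x ^ 2 / 2 * min (u x ^ (α - 1)) (v x ^ (α - 1))))
      ≤ entropy Ω α v := by
    have cS : ContinuousOn (fun x => -τ * ∑ i, T.b i * (u x ^ α / α * K i x)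
      + τ ^ 2 * (increment T K x ^ 2 / 2 * min (u x ^ (α - 1)) (v x ^ (α - 1)))) (closure Ω) :=
      cA'.add cR'
    have cU : ContinuousOn (fun x => 1 / (α * (α + 1)) * u x ^ (α + 1)) (closure Ω) :=
      continuousOn_const.mul (cu _)
    rw [entropy, entropy, ← integral_const_mul, ← integral_const_mul,
      ← integral_add (hΩ.integrableOn cU) (hΩ.integrableOn cS)]
    refine setIntegral_mono_on (hΩ.integrableOn (cU.add cS))
      (hΩ.integrableOn (continuousOn_const.mul (cv _))) hΩ.isOpen.measurableSet fun x hx => ?_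
    have hx' := subset_closure hx
    have hc := rpow_convexity hα (hu.2.1 x hx') (hv.2.1 x hx')
    have hvu : v x - u x = -τ * increment T K x := by
      rw [h.update_eq x hx, increment]; ring
    rw [hvu] at hc
    refine le_of_eq_of_le ?_ hc
    have : ∑ i, T.b i * (u x ^ α / α * K i x) = u x ^ α / α * increment T K x := by
      rw [increment, Finset.mul_sum]; exact Finset.sum_congr rfl fun i _ => by ring
    simp only [this]
    ring
  have hsplit : ∫ x in Ω, (-τ * ∑ i, T.b i * (u x ^ α / α * K i x)
      + τ ^ 2 * (increment T K x ^ 2 / 2 * min (u x ^ (α - 1)) (v x ^ (α - 1))))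
      = τ * ∑ i, T.b i * (∫ x in Ω, u x ^ (α - 1) * ∑ j, pd (closure Ω) j u x *
      pd (closure Ω) j (fun y => stage T τ v K i y ^ β) x) +
      τ ^ 2 * ∫ x in Ω, increment T K x ^ 2 / 2 * min (u x ^ (α - 1)) (v x ^ (α - 1)) := by
    rw [integral_add (hΩ.integrableOn cA') (hΩ.integrableOn cR'), integral_const_mul,
      integral_const_mul, integral_finsetSum _ fun i _ => hΩ.integrableOn (cA i)]
    simp only [integral_const_mul, h.integral_rpow_mul_increment hΩ hα, mul_neg,
      Finset.sum_neg_distrib, neg_mul, neg_neg]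
  have hlhs : ∫ x in Ω, (τ * (u x ^ (α - 1) * ∑ i, T.b i * ∑ j, pd (closure Ω) j u x *
        (pd (closure Ω) j (fun y => stage T τ v K i y ^ β) x
          - pd (closure Ω) j (fun y => u y ^ β) x))
      + τ ^ 2 * (increment T K x ^ 2 / 2 * min (u x ^ (α - 1)) (v x ^ (α - 1))))
      = τ * ∑ i, T.b i * (∫ x in Ω, u x ^ (α - 1) * ∑ j, pd (closure Ω) j u x *
      pd (closure Ω) j (fun y => stage T τ v K i y ^ β) x) - τ * production Ω α β u +
      τ ^ 2 * ∫ x in Ω, increment T K x ^ 2 / 2 * min (u x ^ (α - 1)) (v x ^ (α - 1)) := by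
    have cG' : ∀ i, ContinuousOn (fun x => T.b i * (u x ^ (α - 1) * ∑ j, pd (closure Ω) j u x *
        pd (closure Ω) j (fun y => stage T τ v K i y ^ β) x)) (closure Ω) := fun i =>
      continuousOn_const.mul (cG i)
    have hcs' : ContinuousOn (fun x => τ * ∑ i, T.b i * (u x ^ (α - 1) *
        ∑ j, pd (closure Ω) j u x * pd (closure Ω) j (fun y => stage T τ v K i y ^ β) x))
        (closure Ω) := continuousOn_const.mul (continuousOn_finsetSum _ fun i _ => cG' i)
    have cP' : ContinuousOn (fun x => τ * (β * (u x ^ (α + β - 2) * gradSq Ω u x)))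
        (closure Ω) := continuousOn_const.mul cP
    have hcd : ContinuousOn (fun x => τ * (∑ i, T.b i * (u x ^ (α - 1) *
        ∑ j, pd (closure Ω) j u x * pd (closure Ω) j (fun y => stage T τ v K i y ^ β) x))
        - τ * (β * (u x ^ (α + β - 2) * gradSq Ω u x))) (closure Ω) := hcs'.sub cP'
    have hpt : ∀ x ∈ Ω, τ * (u x ^ (α - 1) * ∑ i, T.b i * ∑ j, pd (closure Ω) j u x *
        (pd (closure Ω) j (fun y => stage T τ v K i y ^ β) x
          - pd (closure Ω) j (fun y => u y ^ β) x))
      + τ ^ 2 * (increment T K x ^ 2 / 2 * min (u x ^ (α - 1)) (v x ^ (α - 1)))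
      = (τ * (∑ i, T.b i * (u x ^ (α - 1) * ∑ j, pd (closure Ω) j u x *
        pd (closure Ω) j (fun y => stage T τ v K i y ^ β) x))
        - τ * (β * (u x ^ (α + β - 2) * gradSq Ω u x)))
        + τ ^ 2 * (increment T K x ^ 2 / 2 * min (u x ^ (α - 1)) (v x ^ (α - 1))) := by
      intro x hx
      have hx' := subset_closure hx
      have hux := hu.2.1 x hx'
      have e1 : ∀ i, ∑ j, pd (closure Ω) j u x *
        (pd (closure Ω) j (fun y => stage T τ v K i y ^ β) x
          - pd (closure Ω) j (fun y => u y ^ β) x) = (∑ j, pd (closure Ω) j u x *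
        pd (closure Ω) j (fun y => stage T τ v K i y ^ β) x)
          - β * u x ^ (β - 1) * gradSq Ω u x := by
        intro i
        rw [gradSq, Finset.mul_sum, ← Finset.sum_sub_distrib]
        refine Finset.sum_congr rfl fun j _ => ?_
        rw [pd_rpow hs hu.1 hx' hux]; ring
      have e2 : u x ^ (α + β - 2) = u x ^ (α - 1) * u x ^ (β - 1) := by
        rw [← Real.rpow_add hux]; ring_nf
      have e3 : ∑ i, T.b i * (u x ^ (α - 1) * ∑ j, pd (closure Ω) j u x *
        pd (closure Ω) j (fun y => stage T τ v K i y ^ β) x)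
        = u x ^ (α - 1) * ∑ i, T.b i * ∑ j, pd (closure Ω) j u x *
        pd (closure Ω) j (fun y => stage T τ v K i y ^ β) x := by
        rw [Finset.mul_sum]; exact Finset.sum_congr rfl fun i _ => by ring
      simp only [e1]
      simp only [mul_sub, Finset.sum_sub_distrib, ← Finset.sum_mul, hT, e2, e3]
      ring
    rw [setIntegral_congr_fun hΩ.isOpen.measurableSet hpt, integral_add (hΩ.integrableOn hcd)
      (hΩ.integrableOn cR'), integral_sub (hΩ.integrableOn hcs') (hΩ.integrableOn cP'),
      integral_const_mul, integral_finsetSum _ fun i _ => hΩ.integrableOn (cG' i), hprod]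
    simp only [integral_const_mul]
  rw [hlhs]
  rw [hsplit] at hconv
  linarith

/-- For the implicit Euler scheme the only stage is the new state, so the entropy inequality holds
for all step sizes. -/
theorem IsStep.entropy_le_of_isImplicitEuler (h : IsStep T Ω β τ v u K)
    (hΩ : IsSmoothConvexDomain Ω) (hT : T.IsImplicitEuler) (hα : 0 < α) :
    entropy Ω α u + τ * production Ω α β u ≤ entropy Ω α v := by
  obtain ⟨rfl, ha, hb, -⟩ := hT
  have hle := h.le_entropy_sub hΩ (by simp [hb]) hα
  have hnn : 0 ≤ ∫ x in Ω, (τ * (u x ^ (α - 1) * ∑ i, T.b i * ∑ j, pd (closure Ω) j u x *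
        (pd (closure Ω) j (fun y => stage T τ v K i y ^ β) x
          - pd (closure Ω) j (fun y => u y ^ β) x))
      + τ ^ 2 * (increment T K x ^ 2 / 2 * min (u x ^ (α - 1)) (v x ^ (α - 1)))) := by
    refine setIntegral_nonneg hΩ.isOpen.measurableSet fun x hx => ?_
    have hux := h.new_admissible.2.1 x (subset_closure hx)
    have hvx := h.old_admissible.2.1 x (subset_closure hx)
    have e : ∀ i j, pd (closure Ω) j (fun y => stage T τ v K i y ^ β) x
        = pd (closure Ω) j (fun y => u y ^ β) x := fun i j =>
      pd_congr hΩ (fun y hy => by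
        simp only [h.stage_eq i hy, stageShift, increment, ha, hb, sub_self, mul_zero,
          add_zero]) hx
    simp only [e, sub_self, mul_zero, Finset.sum_const_zero, zero_add]
    positivity
  linarith

end step

end

section

/-! ### The second variation of the entropy along the scheme -/

variable {d : ℕ} {Ω : Set (Space d)}

section secondVariation

variable {u : Space d → ℝ} {x : Space d}

lemma log_smooth (hu : ContDiffOn ℝ ∞ u (closure Ω)) (h0 : ∀ x ∈ closure Ω, 0 < u x) :
    ContDiffOn ℝ ∞ (fun z => Real.log (u z)) (closure Ω) :=
  hu.log fun x hx => (h0 x hx).ne'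

lemma pd_eq_mul_pd_log (hΩ : IsSmoothConvexDomain Ω) (hu : ContDiffOn ℝ ∞ u (closure Ω))
    (h0 : ∀ x ∈ closure Ω, 0 < u x) (hx : x ∈ closure Ω) (j : Fin d) :
    pd (closure Ω) j u x = u x * pd (closure Ω) j (fun z => Real.log (u z)) x := by
  have hux := h0 x hx
  rw [pd_comp (h := Real.log) hΩ.uniqueDiffOn hu hx (Real.hasDerivAt_log hux.ne')]
  field_simp

lemma neumann_log {β : ℝ} (hΩ : IsSmoothConvexDomain Ω) (hβ : 0 < β)
    (hu : Admissible Ω β u) : Neumann Ω (fun z => Real.log (u z)) := by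
  intro y hy ρ hρ
  have hy' : y ∈ closure Ω := hy.1
  have hs := hΩ.uniqueDiffOn
  have huy := hu.2.1 y hy'
  have h := hu.2.2 y hy ρ hρ
  rw [← sum_pd_mul] at h ⊢
  have e : ∀ i, pd (closure Ω) i (fun z => u z ^ β) y
      = β * u y ^ β * pd (closure Ω) i (fun z => Real.log (u z)) y := by
    intro i
    rw [pd_rpow hs hu.1 hy' huy, pd_eq_mul_pd_log hΩ hu.1 hu.2.1 hy', Real.rpow_sub_one huy.ne']
    field_simp
  simp_rw [e, mul_assoc, ← Finset.mul_sum] at h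
  have hne : u y ^ β ≠ 0 := (Real.rpow_pos_of_pos huy β).ne'
  exact (mul_eq_zero.1 ((mul_eq_zero.1 h).resolve_left hβ.ne')).resolve_left hne

lemma lap_congr (hΩ : IsSmoothConvexDomain Ω) {f g : Space d → ℝ} (h : EqOn f g Ω) (hx : x ∈ Ω) :
    lap Ω f x = lap Ω g x :=
  Finset.sum_congr rfl fun _ _ => pd_congr hΩ (fun _ hz => pd_congr hΩ h hz) hx

lemma lap_rpow (hΩ : IsSmoothConvexDomain Ω) (hu : ContDiffOn ℝ ∞ u (closure Ω))
    (h0 : ∀ x ∈ closure Ω, 0 < u x) (β : ℝ) (hx : x ∈ Ω) :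
    lap Ω (fun z => u z ^ β) x = β * u x ^ β * (lap Ω (fun z => Real.log (u z)) x
      + β * gradSq Ω (fun z => Real.log (u z)) x) := by
  have hs := hΩ.uniqueDiffOn
  have hw := log_smooth hu h0
  have e1 : ∀ j, ∀ z ∈ closure Ω, pd (closure Ω) j (fun z => u z ^ β) z
      = β * (u z ^ β * pd (closure Ω) j (fun z => Real.log (u z)) z) := by
    intro j z hz
    have huz := h0 z hz
    rw [pd_rpow hs hu hz huz, pd_eq_mul_pd_log hΩ hu h0 hz, Real.rpow_sub_one huz.ne']
    field_simp
  have hx' := subset_closure hx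
  have e2 : ∀ j, pd (closure Ω) j (pd (closure Ω) j (fun z => u z ^ β)) x
      = β * u x ^ β * (pd (closure Ω) j (pd (closure Ω) j (fun z => Real.log (u z))) x
        + β * pd (closure Ω) j (fun z => Real.log (u z)) x ^ 2) := by
    intro j
    have hβ := rpow_smooth hu h0 β
    have hp := pd_smooth hs hw j
    rw [pd_congr hΩ (fun z hz => e1 j z (subset_closure hz)) hx,
      pd_const_mul hs (hβ.mul hp) hx', pd_mul hs hβ hp hx', e1 j x hx']
    ring
  simp only [lap, gradSq, e2, ← Finset.mul_sum, Finset.sum_add_distrib]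

/-- The second variation in terms of `w = log u`. -/
theorem integral_secondVariation_eq {β : ℝ} (hΩ : IsSmoothConvexDomain Ω) (hβ : 0 < β)
    (hu : Admissible Ω β u) (C α : ℝ) :
    ∫ x in Ω, u x ^ (α - 1) * (lap Ω (fun z => u z ^ β) x ^ 2
      - C * (β * (u x ^ (β - 1) * (∑ j, pd (closure Ω) j u x
          * pd (closure Ω) j (lap Ω fun z => u z ^ β) x)
        + gradSq Ω u x * ((β - 1) * u x ^ (β - 2) * lap Ω (fun z => u z ^ β) x))))
    = β ^ 2 * ∫ x in Ω, Real.exp ((2 * β + α - 1) * Real.log (u x))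
      * secondVar Ω C α β (fun z => Real.log (u z)) x := by
  have hs := hΩ.uniqueDiffOn
  have hw := log_smooth hu.1 hu.2.1
  have hN := neumann_log hΩ hβ hu
  set w : Space d → ℝ := fun z => Real.log (u z) with hwdef
  set k : Space d → ℝ := lap Ω (fun z => u z ^ β) with hk
  have hks : ContDiffOn ℝ ∞ k (closure Ω) := lap_smooth hΩ (rpow_smooth hu.1 hu.2.1 β)
  have hb := rpow_smooth hu.1 hu.2.1 (β - 1)
  have hφ : ContDiffOn ℝ ∞ (fun z => β * (u z ^ (β - 1) * k z)) (closure Ω) :=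
    contDiffOn_const.mul (hb.mul hks)
  have hgreen := integral_green_exp hΩ hφ hw hN α
  have hgc : ContinuousOn (fun x => Real.exp (α * w x) * ((β * (u x ^ (β - 1) * k x))
      * (lap Ω w x + α * gradSq Ω w x)
      + ∑ i, pd (closure Ω) i (fun z => β * (u z ^ (β - 1) * k z)) x * pd (closure Ω) i w x))
      (closure Ω) :=
    ((exp_smooth hw α).mul ((hφ.mul ((lap_smooth hΩ hw).add (contDiffOn_const.mul
      (gradSq_smooth hΩ hw)))).add (ContDiffOn.sum fun i _ =>
        (pd_smooth hs hφ i).mul (pd_smooth hs hw i)))).continuousOn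
  have hsc : ContinuousOn (fun x => Real.exp ((2 * β + α - 1) * w x) * secondVar Ω C α β w x)
      (closure Ω) := ((exp_smooth hw _).mul (secondVar_smooth hΩ hw C α β)).continuousOn
  have hkey : ∀ x ∈ Ω, u x ^ (α - 1) * (k x ^ 2
      - C * (β * (u x ^ (β - 1) * (∑ j, pd (closure Ω) j u x * pd (closure Ω) j k x)
        + gradSq Ω u x * ((β - 1) * u x ^ (β - 2) * k x))))
      = β ^ 2 * (Real.exp ((2 * β + α - 1) * w x) * secondVar Ω C α β w x)
        - C * (Real.exp (α * w x) * ((β * (u x ^ (β - 1) * k x))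
      * (lap Ω w x + α * gradSq Ω w x)
      + ∑ i, pd (closure Ω) i (fun z => β * (u z ^ (β - 1) * k z)) x
        * pd (closure Ω) i w x)) := by
    intro x hx
    have hx' := subset_closure hx
    have hux := hu.2.1 x hx'
    have hexp : ∀ a : ℝ, Real.exp (a * w x) = u x ^ a := fun a => by
      rw [Real.rpow_def_of_pos hux, mul_comm]
    have hpdφ : ∀ i, pd (closure Ω) i (fun z => β * (u z ^ (β - 1) * k z)) x
        = β * ((β - 1) * u x ^ (β - 2) * k x * pd (closure Ω) i u x
          + u x ^ (β - 1) * pd (closure Ω) i k x) := by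
      intro i
      rw [pd_const_mul hs (hb.mul hks) hx', pd_mul hs hb hks hx', pd_rpow hs hu.1 hx' hux,
        show β - 1 - 1 = β - 2 by ring]
      ring
    have hpw : ∀ i, pd (closure Ω) i w x = (u x)⁻¹ * pd (closure Ω) i u x := fun i => by
      rw [pd_eq_mul_pd_log hΩ hu.1 hu.2.1 hx']; field_simp; rfl
    have hsum : ∑ i, pd (closure Ω) i (fun z => β * (u z ^ (β - 1) * k z)) x
        * pd (closure Ω) i w x = (u x)⁻¹ * (β * (u x ^ (β - 1) *
          (∑ j, pd (closure Ω) j u x * pd (closure Ω) j k x)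
        + gradSq Ω u x * ((β - 1) * u x ^ (β - 2) * k x))) := by
      simp only [gradSq, Finset.mul_sum, Finset.sum_mul, ← Finset.sum_add_distrib]
      refine Finset.sum_congr rfl fun i _ => ?_
      rw [hpdφ, hpw]; ring
    have e1 : u x ^ (α - 1) = u x ^ α * (u x)⁻¹ := by
      rw [Real.rpow_sub_one hux.ne']; rfl
    have e2 : u x ^ (2 * β + α - 1) = u x ^ α * (u x)⁻¹ * (u x ^ β) ^ 2 := by
      rw [show 2 * β + α - 1 = α + β + β - 1 by ring, Real.rpow_sub_one hux.ne',
        Real.rpow_add hux, Real.rpow_add hux]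
      field_simp
    have e3 : u x ^ (β - 1) = u x ^ β * (u x)⁻¹ := by
      rw [Real.rpow_sub_one hux.ne']; rfl
    have e4 : k x = β * u x ^ β * (lap Ω w x + β * gradSq Ω w x) :=
      lap_rpow hΩ hu.1 hu.2.1 β hx
    rw [hexp, hexp, hsum, secondVar, e2, e1]
    generalize β * (u x ^ (β - 1) * (∑ j, pd (closure Ω) j u x * pd (closure Ω) j k x)
        + gradSq Ω u x * ((β - 1) * u x ^ (β - 2) * k x)) = Z
    rw [e3, e4]
    ring
  rw [setIntegral_congr_fun hΩ.isOpen.measurableSet hkey,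
    integral_sub ((hΩ.integrableOn hsc).const_mul _) ((hΩ.integrableOn hgc).const_mul _),
    integral_const_mul, integral_const_mul, hgreen]
  ring

end secondVariation

/-! ### Expansion in the step size -/

/-- Difference quotients of a power along a base point and a direction that both converge. -/
lemma tendsto_rpow_quotient {ι : Type*} {l : Filter ι} {U W E t : ι → ℝ} {u₀ E₀ a : ℝ}
    (hu₀ : 0 < u₀) (hU : Tendsto U l (𝓝 u₀)) (hW : Tendsto W l (𝓝 u₀)) (hE : Tendsto E l (𝓝 E₀))
    (h : ∀ᶠ i in l, W i = U i + t i * E i ∧ t i ≠ 0) :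
    Tendsto (fun i => (W i ^ a - U i ^ a) / t i) l (𝓝 (a * u₀ ^ (a - 1) * E₀)) := by
  have hd := (Real.hasStrictDerivAt_rpow_const (p := a) (Or.inl hu₀.ne')).isLittleO
  have h1 := hd.comp_tendsto (hW.prodMk_nhds hU)
  have h2 : (fun i => W i - U i) =O[l] t := by
    have hE1 : E =O[l] (fun _ => (1 : ℝ)) := hE.isBigO_one ℝ
    have := (Asymptotics.isBigO_refl t l).mul hE1
    refine (this.congr' ?_ ?_)
    · filter_upwards [h] with i hi
      rw [hi.1]; ring
    · exact Eventually.of_forall fun i => mul_one _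
  have h3 := (h1.trans_isBigO h2).tendsto_div_nhds_zero
  have h4 := h3.add (hE.const_mul (a * u₀ ^ (a - 1)))
  rw [zero_add] at h4
  refine h4.congr' ?_
  filter_upwards [h] with i hi
  have := hi.2
  simp only [Function.comp_apply, ContinuousLinearMap.toSpanSingleton_apply, smul_eq_mul]
  rw [hi.1]
  field_simp
  ring

/-- Powers are Lipschitz on the compact set of values of two positive continuous functions. -/
lemma exists_abs_rpow_sub_le {X : Type*} [TopologicalSpace X] {Q : Set X} (hQ : IsCompact Q)
    {f g : X → ℝ} (hf : ContinuousOn f Q) (hg : ContinuousOn g Q) (hf0 : ∀ x ∈ Q, 0 < f x)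
    (hg0 : ∀ x ∈ Q, 0 < g x) (a : ℝ) :
    ∃ L : ℝ, 0 ≤ L ∧ ∀ x ∈ Q, |f x ^ a - g x ^ a| ≤ L * |f x - g x| := by
  rcases Q.eq_empty_or_nonempty with rfl | hne
  · exact ⟨0, le_rfl, fun x hx => absurd hx (notMem_empty x)⟩
  obtain ⟨y, hy, hmin⟩ := hQ.exists_isMinOn hne (ContinuousOn.inf hf hg)
  obtain ⟨z, hz, hmax⟩ := hQ.exists_isMaxOn hne (ContinuousOn.sup hf hg)
  have hm : 0 < min (f y) (g y) := lt_min (hf0 y hy) (hg0 y hy)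
  have hC : ContDiffOn ℝ 1 (fun r : ℝ => r ^ a) (Icc (min (f y) (g y)) (max (f z) (g z))) :=
    contDiffOn_id.rpow_const_of_ne fun r hr => (hm.trans_le hr.1).ne'
  obtain ⟨L, hL⟩ := hC.exists_lipschitzOnWith one_ne_zero (convex_Icc _ _) isCompact_Icc
  refine ⟨L, L.2, fun x hx => ?_⟩
  have h1 : min (f y) (g y) ≤ min (f x) (g x) := hmin hx
  have h2 : max (f x) (g x) ≤ max (f z) (g z) := hmax hx
  have := hL.dist_le_mul (f x) ⟨h1.trans (min_le_left _ _), (le_max_left _ _).trans h2⟩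
    (g x) ⟨h1.trans (min_le_right _ _), (le_max_right _ _).trans h2⟩
  simpa [Real.dist_eq] using this

section family

variable {s : ℕ} {T : RungeKutta s} {α β τ τ₀ : ℝ}

lemma ContinuousFamily.continuousOn {f : ℝ → Space d → ℝ} (hf : ContinuousFamily Ω τ₀ f) :
    ContinuousOn (fun p : ℝ × Space d => f p.1 p.2) (Ico 0 τ₀ ×ˢ closure Ω) := by
  have h := (hf 0).eval_const (0 : Fin 0 → Space d)
  simpa only [iteratedFDerivWithin_zero_apply] using h

lemma ContinuousFamily.continuousOn_pd (hΩ : IsSmoothConvexDomain Ω) {f : ℝ → Space d → ℝ}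
    (hf : ContinuousFamily Ω τ₀ f) (j : Fin d) :
    ContinuousOn (fun p : ℝ × Space d => pd (closure Ω) j (f p.1) p.2)
      (Ico 0 τ₀ ×ˢ closure Ω) := by
  have h := (hf 1).eval_const (fun _ : Fin 1 => (EuclideanSpace.single j 1 : Space d))
  refine h.congr fun p hp => ?_
  beta_reduce
  rw [iteratedFDerivWithin_one_apply (hΩ.uniqueDiffOn p.2 hp.2)]
  rfl

/-- The integrand of `IsStep.le_entropy_sub` divided by the square of the step size. The gradient of
`w ^ β - u ^ β`, for a stage `w`, has been expanded so that it has a limit at step size zero after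
division by the step size. -/
def defect (T : RungeKutta s) (Ω : Set (Space d)) (β α τ : ℝ) (v u : Space d → ℝ)
    (K : Fin s → Space d → ℝ) (x : Space d) : ℝ :=
  increment T K x ^ 2 / 2 * min (u x ^ (α - 1)) (v x ^ (α - 1))
    + u x ^ (α - 1) * (β * ∑ i, T.b i * (stage T τ v K i x ^ (β - 1) *
        (∑ j, pd (closure Ω) j u x * pd (closure Ω) j (stageShift T K i) x)
      + gradSq Ω u x * ((stage T τ v K i x ^ (β - 1) - u x ^ (β - 1)) / τ)))

lemma IsStep.integral_defect_le {v u : Space d → ℝ} {K : Fin s → Space d → ℝ}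
    (h : IsStep T Ω β τ v u K) (hΩ : IsSmoothConvexDomain Ω)
    (hT : ∑ i, T.b i = 1) (hα : 0 < α) (hτ : 0 < τ) :
    τ ^ 2 * ∫ x in Ω, defect T Ω β α τ v u K x
      ≤ entropy Ω α v - entropy Ω α u - τ * production Ω α β u := by
  refine le_of_eq_of_le ?_ (h.le_entropy_sub hΩ hT hα)
  rw [← integral_const_mul]
  refine setIntegral_congr_fun hΩ.isOpen.measurableSet fun x hx => ?_
  have hs := hΩ.uniqueDiffOn
  have hx' := subset_closure hx
  have hu := h.new_admissible
  have hux := hu.2.1 x hx'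
  have e1 : ∀ i j, pd (closure Ω) j (fun y => stage T τ v K i y ^ β) x
      - pd (closure Ω) j (fun y => u y ^ β) x
      = β * stage T τ v K i x ^ (β - 1) * (pd (closure Ω) j u x
        + τ * pd (closure Ω) j (stageShift T K i) x)
        - β * u x ^ (β - 1) * pd (closure Ω) j u x := by
    intro i j
    have hst := h.stage_admissible i
    have hsh := h.stageShift_smooth i
    rw [pd_rpow hs hst.1 hx' (hst.2.1 x hx'), pd_rpow hs hu.1 hx' hux,
      pd_congr (f := stage T τ v K i) hΩ (fun z hz => h.stage_eq i hz) hx,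
      pd_add hs hu.1 (contDiffOn_const.mul hsh) hx', pd_const_mul hs hsh hx']
  have e2 : ∀ i, ∑ j, pd (closure Ω) j u x * (pd (closure Ω) j (fun y => stage T τ v K i y ^ β) x
      - pd (closure Ω) j (fun y => u y ^ β) x)
      = τ * (β * (stage T τ v K i x ^ (β - 1) *
        (∑ j, pd (closure Ω) j u x * pd (closure Ω) j (stageShift T K i) x)
      + gradSq Ω u x * ((stage T τ v K i x ^ (β - 1) - u x ^ (β - 1)) / τ))) := by
    intro i
    have : τ * (β * (stage T τ v K i x ^ (β - 1) *
        (∑ j, pd (closure Ω) j u x * pd (closure Ω) j (stageShift T K i) x)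
      + gradSq Ω u x * ((stage T τ v K i x ^ (β - 1) - u x ^ (β - 1)) / τ)))
      = β * (τ * stage T τ v K i x ^ (β - 1) *
        (∑ j, pd (closure Ω) j u x * pd (closure Ω) j (stageShift T K i) x)
      + (stage T τ v K i x ^ (β - 1) - u x ^ (β - 1)) * gradSq Ω u x) := by
      field_simp
    rw [this, gradSq, Finset.mul_sum, Finset.mul_sum, ← Finset.sum_add_distrib, Finset.mul_sum]
    refine Finset.sum_congr rfl fun j _ => ?_
    rw [e1]; ring
  have e3 : ∑ i, T.b i * ∑ j, pd (closure Ω) j u x * (pd (closure Ω) j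
        (fun y => stage T τ v K i y ^ β) x - pd (closure Ω) j (fun y => u y ^ β) x)
      = τ * (β * ∑ i, T.b i * (stage T τ v K i x ^ (β - 1) *
        (∑ j, pd (closure Ω) j u x * pd (closure Ω) j (stageShift T K i) x)
      + gradSq Ω u x * ((stage T τ v K i x ^ (β - 1) - u x ^ (β - 1)) / τ))) := by
    rw [Finset.mul_sum, Finset.mul_sum]
    exact Finset.sum_congr rfl fun i _ => by rw [e2]; ring
  simp only [e3, defect]
  ring

end family

end

section

/-! ### The limit of small step sizes -/

variable {d : ℕ} {Ω : Set (Space d)}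

section limit

variable {s : ℕ} {T : RungeKutta s} {α β τ τ₀ : ℝ}
  {v u : ℝ → Space d → ℝ} {K : ℝ → Fin s → Space d → ℝ}

lemma pd_sum_const_mul (hΩ : IsSmoothConvexDomain Ω) {F : Fin s → Space d → ℝ}
    (hF : ∀ i, ContDiffOn ℝ ∞ (F i) (closure Ω)) (a : Fin s → ℝ) {x : Space d}
    (hx : x ∈ closure Ω) (j : Fin d) :
    pd (closure Ω) j (fun z => ∑ i, a i * F i z) x = ∑ i, a i * pd (closure Ω) j (F i) x := by
  rw [pd_sum hΩ.uniqueDiffOn (fun i _ => contDiffOn_const.mul (hF i)) hx]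
  exact Finset.sum_congr rfl fun i _ => pd_const_mul hΩ.uniqueDiffOn (hF i) hx _

namespace IsStepFamily

lemma continuousOn_increment (h : IsStepFamily T Ω β τ₀ v u K) :
    ContinuousOn (fun p : ℝ × Space d => increment T (K p.1) p.2) (Ico 0 τ₀ ×ˢ closure Ω) :=
  continuousOn_finsetSum _ fun i _ =>
    continuousOn_const.mul (h.increment_continuous i).continuousOn

lemma continuousOn_stage (h : IsStepFamily T Ω β τ₀ v u K) (i : Fin s) :
    ContinuousOn (fun p : ℝ × Space d => stage T p.1 (v p.1) (K p.1) i p.2)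
      (Ico 0 τ₀ ×ˢ closure Ω) :=
  h.old_continuous.continuousOn.add (continuousOn_fst.mul (continuousOn_finsetSum _ fun j _ =>
    continuousOn_const.mul (h.increment_continuous j).continuousOn))

lemma continuousOn_stageShift (h : IsStepFamily T Ω β τ₀ v u K) (i : Fin s) :
    ContinuousOn (fun p : ℝ × Space d => stageShift T (K p.1) i p.2) (Ico 0 τ₀ ×ˢ closure Ω) :=
  (continuousOn_finsetSum _ fun j _ =>
    continuousOn_const.mul (h.increment_continuous j).continuousOn).sub h.continuousOn_increment

lemma continuousOn_pd_stageShift (h : IsStepFamily T Ω β τ₀ v u K)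
    (hΩ : IsSmoothConvexDomain Ω) (i : Fin s) (j : Fin d) :
    ContinuousOn (fun p : ℝ × Space d => pd (closure Ω) j (stageShift T (K p.1) i) p.2)
      (Ico 0 τ₀ ×ˢ closure Ω) := by
  have hc : ∀ a : Fin s → ℝ, ContinuousOn (fun p : ℝ × Space d =>
      ∑ k, a k * pd (closure Ω) j (K p.1 k) p.2) (Ico 0 τ₀ ×ˢ closure Ω) := fun a =>
    continuousOn_finsetSum _ fun k _ =>
      continuousOn_const.mul ((h.increment_continuous k).continuousOn_pd hΩ j)
  refine ((hc (T.a i)).sub (hc T.b)).congr fun p hp => ?_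
  have hK := fun k => (h.isStep p.1 hp.1).increment_smooth k
  have e := pd_sub (i := j) hΩ.uniqueDiffOn (f := fun z => ∑ k, T.a i k * K p.1 k z)
    (g := fun z => ∑ k, T.b k * K p.1 k z)
    (ContDiffOn.sum fun k _ => contDiffOn_const.mul (hK k))
    (ContDiffOn.sum fun k _ => contDiffOn_const.mul (hK k)) hp.2
  rw [pd_sum_const_mul hΩ hK _ hp.2, pd_sum_const_mul hΩ hK _ hp.2] at e
  exact e

lemma continuousOn_gradSq (h : IsStepFamily T Ω β τ₀ v u K) (hΩ : IsSmoothConvexDomain Ω) :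
    ContinuousOn (fun p : ℝ × Space d => gradSq Ω (u p.1) p.2) (Ico 0 τ₀ ×ˢ closure Ω) :=
  continuousOn_finsetSum _ fun j _ => (h.new_continuous.continuousOn_pd hΩ j).pow 2

/-- Uniform bound for the density of the defect, for `α` in a bounded set and small step sizes. -/
lemma exists_abs_defect_le (h : IsStepFamily T Ω β τ₀ v u K)
    (hΩ : IsSmoothConvexDomain Ω) {τ₁ : ℝ} (hτ₁ : τ₁ < τ₀) (A B : ℝ) :
    ∃ M : ℝ, ∀ τ ∈ Ioc 0 τ₁, ∀ α ∈ Icc A B, ∀ x ∈ Ω,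
      |defect T Ω β α τ (v τ) (u τ) (K τ) x| ≤ M := by
  have hsub : Icc 0 τ₁ ×ˢ closure Ω ⊆ Ico 0 τ₀ ×ˢ closure Ω :=
    prod_mono (Icc_subset_Ico_right hτ₁) Subset.rfl
  have hQ : IsCompact (Icc 0 τ₁ ×ˢ closure Ω) := isCompact_Icc.prod hΩ.isCompact_closure
  have hAQ : IsCompact (Icc A B ×ˢ (Icc 0 τ₁ ×ˢ closure Ω)) := isCompact_Icc.prod hQ
  -- pull a function of `(τ, x)` back to `(α, τ, x)`
  have lift : ∀ {f : ℝ × Space d → ℝ}, ContinuousOn f (Ico 0 τ₀ ×ˢ closure Ω) →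
      ContinuousOn (fun z : ℝ × ℝ × Space d => f z.2) (Icc A B ×ˢ (Icc 0 τ₁ ×ˢ closure Ω)) :=
    fun hf => hf.comp continuousOn_snd fun z hz => hsub hz.2
  have hu0 : ∀ p ∈ Ico 0 τ₀ ×ˢ closure Ω, 0 < u p.1 p.2 := fun p hp =>
    (h.isStep p.1 hp.1).new_admissible.2.1 p.2 hp.2
  have hv0 : ∀ p ∈ Ico 0 τ₀ ×ˢ closure Ω, 0 < v p.1 p.2 := fun p hp =>
    (h.isStep p.1 hp.1).old_admissible.2.1 p.2 hp.2
  have hw0 : ∀ i, ∀ p ∈ Ico 0 τ₀ ×ˢ closure Ω, 0 < stage T p.1 (v p.1) (K p.1) i p.2 :=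
    fun i p hp => ((h.isStep p.1 hp.1).stage_admissible i).2.1 p.2 hp.2
  have hα : ContinuousOn (fun z : ℝ × ℝ × Space d => z.1 - 1)
      (Icc A B ×ˢ (Icc 0 τ₁ ×ˢ closure Ω)) := by fun_prop
  have hcu : ContinuousOn (fun z : ℝ × ℝ × Space d => u z.2.1 z.2.2 ^ (z.1 - 1))
      (Icc A B ×ˢ (Icc 0 τ₁ ×ˢ closure Ω)) :=
    (lift h.new_continuous.continuousOn).rpow hα fun z hz => Or.inl (hu0 z.2 (hsub hz.2)).ne'
  have hcv : ContinuousOn (fun z : ℝ × ℝ × Space d => v z.2.1 z.2.2 ^ (z.1 - 1))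
      (Icc A B ×ˢ (Icc 0 τ₁ ×ˢ closure Ω)) :=
    (lift h.old_continuous.continuousOn).rpow hα fun z hz => Or.inl (hv0 z.2 (hsub hz.2)).ne'
  have hcw : ∀ i, ContinuousOn (fun z : ℝ × ℝ × Space d =>
      stage T z.2.1 (v z.2.1) (K z.2.1) i z.2.2 ^ (β - 1))
      (Icc A B ×ˢ (Icc 0 τ₁ ×ˢ closure Ω)) := fun i =>
    (lift (h.continuousOn_stage i)).rpow_const fun z hz => Or.inl (hw0 i z.2 (hsub hz.2)).ne'
  obtain ⟨M₁, hM₁⟩ := hAQ.exists_bound_of_continuousOn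
    (((lift h.continuousOn_increment).pow 2).div_const 2 |>.mul (ContinuousOn.inf hcu hcv))
  obtain ⟨M₂, hM₂⟩ := hAQ.exists_bound_of_continuousOn hcu
  have hc3 : ∀ i, ContinuousOn (fun z : ℝ × ℝ × Space d =>
      stage T z.2.1 (v z.2.1) (K z.2.1) i z.2.2 ^ (β - 1) *
        ∑ j, pd (closure Ω) j (u z.2.1) z.2.2 *
          pd (closure Ω) j (stageShift T (K z.2.1) i) z.2.2)
      (Icc A B ×ˢ (Icc 0 τ₁ ×ˢ closure Ω)) := fun i =>
    (hcw i).mul (continuousOn_finsetSum _ fun j _ =>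
      (lift (h.new_continuous.continuousOn_pd hΩ j)).mul
        (lift (h.continuousOn_pd_stageShift hΩ i j)))
  choose M₃ hM₃ using fun i => hAQ.exists_bound_of_continuousOn (hc3 i)
  obtain ⟨M₄, hM₄⟩ := hAQ.exists_bound_of_continuousOn (lift (h.continuousOn_gradSq hΩ))
  choose M₅ hM₅ using fun i => hAQ.exists_bound_of_continuousOn
    (lift (h.continuousOn_stageShift i))
  choose L hL0 hL using fun i => exists_abs_rpow_sub_le hQ ((h.continuousOn_stage i).mono hsub)
    (h.new_continuous.continuousOn.mono hsub) (fun p hp => hw0 i p (hsub hp))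
    (fun p hp => hu0 p (hsub hp)) (β - 1)
  refine ⟨M₁ + M₂ * (|β| * ∑ i, |T.b i| * (M₃ i + M₄ * (L i * M₅ i))), fun τ hτ α hα x hx => ?_⟩
  have hx' := subset_closure hx
  have hz : ((α, τ, x) : ℝ × ℝ × Space d) ∈ Icc A B ×ˢ (Icc 0 τ₁ ×ˢ closure Ω) :=
    ⟨hα, ⟨hτ.1.le, hτ.2⟩, hx'⟩
  have hstep := h.isStep τ ⟨hτ.1.le, hτ.2.trans_lt hτ₁⟩
  have b1 := hM₁ _ hz
  have b2 := hM₂ _ hz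
  have b4 := hM₄ _ hz
  simp only [Real.norm_eq_abs] at b1 b2 b4
  have hM₂0 := (abs_nonneg _).trans b2
  have hM₄0 := (abs_nonneg _).trans b4
  have hquot : ∀ i, |(stage T τ (v τ) (K τ) i x ^ (β - 1) - u τ x ^ (β - 1)) / τ| ≤ L i * M₅ i := by
    intro i
    have h1 := hL i (τ, x) hz.2
    have h2 := hM₅ i _ hz
    simp only [Real.norm_eq_abs] at h1 h2
    rw [abs_div, abs_of_pos hτ.1, div_le_iff₀ hτ.1]
    refine h1.trans ?_
    rw [hstep.stage_eq i hx, add_sub_cancel_left, abs_mul, abs_of_pos hτ.1, mul_assoc]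
    refine mul_le_mul_of_nonneg_left ?_ (hL0 i)
    rw [mul_comm]
    exact mul_le_mul_of_nonneg_right h2 hτ.1.le
  have hterm : ∀ i, |T.b i * (stage T τ (v τ) (K τ) i x ^ (β - 1) *
        (∑ j, pd (closure Ω) j (u τ) x * pd (closure Ω) j (stageShift T (K τ) i) x)
      + gradSq Ω (u τ) x * ((stage T τ (v τ) (K τ) i x ^ (β - 1) - u τ x ^ (β - 1)) / τ))|
      ≤ |T.b i| * (M₃ i + M₄ * (L i * M₅ i)) := by
    intro i
    have h3 := hM₃ i _ hz
    simp only [Real.norm_eq_abs] at h3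
    rw [abs_mul]
    refine mul_le_mul_of_nonneg_left ?_ (abs_nonneg _)
    refine (abs_add_le _ _).trans (add_le_add h3 ?_)
    rw [abs_mul]
    exact mul_le_mul b4 (hquot i) (abs_nonneg _) hM₄0
  refine (abs_add_le _ _).trans (add_le_add b1 ?_)
  rw [abs_mul, abs_mul]
  refine mul_le_mul b2 ?_ (by positivity) hM₂0
  refine mul_le_mul_of_nonneg_left ?_ (abs_nonneg _)
  exact (Finset.abs_sum_le_sum_abs _ _).trans (Finset.sum_le_sum fun i _ => hterm i)

lemma continuousOn_defect (h : IsStepFamily T Ω β τ₀ v u K)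
    (hΩ : IsSmoothConvexDomain Ω) (hτ : τ ∈ Ico 0 τ₀) (α : ℝ) :
    ContinuousOn (defect T Ω β α τ (v τ) (u τ) (K τ)) (closure Ω) := by
  have hst := h.isStep τ hτ
  have hs := hΩ.uniqueDiffOn
  have hu := hst.new_admissible
  have hv := hst.old_admissible
  have cu := fun a => (rpow_smooth hu.1 hu.2.1 a).continuousOn
  have cv := fun a => (rpow_smooth hv.1 hv.2.1 a).continuousOn
  have cw := fun i a => (rpow_smooth (hst.stage_admissible i).1
    (hst.stage_admissible i).2.1 a).continuousOn
  exact (((hst.increment_smooth'.continuousOn.pow 2).div_const 2).mul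
      (ContinuousOn.inf (cu _) (cv _))).add ((cu _).mul (continuousOn_const.mul
    (continuousOn_finsetSum _ fun i _ => continuousOn_const.mul
      (((cw i _).mul (continuousOn_finsetSum _ fun j _ => (pd_smooth hs hu.1 j).continuousOn.mul
        (pd_smooth hs (hst.stageShift_smooth i) j).continuousOn)).add
          ((gradSq_smooth hΩ hu.1).continuousOn.mul (((cw i _).sub (cu _)).div_const _))))))

/-- At step size zero all increments equal `Δ(u ^ β)`. -/
lemma increment_zero (h : IsStepFamily T Ω β τ₀ v u K)
    (hΩ : IsSmoothConvexDomain Ω) (hτ₀ : 0 < τ₀) (i : Fin s) {x : Space d}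
    (hx : x ∈ Ω) : K 0 i x = lap Ω (fun z => u 0 z ^ β) x := by
  have hst := h.isStep 0 ⟨le_rfl, hτ₀⟩
  rw [hst.increment_eq_lap hΩ i hx]
  exact lap_congr hΩ (fun z hz => by simp only [hst.stage_eq i hz, zero_mul, add_zero]) hx

lemma sum_increment_zero (h : IsStepFamily T Ω β τ₀ v u K)
    (hΩ : IsSmoothConvexDomain Ω) (hτ₀ : 0 < τ₀) (hT : T.IsConsistent)
    {x : Space d} (hx : x ∈ Ω) : increment T (K 0) x = lap Ω (fun z => u 0 z ^ β) x := by
  simp only [increment, h.increment_zero hΩ hτ₀ _ hx, ← Finset.sum_mul, hT.2, one_mul]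

lemma stageShift_zero (h : IsStepFamily T Ω β τ₀ v u K)
    (hΩ : IsSmoothConvexDomain Ω) (hτ₀ : 0 < τ₀) (hT : T.IsConsistent)
    (i : Fin s) {x : Space d} (hx : x ∈ Ω) :
    stageShift T (K 0) i x = (T.c i - 1) * lap Ω (fun z => u 0 z ^ β) x := by
  simp only [stageShift, h.sum_increment_zero hΩ hτ₀ hT hx, h.increment_zero hΩ hτ₀ _ hx,
    ← Finset.sum_mul, hT.1]
  ring

lemma pd_stageShift_zero (h : IsStepFamily T Ω β τ₀ v u K)
    (hΩ : IsSmoothConvexDomain Ω) (hτ₀ : 0 < τ₀) (hT : T.IsConsistent)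
    (i : Fin s) (j : Fin d) {x : Space d} (hx : x ∈ Ω) :
    pd (closure Ω) j (stageShift T (K 0) i) x
      = (T.c i - 1) * pd (closure Ω) j (lap Ω fun z => u 0 z ^ β) x := by
  have hu := (h.isStep 0 ⟨le_rfl, hτ₀⟩).new_admissible
  rw [pd_congr hΩ (fun z hz => h.stageShift_zero hΩ hτ₀ hT i hz) hx,
    pd_const_mul hΩ.uniqueDiffOn (lap_smooth hΩ (rpow_smooth hu.1 hu.2.1 β)) (subset_closure hx)]

/-- The limit of the defect involves the scheme only through `T.CRK`, because all stages agree with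
the new state to zeroth order and differ from it by `(cᵢ - 1) τ Δ(u ^ β)` to first order. -/
lemma tendsto_defect (h : IsStepFamily T Ω β τ₀ v u K)
    (hΩ : IsSmoothConvexDomain Ω) (hτ₀ : 0 < τ₀) (hT : T.IsConsistent)
    (α₀ : ℝ) {x : Space d} (hx : x ∈ Ω) :
    Tendsto (fun p : ℝ × ℝ => defect T Ω β p.2 p.1 (v p.1) (u p.1) (K p.1) x)
      (𝓝[>] 0 ×ˢ 𝓝 α₀)
      (𝓝 (1 / 2 * (u 0 x ^ (α₀ - 1) * (lap Ω (fun z => u 0 z ^ β) x ^ 2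
      - T.CRK * (β * (u 0 x ^ (β - 1) * (∑ j, pd (closure Ω) j (u 0) x
          * pd (closure Ω) j (lap Ω fun z => u 0 z ^ β) x)
        + gradSq Ω (u 0) x * ((β - 1) * u 0 x ^ (β - 2)
          * lap Ω (fun z => u 0 z ^ β) x))))))) := by
  have hx' := subset_closure hx
  have hst := h.isStep 0 ⟨le_rfl, hτ₀⟩
  set l : Filter (ℝ × ℝ) := 𝓝[>] 0 ×ˢ 𝓝 α₀ with hl
  have hτ : ∀ᶠ p : ℝ × ℝ in l, p.1 ∈ Ioo 0 τ₀ :=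
    tendsto_fst.eventually (Ioo_mem_nhdsGT hτ₀)
  have key : ∀ {f : ℝ × Space d → ℝ}, ContinuousOn f (Ico 0 τ₀ ×ˢ closure Ω) →
      Tendsto (fun p : ℝ × ℝ => f (p.1, x)) l (𝓝 (f (0, x))) := by
    intro f hf
    refine (hf (0, x) ⟨⟨le_rfl, hτ₀⟩, hx'⟩).tendsto.comp (tendsto_nhdsWithin_iff.2 ⟨?_, ?_⟩)
    · exact (tendsto_fst.mono_right nhdsWithin_le_nhds).prodMk_nhds tendsto_const_nhds
    · filter_upwards [hτ] with p hp using ⟨⟨hp.1.le, hp.2⟩, hx'⟩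
  have hux : 0 < u 0 x := hst.new_admissible.2.1 x hx'
  have hvu : v 0 x = u 0 x := by rw [hst.update_eq x hx, zero_mul, add_zero]
  have hwu : ∀ i, stage T 0 (v 0) (K 0) i x = u 0 x := fun i => by
    rw [hst.stage_eq i hx, zero_mul, add_zero]
  have hα : Tendsto (fun p : ℝ × ℝ => p.2 - 1) l (𝓝 (α₀ - 1)) :=
    (tendsto_snd (f := 𝓝[>] (0 : ℝ)) (g := 𝓝 α₀)).sub_const 1
  have tu := key h.new_continuous.continuousOn
  have tv := key h.old_continuous.continuousOn
  rw [hvu] at tv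
  have tua := tu.rpow hα (Or.inl hux.ne')
  have tva := tv.rpow hα (Or.inl hux.ne')
  have tκ := key h.continuousOn_increment
  have tw : ∀ i, Tendsto (fun p : ℝ × ℝ => stage T p.1 (v p.1) (K p.1) i x) l (𝓝 (u 0 x)) :=
    fun i => by simpa only [hwu] using key (h.continuousOn_stage i)
  have te := fun i => key (h.continuousOn_stageShift i)
  have tpu := fun j => key (h.new_continuous.continuousOn_pd hΩ j)
  have tpe := fun i j => key (h.continuousOn_pd_stageShift hΩ i j)
  have tq := fun i => tendsto_rpow_quotient (a := β - 1) (t := fun p : ℝ × ℝ => p.1) hux tu (tw i)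
    (te i) (by
      filter_upwards [hτ] with p hp using
        ⟨(h.isStep p.1 ⟨hp.1.le, hp.2⟩).stage_eq i hx, hp.1.ne'⟩)
  have tall := (((tκ.pow 2).div_const 2).mul (tua.min tva)).add (tua.mul ((tendsto_finsetSum
    Finset.univ fun i _ => ((((tw i).rpow_const (p := β - 1) (Or.inl hux.ne')).mul
      (tendsto_finsetSum Finset.univ fun j _ => (tpu j).mul (tpe i j))).add
        ((key (h.continuousOn_gradSq hΩ)).mul (tq i))).const_mul (T.b i)).const_mul β))
  refine tall.trans (le_of_eq (congrArg 𝓝 ?_))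
  simp only [h.sum_increment_zero hΩ hτ₀ hT hx, h.stageShift_zero hΩ hτ₀ hT _ hx,
    h.pd_stageShift_zero hΩ hτ₀ hT _ _ hx, min_self]
  have hC : ∑ i, T.b i * (T.c i - 1) = -(T.CRK / 2) := by
    rw [RungeKutta.CRK, mul_div_cancel_left₀ _ two_ne_zero, ← Finset.sum_neg_distrib]
    exact Finset.sum_congr rfl fun i _ => by ring
  have hsum : ∑ i, T.b i * (u 0 x ^ (β - 1) * (∑ j, pd (closure Ω) j (u 0) x *
      ((T.c i - 1) * pd (closure Ω) j (lap Ω fun z => u 0 z ^ β) x))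
      + gradSq Ω (u 0) x * ((β - 1) * u 0 x ^ (β - 1 - 1)
        * ((T.c i - 1) * lap Ω (fun z => u 0 z ^ β) x)))
      = -(T.CRK / 2) * (u 0 x ^ (β - 1) * (∑ j, pd (closure Ω) j (u 0) x *
        pd (closure Ω) j (lap Ω fun z => u 0 z ^ β) x)
      + gradSq Ω (u 0) x * ((β - 1) * u 0 x ^ (β - 2) * lap Ω (fun z => u 0 z ^ β) x)) := by
    rw [← hC, Finset.sum_mul]
    refine Finset.sum_congr rfl fun i _ => ?_
    rw [show β - 1 - 1 = β - 2 by ring]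
    have : ∑ j, pd (closure Ω) j (u 0) x *
      ((T.c i - 1) * pd (closure Ω) j (lap Ω fun z => u 0 z ^ β) x)
      = (T.c i - 1) * ∑ j, pd (closure Ω) j (u 0) x *
        pd (closure Ω) j (lap Ω fun z => u 0 z ^ β) x := by
      rw [Finset.mul_sum]; exact Finset.sum_congr rfl fun j _ => by ring
    rw [this]; ring
  rw [hsum]
  ring

/-- As the step size tends to zero, the integral of the defect tends to half the second
variation. -/
theorem tendsto_integral_defect (h : IsStepFamily T Ω β τ₀ v u K)
    (hΩ : IsSmoothConvexDomain Ω) (hβ : 0 < β) (hτ₀ : 0 < τ₀)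
    (hT : T.IsConsistent) (α₀ : ℝ) :
    Tendsto (fun p : ℝ × ℝ => ∫ x in Ω, defect T Ω β p.2 p.1 (v p.1) (u p.1) (K p.1) x)
      (𝓝[>] 0 ×ˢ 𝓝 α₀)
      (𝓝 (1 / 2 * (β ^ 2 * ∫ x in Ω, Real.exp ((2 * β + α₀ - 1) * Real.log (u 0 x))
        * secondVar Ω T.CRK α₀ β (fun z => Real.log (u 0 z)) x))) := by
  have hst := h.isStep 0 ⟨le_rfl, hτ₀⟩
  obtain ⟨M, hM⟩ := h.exists_abs_defect_le hΩ (τ₁ := τ₀ / 2) (by linarith) (α₀ - 1) (α₀ + 1)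
  have hτ : ∀ᶠ p : ℝ × ℝ in 𝓝[>] 0 ×ˢ 𝓝 α₀, p.1 ∈ Ioc 0 (τ₀ / 2) :=
    tendsto_fst.eventually (Ioc_mem_nhdsGT (half_pos hτ₀))
  have hα : ∀ᶠ p : ℝ × ℝ in 𝓝[>] 0 ×ˢ 𝓝 α₀, p.2 ∈ Icc (α₀ - 1) (α₀ + 1) :=
    tendsto_snd.eventually (Icc_mem_nhds (by linarith) (by linarith))
  rw [← integral_secondVariation_eq hΩ hβ hst.new_admissible, ← integral_const_mul]
  refine tendsto_integral_filter_of_dominated_convergence (fun _ => M) ?_ ?_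
    (integrableOn_const hΩ.volume_ne_top) ?_
  · filter_upwards [hτ] with p hp
    exact (hΩ.integrableOn (h.continuousOn_defect hΩ
      ⟨hp.1.le, by linarith [hp.2]⟩ p.2)).aestronglyMeasurable
  · filter_upwards [hτ, hα] with p hp hp'
    filter_upwards [ae_restrict_mem hΩ.isOpen.measurableSet] with x hx
    exact hM p.1 hp p.2 hp' x hx
  · filter_upwards [ae_restrict_mem hΩ.isOpen.measurableSet] with x hx
    exact h.tendsto_defect hΩ hτ₀ hT α₀ hx

/-- The discrete entropy inequality, uniformly for exponents in a compact set of feasible ones. -/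
theorem exists_entropy_le (h : IsStepFamily T Ω β τ₀ v u K)
    (hΩ : IsSmoothConvexDomain Ω) (hβ : 0 < β) (hτ₀ : 0 < τ₀)
    (hT : T.IsConsistent) (hC : 0 ≤ T.CRK) (hne : ¬ ∃ c : ℝ, ∀ x ∈ Ω, u 0 x = c) (b : ℝ) :
    ∃ τk : ℝ, 0 < τk ∧ τk < τ₀ ∧ ∀ α ∈ Ioc 0 b, Feasible d T.CRK α β →
      ∀ τ : ℝ, 0 < τ → τ ≤ τk →
        entropy Ω α (u τ) + τ * production Ω α β (u τ) ≤ entropy Ω α (v τ) := by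
  have hst := h.isStep 0 ⟨le_rfl, hτ₀⟩
  have hu := hst.new_admissible
  have hnew : ¬ ∃ c : ℝ, ∀ x ∈ Ω, Real.log (u 0 x) = c := by
    rintro ⟨c, hc⟩
    refine hne ⟨Real.exp c, fun x hx => ?_⟩
    rw [← hc x hx, Real.exp_log (hu.2.1 x (subset_closure hx))]
  -- the integral of the defect has a positive limit at `(0, α₀)`; compactness of the set of
  -- feasible exponents then gives a common bound for the step size
  have hpos : ∀ α₀ ∈ {α : ℝ | α ∈ Icc 0 b ∧ Feasible d T.CRK α β},
      ∀ᶠ z : ℝ × ℝ in 𝓝 ((0, α₀) : ℝ × ℝ), 0 < z.1 →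
        0 < ∫ x in Ω, defect T Ω β z.2 z.1 (v z.1) (u z.1) (K z.1) x := by
    rintro α₀ ⟨-, c₁, c₂, hc₁, hQ⟩
    have hlim := integral_secondVar_pos hΩ (log_smooth hu.1 hu.2.1) (neumann_log hΩ hβ hu) hnew
      hC hc₁ hQ
    have hev := (h.tendsto_integral_defect hΩ hβ hτ₀ hT α₀).eventually_const_lt (u := 0)
      (by positivity)
    rw [← nhdsWithin_univ α₀, ← nhdsWithin_prod_eq, eventually_nhdsWithin_iff] at hev
    filter_upwards [hev] with z hz h0 using hz ⟨h0, mem_univ _⟩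
  have hall := (isCompact_feasible hΩ.one_le_dim hC β b).eventually_forall_of_forall_eventually
    (P := fun τ α => 0 < τ → 0 < ∫ x in Ω, defect T Ω β α τ (v τ) (u τ) (K τ) x) hpos
  obtain ⟨e, he, hball⟩ := Metric.eventually_nhds_iff.1 hall
  refine ⟨min (e / 2) (τ₀ / 2), lt_min (half_pos he) (half_pos hτ₀),
    (min_le_right _ _).trans_lt (half_lt_self hτ₀), fun α hα hF τ hτ hle => ?_⟩
  have h1 := hle.trans (min_le_left _ _)
  have h2 := hle.trans (min_le_right _ _)
  have hint := hball (y := τ) (by rw [Real.dist_eq, sub_zero, abs_of_pos hτ]; linarith) α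
    ⟨⟨hα.1.le, hα.2⟩, hF⟩ hτ
  have hle' := (h.isStep τ ⟨hτ.le, by linarith⟩).integral_defect_le hΩ hT.2 hα.1 hτ
  have : 0 < τ ^ 2 * ∫ x in Ω, defect T Ω β α τ (v τ) (u τ) (K τ) x := by positivity
  linarith

end IsStepFamily

end limit

end

end PorousMediumRK

end

open PorousMediumRK in
theorem theorem4 {s : ℕ} (T : PorousMediumRK.RungeKutta s)
    (hT : T.IsImplicitEuler ∨ T.HasOrderAtLeastTwo ∨ T.IsExplicitEuler) :
    (∀ d : ℕ, 1 ≤ d →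
      (PorousMediumRK.regionZero d T.CRK).Nonempty ∧
      IsOpen (PorousMediumRK.regionZero d T.CRK) ∧
      PorousMediumRK.regionZero d T.CRK ⊆ Set.Ioi 0 ×ˢ Set.Ioi 0 ∧
      ∀ Ω : Set (PorousMediumRK.Space d), IsOpen Ω → Bornology.IsBounded Ω → Convex ℝ Ω →
        PorousMediumRK.HasSmoothBoundary Ω →
      ∀ β : ℝ, 0 < β →
      ∀ τ₀ : ℝ, 0 < τ₀ →
      ∀ (uOld uNew : ℝ → PorousMediumRK.Space d → ℝ)
        (K : ℝ → Fin s → PorousMediumRK.Space d → ℝ),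
        PorousMediumRK.IsStepFamily T Ω β τ₀ uOld uNew K →
        (¬ ∃ c : ℝ, ∀ x ∈ Ω, uNew 0 x = c) →
        ∃ τk : ℝ, 0 < τk ∧ τk < τ₀ ∧
          ∀ α : ℝ, (α, β) ∈ PorousMediumRK.regionZero d T.CRK →
          ∀ τ : ℝ, 0 < τ → τ ≤ τk →
            PorousMediumRK.entropy Ω α (uNew τ)
                + τ * PorousMediumRK.production Ω α β (uNew τ)
              ≤ PorousMediumRK.entropy Ω α (uOld τ)) ∧
    (T.IsImplicitEuler →
      PorousMediumRK.regionZero 1 T.CRK = Set.Ioi 0 ×ˢ Set.Ioi 0) ∧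
    (T.HasOrderAtLeastTwo →
      PorousMediumRK.regionZero 1 T.CRK =
        {p : ℝ × ℝ | 0 < p.1 ∧ 0 < p.2 ∧ -2 < p.1 - p.2 ∧ p.1 - p.2 < 1}) ∧
    (T.IsExplicitEuler →
      PorousMediumRK.regionZero 1 T.CRK =
        {p : ℝ × ℝ | 0 < p.1 ∧ 0 < p.2 ∧ -1 < p.1 - p.2 ∧ p.1 - p.2 < 1}) := by
  have hC : 0 ≤ T.CRK := by
    rcases hT with h | h | h <;> rw [h.crk] <;> norm_num
  refine ⟨fun d hd => ⟨regionZero_nonempty hd hC, isOpen_interior,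
    interior_subset.trans fun p hp => ⟨hp.1, hp.2.1⟩, ?_⟩,
    fun h => by rw [h.crk, regionZero_one_zero], fun h => by rw [h.crk, regionZero_one_one],
    fun h => by rw [h.crk, regionZero_one_two]⟩
  intro Ω hopen hbdd hconv hsm β hβ τ₀ hτ₀ v u K h hne
  have hΩ : IsSmoothConvexDomain Ω := ⟨hd, hopen, hbdd, hconv, nonempty_iff_ne_empty.2 fun h0 =>
    hne ⟨0, by simp [h0]⟩, hsm⟩
  have hmem : ∀ {α}, (α, β) ∈ regionZero d T.CRK → 0 < α ∧ Feasible d T.CRK α β := fun hα =>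
    have hp := interior_subset hα
    ⟨hp.1, hp.2.2⟩
  -- the exponents `α` that are feasible for the given `β` are bounded
  have general (hcons : T.IsConsistent)
      (hle : ∀ {α}, Feasible d T.CRK α β → α ≤ β + 1) :
      ∃ τk : ℝ, 0 < τk ∧ τk < τ₀ ∧ ∀ α : ℝ, (α, β) ∈ regionZero d T.CRK →
        ∀ τ : ℝ, 0 < τ → τ ≤ τk →
          entropy Ω α (u τ) + τ * production Ω α β (u τ) ≤ entropy Ω α (v τ) := by
    obtain ⟨τk, h0, h1, H⟩ := h.exists_entropy_le hΩ hβ hτ₀ hcons hC hne (β + 1)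
    exact ⟨τk, h0, h1, fun α hα => H α ⟨(hmem hα).1, hle (hmem hα).2⟩ (hmem hα).2⟩
  rcases hT with hT | hT | hT
  · exact ⟨τ₀ / 2, half_pos hτ₀, half_lt_self hτ₀, fun α hα τ hτ hle =>
      (h.isStep τ ⟨hτ.le, hle.trans_lt (half_lt_self hτ₀)⟩).entropy_le_of_isImplicitEuler hΩ hT
        (hmem hα).1⟩
  · refine general hT.1 fun hF => ?_
    rw [hT.crk] at hF
    linarith [(hF.sub_mem_of_one hd).2]
  · refine general hT.isConsistent fun hF => ?_
    rw [hT.crk] at hF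
    linarith [(hF.sub_mem_of_two hd).2]
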